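/- Let $d\ge 2$, $Q=[0,1]^d\subset\mathbb R^d$ with the Euclidean distance and Lebesgue measure $\mathcal L^d$. For a Lipschitz function $g\colon Q\to\mathbb R$ let $\operatorname{Lip}(g)$ be its least Lipschitz constant and $\|g\|_\infty=\sup_Q|g|$. For a Lipschitz map $\pi=(\pi^1,\dots,\pi^d)\colon Q\to\mathbb R^d$ let $\det \mathrm D\pi$ be its Jacobian determinant, which is defined almost everywhere on $Q$. For Lipschitz $f\colon Q\to\mathbb R$ and $\pi\colon Q\to\mathbb R^d$ put $$s(f,\pi)=\max\{\operatorname{Lip}(f),\|f\|_\infty\}\prod_{j=1}^d\operatorname{Lip}(\pi^j).$$ **Theorem 1.1.** (1) There are functions $u_n\in L^1(Q)$, $n=1,2,3,\dots$, such that for every $n\ge 1$ we have $\|u_n\|_{L^1(Q)}\ge 1$ and $$\sup\Big\{\Big|\int_Q u_n\, f\det \mathrm D\pi\;\mathrm d\mathcal L^d\Big| : f\colon Q\to\mathbb R,\ \pi\colon Q\to\mathbb R^d \text{ Lipschitz},\ s(f,\pi)\le 1\Big\}\le \frac1n .$$ (2) Consequently, there is a $\rho\in L^\infty(Q)$ for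 which there are no sequences of Lipschitz maps $f_i\colon Q\to\mathbb R$ and $\pi_i\colon Q\to\mathbb R^d$ ($i\in\mathbb N$) such that $\sum_i s(f_i,\pi_i)<\infty$ and $$\sum_i f_i\det \mathrm D\pi_i=\rho\quad\text{a.e. on } Q,$$ the series converging absolutely in $L^\infty(Q)$. In particular, for this $\rho$ there is no Lipschitz map $\pi\colon Q\to\mathbb R^d$ with $\det \mathrm D\pi=\rho$ a.e. on $Q$. -/

import Mathlib

open MeasureTheory Filter Topology
open scoped NNReal ENNReal

namespace PrescribedJacobian

noncomputable section

/-- The unit cube `Q = [0,1]^d` in Euclidean space. -/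
def cube (d : ℕ) : Set (EuclideanSpace ℝ (Fin d)) :=
  {x | ∀ i, x i ∈ Set.Icc (0 : ℝ) 1}

/-- Lebesgue measure on `Q = [0,1]^d`. -/
def cubeVol (d : ℕ) : Measure (EuclideanSpace ℝ (Fin d)) :=
  volume.restrict (cube d)

/-- `g` is Lipschitz on `Q`. Functions on `Q` are represented by functions on the whole
space whose values off `Q` play no role in any of the notions below. -/
def IsLip {d : ℕ} {F : Type*} [PseudoEMetricSpace F]
    (g : EuclideanSpace ℝ (Fin d) → F) : Prop :=
  ∃ K : ℝ≥0, LipschitzOnWith K g (cube d)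

/-- `Lip(g)`: the least Lipschitz constant of `g` on `Q` (meaningful when `IsLip g`). -/
def lipConst {d : ℕ} (g : EuclideanSpace ℝ (Fin d) → ℝ) : ℝ :=
  ((sInf {K : ℝ≥0 | LipschitzOnWith K g (cube d)} : ℝ≥0) : ℝ)

/-- `‖g‖_∞`: the supremum of `|g|` over `Q` (meaningful when `g` is bounded on `Q`, for
instance when `IsLip g`). -/
def supNorm {d : ℕ} (g : EuclideanSpace ℝ (Fin d) → ℝ) : ℝ :=
  ⨆ x : cube d, |g x|

/-- The size `max {Lip f, ‖f‖_∞} * ∏ j, Lip (π^j)` of a pair `(f, π)`. -/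
def pairSize {d : ℕ} (f : EuclideanSpace ℝ (Fin d) → ℝ)
    (π : EuclideanSpace ℝ (Fin d) → EuclideanSpace ℝ (Fin d)) : ℝ :=
  max (lipConst f) (supNorm f) * ∏ j, lipConst (fun x => π x j)

/-- The Jacobian `det Dπ (x)`, the derivative being taken within `Q`. For Lipschitz `π` it
exists for almost every `x ∈ Q`. -/
def jac {d : ℕ} (π : EuclideanSpace ℝ (Fin d) → EuclideanSpace ℝ (Fin d))
    (x : EuclideanSpace ℝ (Fin d)) : ℝ :=
  (fderivWithin ℝ π (cube d) x).det

/-- Strong Lipschitz non-regularity of the prescribed Jacobian equation on `Q`. -/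
def StrongNonRegularity (d : ℕ) : Prop :=
  ∃ u : ℕ → EuclideanSpace ℝ (Fin d) → ℝ, ∀ n : ℕ, 1 ≤ n →
    Integrable (u n) (cubeVol d) ∧
    1 ≤ ∫ x, |u n x| ∂(cubeVol d) ∧
    ∀ (f : EuclideanSpace ℝ (Fin d) → ℝ)
      (π : EuclideanSpace ℝ (Fin d) → EuclideanSpace ℝ (Fin d)),
      IsLip f → IsLip π → pairSize f π ≤ 1 →
        |∫ x, u n x * f x * jac π x ∂(cubeVol d)| ≤ 1 / (n : ℝ)

/-- `(f_i, π_i)` is a Lipschitz solution of `∑ i, f_i det Dπ_i = ρ`: all maps are Lipschitz,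
their total size is finite, and the series converges absolutely in `L^∞(Q)` to `ρ`. -/
structure IsLipschitzSolution {d : ℕ} (ρ : EuclideanSpace ℝ (Fin d) → ℝ)
    (f : ℕ → EuclideanSpace ℝ (Fin d) → ℝ)
    (π : ℕ → EuclideanSpace ℝ (Fin d) → EuclideanSpace ℝ (Fin d)) : Prop where
  lip_coeff : ∀ i, IsLip (f i)
  lip_field : ∀ i, IsLip (π i)
  finite_size : Summable (fun i => pairSize (f i) (π i))
  abs_conv : ∑' i, eLpNorm (fun x => f i x * jac (π i) x) ∞ (cubeVol d) < ∞
  conv : Tendsto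
    (fun N : ℕ => eLpNorm
      (fun x => (∑ i ∈ Finset.range N, f i x * jac (π i) x) - ρ x) ∞ (cubeVol d))
    atTop (𝓝 0)

/-- The Lipschitz vector field `π` solves `det Dπ = ρ` almost everywhere on `Q`. -/
def IsJacobianSolution {d : ℕ} (ρ : EuclideanSpace ℝ (Fin d) → ℝ)
    (π : EuclideanSpace ℝ (Fin d) → EuclideanSpace ℝ (Fin d)) : Prop :=
  IsLip π ∧ ∀ᵐ x ∂(cubeVol d), jac π x = ρ x

end

end PrescribedJacobian

/-! Both parts rest on densities of unit mass whose pairing with every normalised `f * jacDet p` is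
small. Such a density is a normalised sum of `T` terms `r_k v_k`, localised by a bump `χ`. Here
`r_k` is a cosine wave in a coordinate `x_i`, at finer and finer dyadic scales `h_k`, and `v_k` is a
Riesz-type product of nonnegative profiles `β (N x_j)` with `j ≠ i`, which therefore does not depend
on `x_i`.

Upper bound. The wave changes sign under translation by `h` in direction `i`, so pairing with `r_k
v_k` only sees the difference between `jacDet p` and its translate. Expanding that difference row by
row and integrating by parts (Jacobians are null Lagrangians, `integral_jacDet_eq_zero`) leaves an
error of order `1 / M` plus a weighted integral of second differences of the `p j`
(`exists_step_bound`). By the parallelogram identity `integral_secondDiff_sq`, squared second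
differences are increments, from scale `2h` to scale `h`, of the energy `∑ j, ∫ (diffQuot i h (p
j))² v`. These increments telescope, and the energy stays bounded because `p` is Lipschitz. So `T`
terms pair to at most `A * T + B * const`, with `A` as small as desired.

Lower bound. The `L¹` norm must grow linearly in `T`, whereas a plain sum of waves would suffer from
cancellation. Hence the concentrating weights: a dual function `X` with `|X| ≤ 1` receives its new
term on a set where the next weight vanishes, so later waves do not disturb it, and each wave adds a
fixed amount to `∫ χ u X` (`Stage.le_integral_succ`). The induction is `Stage.exists_succ`; dividing
by the mass gives `exists_density`, which is transferred to the cube by Lipschitz extension.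

The nonexistence statement follows by Banach–Steinhaus on `L^∞`: solvability for all `ρ` would bound
the functionals `(n + 1) ∫ U_n ρ` pointwise, while their norms are unbounded. -/

namespace PrescribedJacobian

/-! ### Jacobian matrices and determinant algebra -/

/-- The matrix whose rows are the gradients of the components of `p`. -/
noncomputable def gradMat {d : ℕ} (p : Fin d → EuclideanSpace ℝ (Fin d) → ℝ)
    (x : EuclideanSpace ℝ (Fin d)) : Matrix (Fin d) (Fin d) ℝ :=
  Matrix.of fun j i => fderiv ℝ (p j) x (EuclideanSpace.single i 1)

/-- The Jacobian determinant of the map with components `p`. -/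
noncomputable def jacDet {d : ℕ} (p : Fin d → EuclideanSpace ℝ (Fin d) → ℝ)
    (x : EuclideanSpace ℝ (Fin d)) : ℝ :=
  (gradMat p x).det

/-- Lipschitz functions vanishing outside the closed ball of radius `R`. -/
structure LipSupp {d : ℕ} (C : ℝ≥0) (R : ℝ) (g : EuclideanSpace ℝ (Fin d) → ℝ) : Prop where
  lip : LipschitzWith C g
  zero : ∀ x, R < ‖x‖ → g x = 0

theorem abs_det_le {d : ℕ} (A : Matrix (Fin d) (Fin d) ℝ) (b : Fin d → ℝ)
    (hA : ∀ j i, |A j i| ≤ b j) : |A.det| ≤ d.factorial * ∏ j, b j := by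
  rw [Matrix.det_apply']
  refine (Finset.abs_sum_le_sum_abs _ _).trans ?_
  have : ∀ σ ∈ (Finset.univ : Finset (Equiv.Perm (Fin d))),
      |((Equiv.Perm.sign σ : ℤ) : ℝ) * ∏ i, A (σ i) i| ≤ ∏ j, b j := by
    intro σ _
    have hs : |((Equiv.Perm.sign σ : ℤ) : ℝ)| = 1 := by
      rcases Int.units_eq_one_or (Equiv.Perm.sign σ) with h | h <;> simp [h]
    rw [abs_mul, hs, one_mul, Finset.abs_prod, ← Equiv.prod_comp σ b]
    exact Finset.prod_le_prod (fun i _ => abs_nonneg _) (fun i _ => hA _ _)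
  refine (Finset.sum_le_sum this).trans ?_
  simp [Fintype.card_perm]

/-- The determinant of `A` is a fixed linear combination of the values `det (1 + t A)` at finitely
many small `t`. -/
theorem exists_det_weights (d : ℕ) (hd : 0 < d) (t₀ : ℝ) (ht₀ : 0 < t₀) :
    ∃ (t w : Fin (d + 1) → ℝ), (∀ i, 0 < t i ∧ t i ≤ t₀) ∧ ∑ i, w i = 0 ∧
      ∀ A : Matrix (Fin d) (Fin d) ℝ, A.det = ∑ i, w i * (1 + t i • A).det := by
  let t : Fin (d + 1) → ℝ := fun i => t₀ / ((i : ℝ) + 1)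
  have htinj : Function.Injective t := by
    intro i j hij
    simp only [t] at hij
    have h1 : ((i : ℕ) : ℝ) + 1 ≠ 0 := by positivity
    have h2 : ((j : ℕ) : ℝ) + 1 ≠ 0 := by positivity
    field_simp at hij
    have : ((i : ℕ) : ℝ) = (j : ℕ) := by linarith
    exact Fin.ext (by exact_mod_cast this)
  have hV : IsUnit (Matrix.vandermonde t).det :=
    isUnit_iff_ne_zero.mpr (Matrix.det_vandermonde_ne_zero_iff.mpr htinj)
  -- The last row of the inverse Vandermonde matrix: it gives `∑ w i * t i ^ m = 0` for `m < d` and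
  -- `1` for `m = d`. Applied to the polynomial `s ↦ det (1 + s A)` it extracts the top coefficient
  -- `det A`; the case `m = 0` gives `∑ w = 0`.
  let w : Fin (d + 1) → ℝ := Matrix.vecMul (Pi.single (Fin.last d) 1) (Matrix.vandermonde t)⁻¹
  have hw : Matrix.vecMul w (Matrix.vandermonde t) = Pi.single (Fin.last d) 1 := by
    simp only [w, Matrix.vecMul_vecMul, Matrix.nonsing_inv_mul _ hV, Matrix.vecMul_one]
  have hw' : ∀ m : Fin (d + 1), ∑ i, w i * t i ^ (m : ℕ) = if m = Fin.last d then 1 else 0 := by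
    intro m
    have := congrFun hw m
    simp only [Matrix.vecMul, dotProduct, Matrix.vandermonde_apply, Pi.single_apply] at this
    exact this
  refine ⟨t, w, fun i => ⟨by simp only [t]; positivity, ?_⟩, ?_, fun A => ?_⟩
  · simp only [t]
    exact div_le_self ht₀.le (by linarith [(Nat.cast_nonneg (i : ℕ) : (0 : ℝ) ≤ _)])
  · have := hw' 0
    rw [if_neg] at this
    · simpa using this
    · intro h
      have := congrArg Fin.val h
      simp at this
      omega
  · let q : Polynomial ℝ :=
      (((Polynomial.X : Polynomial ℝ) • A.map Polynomial.C +
        (1 : Matrix (Fin d) (Fin d) ℝ).map Polynomial.C)).det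
    have hdeg : q.natDegree < d + 1 := by
      have := Polynomial.natDegree_det_X_add_C_le A 1
      simp only [Fintype.card_fin] at this
      exact Nat.lt_succ_of_le this
    have heval : ∀ s : ℝ, q.eval s = (1 + s • A).det := by
      intro s
      simp only [q]
      rw [← Polynomial.coe_evalRingHom, RingHom.map_det]
      congr 1
      ext i j
      by_cases h : i = j
      · subst h
        simp only [RingHom.mapMatrix_apply, Matrix.map_apply, Matrix.add_apply, Matrix.smul_apply,
          Matrix.one_apply_eq, map_one, smul_eq_mul, Polynomial.coe_evalRingHom,
          Polynomial.eval_add, Polynomial.eval_mul, Polynomial.eval_X, Polynomial.eval_C,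
          Polynomial.eval_one]
        ring
      · simp only [RingHom.mapMatrix_apply, Matrix.map_apply, Matrix.add_apply, Matrix.smul_apply,
          Matrix.one_apply_ne h, map_zero, smul_eq_mul, Polynomial.coe_evalRingHom,
          Polynomial.eval_add, Polynomial.eval_mul, Polynomial.eval_X, Polynomial.eval_C,
          Polynomial.eval_zero]
        ring
    have hcoeff : q.coeff d = A.det := by
      have := Polynomial.coeff_det_X_add_C_card A 1
      simpa only [Fintype.card_fin] using this
    simp_rw [← heval, Polynomial.eval_eq_sum_range' hdeg, Finset.mul_sum]
    rw [Finset.sum_comm, Finset.sum_range]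
    have : ∀ m : Fin (d + 1), ∑ i, w i * (q.coeff (m : ℕ) * t i ^ (m : ℕ)) =
        if m = Fin.last d then q.coeff (m : ℕ) else 0 := by
      intro m
      have h := hw' m
      calc ∑ i, w i * (q.coeff (m : ℕ) * t i ^ (m : ℕ))
          = q.coeff (m : ℕ) * ∑ i, w i * t i ^ (m : ℕ) := by
            rw [Finset.mul_sum]; exact Finset.sum_congr rfl fun i _ => by ring
        _ = _ := by rw [h]; split_ifs <;> simp
    simp_rw [this]
    simp [hcoeff]

/-! ### Measurability, derivative bounds and integrability -/

section Measurability

variable {d : ℕ}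

theorem norm_single_one (i : Fin d) : ‖(EuclideanSpace.single i 1 : EuclideanSpace ℝ (Fin d))‖ = 1 := by
  simp

theorem abs_coord_le (x : EuclideanSpace ℝ (Fin d)) (i : Fin d) : |x i| ≤ ‖x‖ := by
  simpa using PiLp.norm_apply_le x i

theorem measurable_gradMat (p : Fin d → EuclideanSpace ℝ (Fin d) → ℝ) (j i : Fin d) :
    Measurable fun x => gradMat p x j i :=
  measurable_fderiv_apply_const ℝ (p j) _

theorem measurable_det {α : Type*} [MeasurableSpace α] {A : α → Matrix (Fin d) (Fin d) ℝ}
    (hA : ∀ j i, Measurable fun x => A x j i) : Measurable fun x => (A x).det := by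
  simp_rw [Matrix.det_apply']
  exact Finset.measurable_fun_sum _ fun σ _ =>
    measurable_const.mul (Finset.measurable_fun_prod _ fun i _ => hA _ _)

theorem measurable_jacDet (p : Fin d → EuclideanSpace ℝ (Fin d) → ℝ) :
    Measurable (jacDet p) :=
  measurable_det (measurable_gradMat p)

theorem abs_fderiv_single_le {g : EuclideanSpace ℝ (Fin d) → ℝ} {C : ℝ≥0}
    (hg : LipschitzWith C g) (x : EuclideanSpace ℝ (Fin d)) (i : Fin d) :
    |fderiv ℝ g x (EuclideanSpace.single i 1)| ≤ C := by
  have h := (fderiv ℝ g x).le_opNorm (EuclideanSpace.single i 1)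
  rw [norm_single_one, mul_one] at h
  exact h.trans (norm_fderiv_le_of_lipschitz ℝ hg)

theorem fderiv_eq_zero_of_norm_gt {g : EuclideanSpace ℝ (Fin d) → ℝ} {R : ℝ}
    (hg : ∀ x, R < ‖x‖ → g x = 0) {x : EuclideanSpace ℝ (Fin d)} (hx : R < ‖x‖) :
    fderiv ℝ g x = 0 := by
  have h : g =ᶠ[𝓝 x] fun _ => 0 := by
    filter_upwards [(isOpen_lt continuous_const continuous_norm).mem_nhds hx] with y hy
    exact hg y hy
  rw [h.fderiv_eq]
  simp

theorem integrable_of_bounded_support {g : EuclideanSpace ℝ (Fin d) → ℝ} {B R : ℝ}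
    (hm : Measurable g) (hb : ∀ x, |g x| ≤ B) (h0 : ∀ x, R < ‖x‖ → g x = 0) :
    Integrable g := by
  have h1 : IntegrableOn g (Metric.closedBall 0 R) :=
    Measure.integrableOn_of_bounded (M := B) measure_closedBall_lt_top.ne hm.aestronglyMeasurable
      (Eventually.of_forall fun x => by simpa using hb x)
  refine (integrableOn_iff_integrable_of_support_subset ?_).mp h1
  intro x hx
  by_contra hxR
  exact hx (h0 x (by simpa using hxR))

end Measurability

/-! ### Lipschitz perturbations of the identity preserve the volume of a ball -/

section ChangeOfVariables

variable {E : Type*} [NormedAddCommGroup E] [InnerProductSpace ℝ E] [FiniteDimensional ℝ E]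

/-- A perturbation with constant `1 / 2` cannot cancel a displacement, whence injectivity; a
preimage of `y` is a fixed point of the contraction `x ↦ y - ζ x`. -/
theorem bijective_id_add_of_lipschitz_half {ζ : E → E} (hζ : LipschitzWith (1 / 2) ζ) :
    Function.Bijective fun x => x + ζ x := by
  have hd : ∀ x y, ‖ζ x - ζ y‖ ≤ 1 / 2 * ‖x - y‖ := fun x y => by
    simpa [dist_eq_norm] using hζ.dist_le_mul x y
  constructor
  · intro x y hxy
    have h1 : x - y = -(ζ x - ζ y) := by
      have : x + ζ x = y + ζ y := hxy
      rw [neg_sub, sub_eq_sub_iff_add_eq_add, this, add_comm]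
    have h2 := hd x y
    rw [← norm_neg, ← h1] at h2
    have h3 : ‖x - y‖ = 0 := le_antisymm (by linarith) (norm_nonneg _)
    exact sub_eq_zero.mp (norm_eq_zero.mp h3)
  · intro y
    have hc : ContractingWith (1 / 2) fun x => y - ζ x := by
      refine ⟨by norm_num, LipschitzWith.of_dist_le_mul fun x z => ?_⟩
      rw [dist_sub_left]
      exact hζ.dist_le_mul x z
    refine ⟨hc.fixedPoint, ?_⟩
    have := hc.fixedPoint_isFixedPt
    have h : y - ζ hc.fixedPoint = hc.fixedPoint := this
    calc hc.fixedPoint + ζ hc.fixedPoint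
        = (y - ζ hc.fixedPoint) + ζ hc.fixedPoint := by rw [h]
      _ = y := sub_add_cancel _ _

/-- Along the segment `id + s A`, `0 ≤ s ≤ 1`, no kernel vector can exist, so the continuous
determinant keeps the sign it has at the identity. -/
theorem det_one_add_pos {A : E →L[ℝ] E} (hA : ‖A‖ ≤ 1 / 2) :
    0 < (ContinuousLinearMap.id ℝ E + A).det := by
  have hne : ∀ s ∈ Set.Icc (0 : ℝ) 1, (ContinuousLinearMap.id ℝ E + s • A).det ≠ 0 := by
    intro s hs h0
    obtain ⟨v, hv, hv0⟩ := (Submodule.ne_bot_iff _).mp (LinearMap.bot_lt_ker_of_det_eq_zero h0).ne'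
    have h1 : v + s • A v = 0 := by simpa using hv
    have h2 : ‖v‖ = s * ‖A v‖ := by
      rw [← Real.norm_of_nonneg hs.1, ← norm_smul, ← norm_neg (s • A v),
        ← eq_neg_of_add_eq_zero_left h1]
    have h3 : ‖A v‖ ≤ 1 / 2 * ‖v‖ := A.le_of_opNorm_le hA v
    have h4 : s * ‖A v‖ ≤ 1 * ‖A v‖ := mul_le_mul_of_nonneg_right hs.2 (norm_nonneg _)
    have : ‖v‖ = 0 := le_antisymm (by linarith) (norm_nonneg _)
    exact hv0 (norm_eq_zero.mp this)
  have hcont : ContinuousOn (fun s : ℝ => (ContinuousLinearMap.id ℝ E + s • A).det)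
      (Set.Icc 0 1) :=
    (ContinuousLinearMap.continuous_det.comp (by fun_prop)).continuousOn
  by_contra hneg
  push Not at hneg
  have h01 : (0 : ℝ) ∈ Set.Icc ((ContinuousLinearMap.id ℝ E + (1 : ℝ) • A).det)
      ((ContinuousLinearMap.id ℝ E + (0 : ℝ) • A).det) := by
    constructor
    · simpa using hneg
    · simp [ContinuousLinearMap.det]
  obtain ⟨s, hs, hs0⟩ := intermediate_value_Icc' (zero_le_one) hcont h01
  exact hne s hs hs0

variable [MeasurableSpace E] [BorelSpace E]

/-- Lebesgue measure and Hausdorff measure of full dimension are multiples of each other, and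
Lipschitz maps control the latter. -/
theorem volume_image_eq_zero_of_lipschitz {f : E → E} {K : ℝ≥0}
    (hf : LipschitzWith K f) {s : Set E} (hs : volume s = 0) :
    volume (f '' s) = 0 := by
  have hmu : (volume : Measure E) =
      Measure.addHaarScalarFactor (volume : Measure E) (μH[Module.finrank ℝ E]) •
        (μH[Module.finrank ℝ E] : Measure E) :=
    Measure.isAddLeftInvariant_eq_smul _ _
  have hmu' : (μH[Module.finrank ℝ E] : Measure E) =
      Measure.addHaarScalarFactor (μH[Module.finrank ℝ E] : Measure E) (volume : Measure E) •
        (volume : Measure E) :=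
    Measure.isAddLeftInvariant_eq_smul _ _
  have h1 : (μH[Module.finrank ℝ E] : Measure E) s = 0 := by
    rw [hmu']; simp [hs]
  have h2 := hf.hausdorffMeasure_image_le (d := Module.finrank ℝ E) (by positivity) s
  rw [h1, mul_zero] at h2
  rw [hmu]
  simp [nonpos_iff_eq_zero.mp h2]

/-- The bijection `x + ζ x` is the identity off the ball, hence maps the ball onto itself. The
change of variables formula applies on the points of differentiability, the rest being null with
null image, and the absolute value disappears because the determinant is positive. -/
theorem integral_det_id_add {ζ : E → E} {R : ℝ} (hζ : LipschitzWith (1 / 2) ζ)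
    (h0 : ∀ x, R < ‖x‖ → ζ x = 0) :
    ∫ x in Metric.closedBall (0 : E) R, (ContinuousLinearMap.id ℝ E + fderiv ℝ ζ x).det =
      volume.real (Metric.closedBall (0 : E) R) := by
  set K := Metric.closedBall (0 : E) R with hK
  set f : E → E := fun x => x + ζ x with hf
  have hbij : Function.Bijective f := bijective_id_add_of_lipschitz_half hζ
  have hout : ∀ x, x ∉ K → f x = x := fun x hx => by
    simp [hf, h0 x (by simpa [hK] using hx)]
  have himage : f '' K = K := by
    apply Set.Subset.antisymm
    · rintro _ ⟨x, hx, rfl⟩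
      by_contra hfx
      exact hfx (by rw [hbij.1 (hout _ hfx)]; exact hx)
    · intro y hy
      obtain ⟨x, rfl⟩ := hbij.2 y
      by_cases hx : x ∈ K
      · exact ⟨x, hx, rfl⟩
      · exact absurd (by rwa [hout x hx] at hy) hx
  have hfl : LipschitzWith (1 + 1 / 2) f := LipschitzWith.id.add hζ
  set s := K ∩ {x | DifferentiableAt ℝ ζ x} with hs
  have hsm : MeasurableSet s :=
    Metric.isClosed_closedBall.measurableSet.inter (measurableSet_of_differentiableAt ℝ ζ)
  have hnull : volume (K \ s) = 0 := by
    refine measure_mono_null (fun x hx => ?_) (ae_iff.mp hζ.ae_differentiableAt)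
    exact fun h => hx.2 ⟨hx.1, h⟩
  have hder : ∀ x ∈ s, HasFDerivWithinAt f (ContinuousLinearMap.id ℝ E + fderiv ℝ ζ x) s x :=
    fun x hx => ((hasFDerivAt_id x).add hx.2.hasFDerivAt).hasFDerivWithinAt
  have hcv := lintegral_abs_det_fderiv_eq_addHaar_image volume hsm hder hbij.1.injOn
  have hvol : volume (f '' s) = volume K := by
    apply le_antisymm
    · exact (measure_mono (Set.image_mono Set.inter_subset_left)).trans_eq (by rw [himage])
    · calc volume K = volume (f '' K) := by rw [himage]
        _ ≤ volume (f '' s ∪ f '' (K \ s)) := by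
            refine measure_mono ?_
            rw [← Set.image_union, Set.union_sdiff_cancel Set.inter_subset_left]
        _ ≤ volume (f '' s) + volume (f '' (K \ s)) := measure_union_le _ _
        _ = volume (f '' s) := by rw [volume_image_eq_zero_of_lipschitz hfl hnull, add_zero]
  have hKs : (s : Set E) =ᵐ[volume] K := by
    refine (Set.inter_subset_left : s ⊆ K).eventuallyLE.antisymm ?_
    exact (ae_le_set (μ := volume)).mpr hnull
  have hpos : ∀ x, 0 < (ContinuousLinearMap.id ℝ E + fderiv ℝ ζ x).det := fun x =>
    det_one_add_pos (by simpa using norm_fderiv_le_of_lipschitz ℝ hζ (x₀ := x))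
  rw [← setIntegral_congr_set hKs, integral_eq_lintegral_of_nonneg_ae
    (Eventually.of_forall fun x => (hpos x).le)]
  · rw [measureReal_def, ← hvol, ← hcv]
    congr 1
    refine lintegral_congr fun x => ?_
    rw [abs_of_pos (hpos x)]
  · refine (ContinuousLinearMap.continuous_det.measurable.comp ?_).aestronglyMeasurable
    exact measurable_const.add (measurable_fderiv ℝ ζ)

end ChangeOfVariables

/-! ### Jacobians as null Lagrangians; integration by parts -/

section NullLagrangian

variable {d : ℕ}

theorem det_eq_det_matrix (A : EuclideanSpace ℝ (Fin d) →L[ℝ] EuclideanSpace ℝ (Fin d)) :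
    A.det = (Matrix.of fun j i => A (EuclideanSpace.single i 1) j).det := by
  rw [ContinuousLinearMap.det, ← LinearMap.det_toMatrix (EuclideanSpace.basisFun (Fin d) ℝ).toBasis]
  congr 1

theorem abs_jacDet_le {p : Fin d → EuclideanSpace ℝ (Fin d) → ℝ} {b : Fin d → ℝ≥0}
    (hp : ∀ j, LipschitzWith (b j) (p j)) (x : EuclideanSpace ℝ (Fin d)) :
    |jacDet p x| ≤ d.factorial * ∏ j, (b j : ℝ) :=
  abs_det_le _ _ fun j i => abs_fderiv_single_le (hp j) x i

theorem gradMat_update (p : Fin d → EuclideanSpace ℝ (Fin d) → ℝ) (j : Fin d)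
    (w : EuclideanSpace ℝ (Fin d) → ℝ) (x : EuclideanSpace ℝ (Fin d)) :
    gradMat (Function.update p j w) x =
      (gradMat p x).updateRow j fun i => fderiv ℝ w x (EuclideanSpace.single i 1) := by
  ext k i
  by_cases h : k = j
  · subst h; simp [gradMat]
  · simp [gradMat, h]

theorem jacDet_eq_zero_of_fderiv {p : Fin d → EuclideanSpace ℝ (Fin d) → ℝ} {j : Fin d}
    {x : EuclideanSpace ℝ (Fin d)} (h : fderiv ℝ (p j) x = 0) : jacDet p x = 0 :=
  Matrix.det_eq_zero_of_row_eq_zero j fun i => by simp [gradMat, h]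

theorem jacDet_eq_zero_of_norm_gt {p : Fin d → EuclideanSpace ℝ (Fin d) → ℝ} {j : Fin d} {C : ℝ≥0}
    {R : ℝ} (hp : LipSupp C R (p j)) {x : EuclideanSpace ℝ (Fin d)} (hx : R < ‖x‖) :
    jacDet p x = 0 :=
  jacDet_eq_zero_of_fderiv (fderiv_eq_zero_of_norm_gt hp.zero hx)

theorem ae_differentiableAt_all {p : Fin d → EuclideanSpace ℝ (Fin d) → ℝ} {b : Fin d → ℝ≥0}
    (hp : ∀ j, LipschitzWith (b j) (p j)) :
    ∀ᵐ x : EuclideanSpace ℝ (Fin d), ∀ j, DifferentiableAt ℝ (p j) x :=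
  ae_all_iff.mpr fun j => (hp j).ae_differentiableAt

theorem hasFDerivAt_toLp {p : Fin d → EuclideanSpace ℝ (Fin d) → ℝ} {x : EuclideanSpace ℝ (Fin d)}
    (hp : ∀ j, DifferentiableAt ℝ (p j) x) :
    HasFDerivAt (fun y => WithLp.toLp 2 fun j => p j y)
      (((EuclideanSpace.equiv (Fin d) ℝ).symm : (Fin d → ℝ) →L[ℝ] EuclideanSpace ℝ (Fin d)).comp
        (ContinuousLinearMap.pi fun j => fderiv ℝ (p j) x)) x :=
  ((EuclideanSpace.equiv (Fin d) ℝ).symm.toContinuousLinearMap.hasFDerivAt).comp x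
    (hasFDerivAt_pi.mpr fun j => (hp j).hasFDerivAt)

/-- For all small `t` the integral of `det (1 + t Dη)` over the ball is the volume of the ball,
independently of `t`. Since `det Dη` is a combination of finitely many of these determinants with
weights of sum zero, its integral vanishes. -/
theorem integral_jacDet_eq_zero (hd : 0 < d) {p : Fin d → EuclideanSpace ℝ (Fin d) → ℝ}
    {C : ℝ≥0} {R : ℝ} (hp : ∀ j, LipSupp C R (p j)) : ∫ x, jacDet p x = 0 := by
  set η : EuclideanSpace ℝ (Fin d) → EuclideanSpace ℝ (Fin d) :=
    fun y => WithLp.toLp 2 fun j => p j y with hη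
  obtain ⟨K, hK⟩ : ∃ K : ℝ≥0, LipschitzWith K η := by
    have h1 : LipschitzWith C fun y => fun j => p j y :=
      LipschitzWith.of_dist_le_mul fun x y => by
        rw [dist_pi_le_iff (by positivity)]
        exact fun j => (hp j).lip.dist_le_mul x y
    exact ⟨_, (EuclideanSpace.equiv (Fin d) ℝ).symm.lipschitz.comp h1⟩
  have hη0 : ∀ x, R < ‖x‖ → η x = 0 := fun x hx => by
    ext j; simp [hη, (hp j).zero x hx]
  -- The bound on `t` makes `t • η` Lipschitz with constant `1 / 2`, as `integral_det_id_add`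
  -- requires.
  obtain ⟨t, w, ht, hw0, hdet⟩ := exists_det_weights d hd (1 / (2 * ((K : ℝ) + 1))) (by positivity)
  set B := Metric.closedBall (0 : EuclideanSpace ℝ (Fin d)) R with hB
  have hint : ∀ i, ∫ x in B, (1 + t i • gradMat p x).det = volume.real B := by
    intro i
    have hlip : LipschitzWith (1 / 2) fun x => t i • η x := by
      refine LipschitzWith.of_dist_le_mul fun x y => ?_
      rw [dist_smul₀, Real.norm_of_nonneg (ht i).1.le]
      calc t i * dist (η x) (η y) ≤ 1 / (2 * ((K : ℝ) + 1)) * (K * dist x y) :=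
            mul_le_mul (ht i).2 (hK.dist_le_mul x y) dist_nonneg (by positivity)
        _ = (K / (K + 1)) * (1 / 2 * dist x y) := by field_simp
        _ ≤ 1 * (1 / 2 * dist x y) := by
            refine mul_le_mul_of_nonneg_right ?_ (by positivity)
            rw [div_le_one (by positivity)]; linarith
        _ = _ := by simp
    rw [← integral_det_id_add hlip fun x hx => by rw [hη0 x hx, smul_zero]]
    refine setIntegral_congr_ae measurableSet_closedBall ?_
    filter_upwards [ae_differentiableAt_all fun j => (hp j).lip] with x hx _
    have hf : HasFDerivAt (fun x => t i • η x) _ x := (hasFDerivAt_toLp hx).const_smul (t i)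
    rw [hf.fderiv, det_eq_det_matrix]
    congr 1
    ext j k
    by_cases hjk : j = k
    · subst hjk
      simp [gradMat]
    · simp [gradMat, Matrix.one_apply_ne hjk, hjk]
  have hsupp : ∫ x, jacDet p x = ∫ x in B, jacDet p x := by
    refine (setIntegral_eq_integral_of_forall_compl_eq_zero fun x hx => ?_).symm
    exact jacDet_eq_zero_of_norm_gt (hp ⟨0, hd⟩) (by simpa [hB] using hx)
  have hintble : ∀ i, IntegrableOn (fun x => (1 + t i • gradMat p x).det) B := by
    intro i
    refine Measure.integrableOn_of_bounded (M := d.factorial * ∏ _j : Fin d, (1 + t i * C))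
      measure_closedBall_lt_top.ne ?_ (Eventually.of_forall fun x => ?_)
    · refine (measurable_det fun j k => ?_).aestronglyMeasurable
      exact measurable_const.add ((measurable_gradMat p j k).const_mul (t i))
    · refine abs_det_le _ _ fun j k => ?_
      simp only [Matrix.add_apply, Matrix.smul_apply, smul_eq_mul]
      refine (abs_add_le _ _).trans (add_le_add ?_ ?_)
      · rw [Matrix.one_apply]; split_ifs <;> simp
      · rw [abs_mul, abs_of_pos (ht i).1]
        exact mul_le_mul_of_nonneg_left (abs_fderiv_single_le (hp j).lip x k) (ht i).1.le
  rw [hsupp]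
  have hexp : ∀ x, jacDet p x = ∑ i, w i * (1 + t i • gradMat p x).det := fun x => hdet _
  simp_rw [hexp]
  rw [integral_finsetSum _ fun i _ => (hintble i).const_mul (w i)]
  simp_rw [integral_const_mul, hint, ← Finset.sum_mul, hw0, zero_mul]

theorem LipSupp.bounded {C : ℝ≥0} {R : ℝ} {g : EuclideanSpace ℝ (Fin d) → ℝ} (hd : 0 < d)
    (hR : 0 ≤ R) (hg : LipSupp C R g) (x : EuclideanSpace ℝ (Fin d)) :
    |g x| ≤ C * (2 * R + 1) := by
  by_cases hx : R < ‖x‖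
  · rw [hg.zero x hx, abs_zero]; positivity
  -- Compare with a point of norm `R + 1`, where the function vanishes; such a point exists because
  -- `0 < d`.
  · set y : EuclideanSpace ℝ (Fin d) := EuclideanSpace.single ⟨0, hd⟩ (R + 1) with hy
    have hyn : ‖y‖ = R + 1 := by
      rw [hy, PiLp.norm_single, Real.norm_of_nonneg (by linarith)]
    have h1 := hg.lip.dist_le_mul x y
    rw [hg.zero y (by rw [hyn]; linarith), Real.dist_eq, sub_zero] at h1
    refine h1.trans (mul_le_mul_of_nonneg_left ?_ C.2)
    rw [dist_eq_norm]
    refine (norm_sub_le _ _).trans ?_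
    rw [hyn]; push Not at hx; linarith

theorem LipSupp.mul {C C' : ℝ≥0} {R : ℝ} {g w : EuclideanSpace ℝ (Fin d) → ℝ} (hd : 0 < d)
    (hR : 0 ≤ R) (hg : LipSupp C R g) (hw : LipSupp C' R w) :
    ∃ C'', LipSupp C'' R fun x => w x * g x := by
  refine ⟨C' * (C * (2 * R.toNNReal + 1)) + C * (C' * (2 * R.toNNReal + 1)), ?_, fun x hx => ?_⟩
  · refine LipschitzWith.of_dist_le_mul fun x y => ?_
    have h1 := hg.lip.dist_le_mul x y
    have h2 := hw.lip.dist_le_mul x y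
    have h3 := hg.bounded hd hR x
    have h4 := hw.bounded hd hR y
    rw [Real.dist_eq] at *
    have e : w x * g x - w y * g y = (w x - w y) * g x + w y * (g x - g y) := by ring
    rw [e]
    refine (abs_add_le _ _).trans ?_
    rw [abs_mul, abs_mul]
    push_cast
    rw [Real.coe_toNNReal R hR]
    calc _ ≤ (C' * dist x y) * (C * (2 * R + 1)) + (C' * (2 * R + 1)) * (C * dist x y) := by
          gcongr
      _ = _ := by ring
  · simp [hg.zero x hx]

theorem LipSupp.mono {C C' : ℝ≥0} {R : ℝ} {g : EuclideanSpace ℝ (Fin d) → ℝ}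
    (hg : LipSupp C R g) (h : C ≤ C') : LipSupp C' R g :=
  ⟨hg.lip.weaken h, hg.zero⟩

/-- Put `w * p j` in row `j`: the Jacobian integrates to zero, and the Leibniz rule with linearity
in that row splits it into the two sides. A derivative thus moves from `p j` to `w` without any
second derivatives. -/
theorem integral_mul_jacDet (hd : 0 < d) {p : Fin d → EuclideanSpace ℝ (Fin d) → ℝ}
    {C C' : ℝ≥0} {R : ℝ} (hR : 0 ≤ R) (hp : ∀ j, LipSupp C R (p j))
    {w : EuclideanSpace ℝ (Fin d) → ℝ} (hw : LipSupp C' R w) (j : Fin d) :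
    ∫ x, w x * jacDet p x = -∫ x, p j x * jacDet (Function.update p j w) x := by
  obtain ⟨C'', h⟩ := (hp j).mul hd hR hw
  have hz := integral_jacDet_eq_zero hd (p := Function.update p j fun x => w x * p j x)
    (C := max C C'') (R := R) fun k => by
      by_cases hk : k = j
      · subst hk; simpa using h.mono (le_max_right _ _)
      · simpa [hk] using (hp k).mono (le_max_left _ _)
  have hae : ∀ᵐ x, jacDet (Function.update p j fun x => w x * p j x) x =
      w x * jacDet p x + p j x * jacDet (Function.update p j w) x := by
    filter_upwards [(hp j).lip.ae_differentiableAt, hw.lip.ae_differentiableAt] with x h1 h2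
    have e : (fun i => fderiv ℝ (fun x => w x * p j x) x (EuclideanSpace.single i 1)) =
        w x • (gradMat p x j) +
        p j x • fun i => fderiv ℝ w x (EuclideanSpace.single i 1) := by
      ext i
      rw [fderiv_fun_mul h2 h1]
      simp [gradMat]
    rw [jacDet, gradMat_update, e, Matrix.det_updateRow_add, Matrix.det_updateRow_smul,
      Matrix.det_updateRow_smul, Matrix.updateRow_eq_self, jacDet, jacDet, gradMat_update]
  rw [integral_congr_ae hae, integral_add] at hz
  · linarith
  · refine integrable_of_bounded_support (R := R)
      (B := (C' * (2 * R + 1)) * (d.factorial * ∏ _j : Fin d, (C : ℝ)))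
      (hw.lip.continuous.measurable.mul (measurable_jacDet p)) (fun x => ?_)
      fun x hx => by rw [hw.zero x hx, zero_mul]
    rw [abs_mul]
    have := abs_jacDet_le (fun j => (hp j).lip) x
    gcongr
    exact hw.bounded hd hR x
  · refine integrable_of_bounded_support (R := R)
      (B := (C * (2 * R + 1)) * (d.factorial * ∏ _j : Fin d, ((max C C' : ℝ≥0) : ℝ)))
      ((hp j).lip.continuous.measurable.mul (measurable_jacDet _)) (fun x => ?_)
      fun x hx => by rw [(hp j).zero x hx, zero_mul]
    rw [abs_mul]
    have := abs_jacDet_le (p := Function.update p j w) (b := fun _ => max C C') (fun k => by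
      by_cases hk : k = j
      · subst hk; simpa using hw.lip.weaken (le_max_right _ _)
      · simpa [hk] using (hp k).lip.weaken (le_max_left _ _)) x
    gcongr
    exact (hp j).bounded hd hR x

end NullLagrangian

/-! ### Integrals against oscillating functions -/

section Oscillation

variable {d : ℕ}

/-- Integrals against a rapidly oscillating function of one coordinate are small. -/
theorem abs_integral_oscillating_le {Γ γ : ℝ → ℝ} {A B : ℝ} (hΓ : ∀ t, HasDerivAt Γ (γ t) t)
    (hA : ∀ t, |Γ t| ≤ A) (hB : ∀ t, |γ t| ≤ B) {N : ℝ} (hN : 0 < N) (i : Fin d)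
    {G : EuclideanSpace ℝ (Fin d) → ℝ} {C : ℝ≥0} {R L : ℝ} (hG : LipSupp C R G) (hL0 : 0 ≤ L)
    (hL : ∀ x (t : ℝ), |G (x + t • EuclideanSpace.single i 1) - G x| ≤ L * |t|) :
    |∫ x, γ (N * x i) * G x| ≤
      A / N * L * volume.real (Metric.closedBall (0 : EuclideanSpace ℝ (Fin d)) R) := by
  set e : EuclideanSpace ℝ (Fin d) := EuclideanSpace.single i 1 with he
  have hei : e i = 1 := by simp [he]
  have hB0 : 0 ≤ B := (abs_nonneg _).trans (hB 0)
  have hA0 : 0 ≤ A := (abs_nonneg _).trans (hA 0)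
  set f : EuclideanSpace ℝ (Fin d) → ℝ := fun x => Γ (N * x i) / N with hf
  have hΓl : LipschitzWith B.toNNReal Γ := by
    refine lipschitzWith_of_nnnorm_deriv_le (fun t => (hΓ t).differentiableAt) fun t => ?_
    rw [(hΓ t).deriv, ← NNReal.coe_le_coe, coe_nnnorm, Real.coe_toNNReal _ hB0]
    exact hB t
  have hfl : LipschitzWith B.toNNReal f := by
    refine LipschitzWith.of_dist_le_mul fun x y => ?_
    have h1 := hΓl.dist_le_mul (N * x i) (N * y i)
    have h2 := abs_coord_le (x - y) i
    rw [Real.dist_eq] at *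
    simp only [hf]
    rw [← sub_div, abs_div, abs_of_pos hN, div_le_iff₀ hN, dist_eq_norm]
    refine h1.trans ?_
    rw [Real.dist_eq, ← mul_sub, abs_mul, abs_of_pos hN]
    calc (B.toNNReal : ℝ) * (N * |x i - y i|) ≤ B.toNNReal * (N * ‖x - y‖) := by
          gcongr; simpa using h2
      _ = _ := by ring
  have hfd : ∀ x, lineDeriv ℝ f x e = γ (N * x i) := by
    intro x
    refine HasLineDerivAt.lineDeriv ?_
    unfold HasLineDerivAt
    have h1 : HasDerivAt (fun t : ℝ => N * (x i + t)) N 0 := by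
      simpa using ((hasDerivAt_id (0 : ℝ)).const_add (x i)).const_mul N
    have h2 : HasDerivAt Γ (γ (N * x i)) (N * (x i + 0)) := by simpa using hΓ (N * x i)
    have h3 := (h2.comp (0 : ℝ) h1).div_const N
    rw [mul_div_assoc, div_self hN.ne', mul_one] at h3
    refine h3.congr_of_eventuallyEq (Eventually.of_forall fun t => ?_)
    simp [hf, hei]
  have hGc : HasCompactSupport G := by
    refine HasCompactSupport.intro (isCompact_closedBall (0 : EuclideanSpace ℝ (Fin d)) R) ?_
    intro x hx
    exact hG.zero x (by simpa using hx)
  -- After integrating by parts only the derivative of `G` in direction `i` remains. Hence the bound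
  -- involves `L` and not the full constant `C`, so that factors of `G` oscillating fast in other
  -- coordinates are harmless.
  have hibp := LipschitzWith.integral_lineDeriv_mul_eq (μ := volume) hfl hG.lip hGc e
  simp_rw [hfd] at hibp
  rw [hibp]
  have hzero : ∀ x, x ∉ Metric.closedBall (0 : EuclideanSpace ℝ (Fin d)) R →
      lineDeriv ℝ G x (-e) * f x = 0 := by
    intro x hx
    have hx' : R < ‖x‖ := by simpa using hx
    have h : G =ᶠ[𝓝 x] fun _ => 0 := by
      filter_upwards [(isOpen_lt continuous_const continuous_norm).mem_nhds hx'] with y hy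
      exact hG.zero y hy
    rw [h.lineDeriv_eq]
    simp [lineDeriv]
  rw [← setIntegral_eq_integral_of_forall_compl_eq_zero hzero]
  have hbd : ∀ x, ‖lineDeriv ℝ G x (-e) * f x‖ ≤ A / N * L := by
    intro x
    rw [norm_mul, mul_comm]
    refine mul_le_mul ?_ ?_ (norm_nonneg _) (by positivity)
    · simp only [hf, Real.norm_eq_abs, abs_div, abs_of_pos hN]
      have := hA (N * x i)
      gcongr
    · unfold lineDeriv
      refine norm_deriv_le_of_lip' hL0 (Eventually.of_forall fun t => ?_)
      have := hL x (-t)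
      simpa using this
  exact norm_setIntegral_le_of_norm_le_const measure_closedBall_lt_top fun x _ => hbd x

end Oscillation

/-! ### Difference quotients and the directional energy -/

section Energy

variable {d : ℕ}

/-- The difference quotient of step `h` in the direction `i`. -/
noncomputable def diffQuot (i : Fin d) (h : ℝ) (p : EuclideanSpace ℝ (Fin d) → ℝ)
    (x : EuclideanSpace ℝ (Fin d)) : ℝ :=
  (p (x + h • EuclideanSpace.single i 1) - p x) / h

/-- The centred second difference of step `h` in the direction `i`, divided by `h`. -/
noncomputable def secondDiff (i : Fin d) (h : ℝ) (p : EuclideanSpace ℝ (Fin d) → ℝ)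
    (x : EuclideanSpace ℝ (Fin d)) : ℝ :=
  (p (x + h • EuclideanSpace.single i 1) + p (x - h • EuclideanSpace.single i 1) - 2 * p x) / h

theorem norm_smul_single (i : Fin d) (h : ℝ) :
    ‖(h • EuclideanSpace.single i 1 : EuclideanSpace ℝ (Fin d))‖ = |h| := by
  rw [norm_smul, norm_single_one, mul_one, Real.norm_eq_abs]

theorem LipSupp.zero_shift {C : ℝ≥0} {R h : ℝ} {p : EuclideanSpace ℝ (Fin d) → ℝ}
    (hp : LipSupp C R p) (i : Fin d) {x : EuclideanSpace ℝ (Fin d)} (hx : R + |h| < ‖x‖) :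
    p (x + h • EuclideanSpace.single i 1) = 0 := by
  refine hp.zero _ ?_
  have := norm_sub_norm_le x (-(h • EuclideanSpace.single i 1))
  rw [sub_neg_eq_add, norm_neg, norm_smul_single] at this
  linarith

theorem LipSupp.zero_shift_neg {C : ℝ≥0} {R h : ℝ} {p : EuclideanSpace ℝ (Fin d) → ℝ}
    (hp : LipSupp C R p) (i : Fin d) {x : EuclideanSpace ℝ (Fin d)} (hx : R + |h| < ‖x‖) :
    p (x - h • EuclideanSpace.single i 1) = 0 := by
  have := hp.zero_shift (h := -h) i (x := x) (by simpa using hx)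
  rwa [neg_smul, ← sub_eq_add_neg] at this

theorem abs_shift_sub_le {C : ℝ≥0} {p : EuclideanSpace ℝ (Fin d) → ℝ}
    (hp : LipschitzWith C p) (i : Fin d) (h : ℝ) (x : EuclideanSpace ℝ (Fin d)) :
    |p (x + h • EuclideanSpace.single i 1) - p x| ≤ C * |h| := by
  have := hp.dist_le_mul (x + h • EuclideanSpace.single i 1) x
  rwa [Real.dist_eq, dist_eq_norm, add_sub_cancel_left, norm_smul_single] at this

theorem abs_diffQuot_le {C : ℝ≥0} {p : EuclideanSpace ℝ (Fin d) → ℝ}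
    (hp : LipschitzWith C p) (i : Fin d) (h : ℝ) (x : EuclideanSpace ℝ (Fin d)) :
    |diffQuot i h p x| ≤ C := by
  rw [diffQuot, abs_div]
  rcases eq_or_ne h 0 with rfl | hh
  · simp
  · rw [div_le_iff₀ (abs_pos.mpr hh)]
    exact abs_shift_sub_le hp i h x

theorem diffQuot_eq_zero {C : ℝ≥0} {R h : ℝ} {p : EuclideanSpace ℝ (Fin d) → ℝ}
    (hp : LipSupp C R p) (i : Fin d) {x : EuclideanSpace ℝ (Fin d)} (hx : R + |h| < ‖x‖) :
    diffQuot i h p x = 0 := by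
  rw [diffQuot, hp.zero_shift i hx, hp.zero x (by linarith [abs_nonneg h])]
  simp

theorem secondDiff_eq_zero {C : ℝ≥0} {R h : ℝ} {p : EuclideanSpace ℝ (Fin d) → ℝ}
    (hp : LipSupp C R p) (i : Fin d) {x : EuclideanSpace ℝ (Fin d)} (hx : R + |h| < ‖x‖) :
    secondDiff i h p x = 0 := by
  rw [secondDiff, hp.zero_shift i hx, hp.zero_shift_neg i hx, hp.zero x (by linarith [abs_nonneg h])]
  simp

theorem diffQuot_sub_diffQuot (i : Fin d) (h : ℝ) (p : EuclideanSpace ℝ (Fin d) → ℝ)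
    (x : EuclideanSpace ℝ (Fin d)) :
    diffQuot i h p x - diffQuot i h p (x - h • EuclideanSpace.single i 1) = secondDiff i h p x := by
  rw [diffQuot, diffQuot, secondDiff, sub_add_cancel]
  ring

theorem abs_secondDiff_le {C : ℝ≥0} {p : EuclideanSpace ℝ (Fin d) → ℝ}
    (hp : LipschitzWith C p) (i : Fin d) (h : ℝ) (x : EuclideanSpace ℝ (Fin d)) :
    |secondDiff i h p x| ≤ 2 * C := by
  rw [← diffQuot_sub_diffQuot]
  refine (abs_sub _ _).trans ?_
  linarith [abs_diffQuot_le hp i h x,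
    abs_diffQuot_le hp i h (x - h • EuclideanSpace.single i 1)]

theorem continuous_diffQuot {p : EuclideanSpace ℝ (Fin d) → ℝ} (hp : Continuous p) (i : Fin d)
    (h : ℝ) : Continuous (diffQuot i h p) := by
  unfold diffQuot
  fun_prop

theorem continuous_secondDiff {p : EuclideanSpace ℝ (Fin d) → ℝ} (hp : Continuous p) (i : Fin d)
    (h : ℝ) : Continuous (secondDiff i h p) := by
  unfold secondDiff
  fun_prop

variable {C : ℝ≥0} {R : ℝ} {p v : EuclideanSpace ℝ (Fin d) → ℝ} {B : ℝ}

theorem integrable_diffQuot_sq_mul (hp : LipSupp C R p) (hv : Continuous v) (hB : ∀ x, |v x| ≤ B)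
    (i : Fin d) (h : ℝ) : Integrable fun x => diffQuot i h p x ^ 2 * v x := by
  refine integrable_of_bounded_support (B := (C : ℝ) ^ 2 * B) (R := R + |h|)
    (((continuous_diffQuot hp.lip.continuous i h).pow 2).mul hv).measurable (fun x => ?_)
    fun x hx => by rw [diffQuot_eq_zero hp i hx]; simp
  rw [abs_mul, abs_pow]
  have h1 := abs_diffQuot_le hp.lip i h x
  have h2 := hB x
  gcongr

theorem integrable_secondDiff_sq_mul (hp : LipSupp C R p) (hv : Continuous v)
    (hB : ∀ x, |v x| ≤ B) (i : Fin d) (h : ℝ) :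
    Integrable fun x => secondDiff i h p x ^ 2 * v x := by
  refine integrable_of_bounded_support (B := (2 * (C : ℝ)) ^ 2 * B) (R := R + |h|)
    (((continuous_secondDiff hp.lip.continuous i h).pow 2).mul hv).measurable (fun x => ?_)
    fun x hx => by rw [secondDiff_eq_zero hp i hx]; simp
  rw [abs_mul, abs_pow]
  have h1 := abs_secondDiff_le hp.lip i h x
  have h2 := hB x
  gcongr

theorem integrable_abs_secondDiff_mul (hp : LipSupp C R p) (hv : Continuous v)
    (hB : ∀ x, |v x| ≤ B) (i : Fin d) (h : ℝ) :
    Integrable fun x => |secondDiff i h p x| * v x := by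
  refine integrable_of_bounded_support (B := (2 * (C : ℝ)) * B) (R := R + |h|)
    ((continuous_secondDiff hp.lip.continuous i h).abs.mul hv).measurable (fun x => ?_)
    fun x hx => by rw [secondDiff_eq_zero hp i hx]; simp
  rw [abs_mul, abs_abs]
  have h1 := abs_secondDiff_le hp.lip i h x
  have h2 := hB x
  gcongr

/-- The parallelogram identity for difference quotients at consecutive dyadic scales. -/
theorem integral_secondDiff_sq (hp : LipSupp C R p) (hv : Continuous v) (hB : ∀ x, |v x| ≤ B)
    (i : Fin d) (hinv : ∀ x (t : ℝ), v (x + t • EuclideanSpace.single i 1) = v x) {h : ℝ}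
    (hh : h ≠ 0) :
    ∫ x, secondDiff i h p x ^ 2 * v x =
      4 * (∫ x, diffQuot i h p x ^ 2 * v x) - 4 * ∫ x, diffQuot i (2 * h) p x ^ 2 * v x := by
  set e : EuclideanSpace ℝ (Fin d) := EuclideanSpace.single i 1 with he
  -- Translations in direction `i` do not see the weight. This invariance is what makes the identity
  -- exact.
  have hshift : ∀ F : EuclideanSpace ℝ (Fin d) → ℝ,
      ∫ x, F (x - h • e) * v x = ∫ x, F x * v x := by
    intro F
    rw [← integral_sub_right_eq_self (fun x => F x * v x) (h • e)]
    refine integral_congr_ae (Eventually.of_forall fun x => ?_)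
    have := hinv x (-h)
    simp only [neg_smul, ← sub_eq_add_neg] at this
    simp only
    rw [this]
  have hident : ∀ x, secondDiff i h p x ^ 2 * v x =
      2 * (diffQuot i h p x ^ 2 * v x) + 2 * (diffQuot i h p (x - h • e) ^ 2 * v x)
        - 4 * (diffQuot i (2 * h) p (x - h • e) ^ 2 * v x) := by
    intro x
    have h1 : x - h • e + (2 * h) • e = x + h • e := by rw [mul_smul, two_smul]; abel
    simp only [secondDiff, diffQuot, ← he, sub_add_cancel, h1]
    field_simp
    ring
  have hI1 := integrable_diffQuot_sq_mul hp hv hB i h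
  have hI2 : Integrable fun x => diffQuot i h p (x - h • e) ^ 2 * v x := by
    refine (hI1.comp_sub_right (h • e)).congr (Eventually.of_forall fun x => ?_)
    have := hinv x (-h)
    simp only [neg_smul, ← sub_eq_add_neg] at this
    simp only
    rw [this]
  have hI3 : Integrable fun x => diffQuot i (2 * h) p (x - h • e) ^ 2 * v x := by
    refine ((integrable_diffQuot_sq_mul hp hv hB i (2 * h)).comp_sub_right (h • e)).congr
      (Eventually.of_forall fun x => ?_)
    have := hinv x (-h)
    simp only [neg_smul, ← sub_eq_add_neg] at this
    simp only
    rw [this]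
  simp_rw [hident]
  rw [integral_sub (by exact (hI1.const_mul 2).add (hI2.const_mul 2)) (hI3.const_mul 4),
    integral_add (hI1.const_mul 2) (hI2.const_mul 2)]
  simp_rw [integral_const_mul]
  rw [hshift fun x => diffQuot i h p x ^ 2, hshift fun x => diffQuot i (2 * h) p x ^ 2]
  ring

/-- By `integral_secondDiff_sq` each halving of the scale increases the energy by a quarter of a
weighted integral of squares. -/
theorem integral_diffQuot_sq_le_half (hp : LipSupp C R p) (hv : Continuous v)
    (hB : ∀ x, |v x| ≤ B) (hv0 : ∀ x, 0 ≤ v x) (i : Fin d)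
    (hinv : ∀ x (t : ℝ), v (x + t • EuclideanSpace.single i 1) = v x) {m n : ℕ} (hmn : m ≤ n) :
    ∫ x, diffQuot i ((1 / 2) ^ m) p x ^ 2 * v x ≤ ∫ x, diffQuot i ((1 / 2) ^ n) p x ^ 2 * v x := by
  induction n, hmn using Nat.le_induction with
  | base => exact le_rfl
  | succ n _ ih =>
    refine ih.trans ?_
    have h1 := integral_secondDiff_sq hp hv hB i hinv (h := (1 / 2) ^ (n + 1)) (by positivity)
    have h2 : 0 ≤ ∫ x, secondDiff i ((1 / 2) ^ (n + 1)) p x ^ 2 * v x :=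
      integral_nonneg fun x => mul_nonneg (sq_nonneg _) (hv0 x)
    have h3 : (2 : ℝ) * (1 / 2) ^ (n + 1) = (1 / 2) ^ n := by rw [pow_succ]; ring
    rw [h3] at h1
    linarith

end Energy

/-! ### Translates of Jacobians and expansion by rows -/

section Step

variable {d : ℕ}

theorem LipSupp.shift {C : ℝ≥0} {R h : ℝ} {p : EuclideanSpace ℝ (Fin d) → ℝ}
    (hp : LipSupp C R p) (i : Fin d) :
    LipSupp C (R + |h|) fun x => p (x + h • EuclideanSpace.single i 1) :=
  ⟨LipschitzWith.of_dist_le_mul fun x y => by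
    have := hp.lip.dist_le_mul (x + h • EuclideanSpace.single i 1)
      (y + h • EuclideanSpace.single i 1)
    rwa [dist_add_right] at this, fun _ hx => hp.zero_shift i hx⟩

theorem LipSupp.enlarge {C : ℝ≥0} {R R' : ℝ} {p : EuclideanSpace ℝ (Fin d) → ℝ}
    (hp : LipSupp C R p) (h : R ≤ R') : LipSupp C R' p :=
  ⟨hp.lip, fun x hx => hp.zero x (h.trans_lt hx)⟩

theorem LipSupp.sub {C C' : ℝ≥0} {R : ℝ} {p q : EuclideanSpace ℝ (Fin d) → ℝ}
    (hp : LipSupp C R p) (hq : LipSupp C' R q) : LipSupp (C + C') R fun x => p x - q x :=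
  ⟨hp.lip.sub hq.lip, fun x hx => by rw [hp.zero x hx, hq.zero x hx, sub_zero]⟩

theorem LipSupp.div {C : ℝ≥0} {R : ℝ} {p : EuclideanSpace ℝ (Fin d) → ℝ}
    (hp : LipSupp C R p) (a : ℝ≥0) : LipSupp (C / a) R fun x => p x / a :=
  ⟨LipschitzWith.of_dist_le_mul fun x y => by
    rw [Real.dist_eq, ← sub_div, abs_div, NNReal.abs_eq, NNReal.coe_div, div_mul_eq_mul_div]
    exact div_le_div_of_nonneg_right (hp.lip.dist_le_mul x y) a.2,
    fun x hx => by rw [hp.zero x hx, zero_div]⟩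

theorem jacDet_shift (p : Fin d → EuclideanSpace ℝ (Fin d) → ℝ)
    (a x : EuclideanSpace ℝ (Fin d)) :
    jacDet (fun j y => p j (y + a)) x = jacDet p (x + a) := by
  simp only [jacDet, gradMat]
  congr 1
  ext j k
  simp only [Matrix.of_apply]
  rw [fderiv_comp_add_right]

theorem integrable_mul_jacDet {C C' : ℝ≥0} {R : ℝ} (hd : 0 < d) (hR : 0 ≤ R)
    {p : Fin d → EuclideanSpace ℝ (Fin d) → ℝ} (hp : ∀ j, LipschitzWith C (p j))
    {w : EuclideanSpace ℝ (Fin d) → ℝ} (hw : LipSupp C' R w) :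
    Integrable fun x => w x * jacDet p x := by
  refine integrable_of_bounded_support (R := R)
    (B := (C' * (2 * R + 1)) * (d.factorial * ∏ _j : Fin d, (C : ℝ)))
    (hw.lip.continuous.measurable.mul (measurable_jacDet p)) (fun x => ?_)
    fun x hx => by rw [hw.zero x hx, zero_mul]
  rw [abs_mul]
  have := abs_jacDet_le hp x
  gcongr
  exact hw.bounded hd hR x

/-- The components of the first map up to `m`, those of the second from `m` on. -/
def hybrid (p q : Fin d → EuclideanSpace ℝ (Fin d) → ℝ) (m : ℕ) :
    Fin d → EuclideanSpace ℝ (Fin d) → ℝ :=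
  fun k => if (k : ℕ) < m then q k else p k

/-- Telescoping over `hybrid p q m`, which carries `q` in the rows below `m` and `p` in the others:
consecutive hybrids differ in row `m` alone, and the determinant is linear in that row. -/
theorem ae_jacDet_sub_eq_sum {C : ℝ≥0} {p q : Fin d → EuclideanSpace ℝ (Fin d) → ℝ}
    (hp : ∀ j, LipschitzWith C (p j)) (hq : ∀ j, LipschitzWith C (q j)) :
    ∀ᵐ x, jacDet q x - jacDet p x =
      ∑ m : Fin d, jacDet (Function.update (hybrid p q m) m fun y => q m y - p m y) x := by
  filter_upwards [ae_differentiableAt_all hp, ae_differentiableAt_all hq] with x hpx hqx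
  have hstep : ∀ m : Fin d,
      jacDet (Function.update (hybrid p q m) m fun y => q m y - p m y) x =
        jacDet (hybrid p q (m + 1)) x - jacDet (hybrid p q m) x := by
    intro m
    have h1 : hybrid p q (m + 1) = Function.update (hybrid p q m) m (q m) := by
      funext k
      by_cases hk : k = m
      · subst hk; simp [hybrid]
      · have : ((k : ℕ) < m + 1) ↔ ((k : ℕ) < m) := by
          have : (k : ℕ) ≠ m := fun h => hk (Fin.ext h)
          omega
        simp [hybrid, hk, this]
    have h2 : hybrid p q m = Function.update (hybrid p q m) m (p m) := by
      funext k
      by_cases hk : k = m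
      · subst hk; simp [hybrid]
      · simp [hk]
    have e : (fun i => fderiv ℝ (fun y => q m y - p m y) x (EuclideanSpace.single i 1)) =
        (fun i => fderiv ℝ (q m) x (EuclideanSpace.single i 1)) +
        (-1 : ℝ) • fun i => fderiv ℝ (p m) x (EuclideanSpace.single i 1) := by
      ext i
      rw [fderiv_fun_sub (hqx m) (hpx m)]
      simp [sub_eq_add_neg]
    rw [h1]
    conv_rhs => rw [h2]
    rw [Function.update_idem]
    simp only [jacDet]
    rw [gradMat_update, gradMat_update, gradMat_update, e, Matrix.det_updateRow_add,
      Matrix.det_updateRow_smul]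
    ring
  simp_rw [hstep]
  rw [Fin.sum_univ_eq_sum_range (fun m => jacDet (hybrid p q (m + 1)) x - jacDet (hybrid p q m) x),
    Finset.sum_range_sub (fun m => jacDet (hybrid p q m) x)]
  congr 2
  funext k
  simp [hybrid]

theorem prod_update_const (m : Fin d) (a C : ℝ) :
    ∏ k, Function.update (fun _ => C) m a k = a * C ^ (d - 1) := by
  rw [Finset.prod_update_of_mem (Finset.mem_univ m)]
  simp [Finset.card_sdiff]

/-- A difference of translates is close to the slowly varying average of such differences up to
second differences. -/
theorem abs_diffQuot_sub_le (i : Fin d) {h : ℝ} (hh : h ≠ 0) {M : ℕ} (hM : 0 < M)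
    (p : EuclideanSpace ℝ (Fin d) → ℝ) (x : EuclideanSpace ℝ (Fin d)) :
    |diffQuot i h p x - diffQuot i (M * h) p x| ≤
      ∑ t ∈ Finset.range M, |secondDiff i h p (x + (((t : ℝ) + 1) * h) • EuclideanSpace.single i 1)| := by
  set e : EuclideanSpace ℝ (Fin d) := EuclideanSpace.single i 1 with he
  set q : ℕ → ℝ := fun t => diffQuot i h p (x + ((t : ℝ) * h) • e) with hq
  have hq1 : ∀ t : ℕ, q (t + 1) - q t = secondDiff i h p (x + (((t : ℝ) + 1) * h) • e) := by
    intro t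
    rw [← diffQuot_sub_diffQuot]
    simp only [hq]
    push_cast
    congr 2
    rw [add_sub_assoc, ← he, ← sub_smul]
    congr 2
    ring
  have hM0 : (M : ℝ) ≠ 0 := by positivity
  -- The quotient over the long step `M * h` is the average of `M` consecutive quotients over the
  -- short step `h`; consecutive ones differ by a second difference.
  have havg : diffQuot i (M * h) p x = (∑ t ∈ Finset.range M, q t) / M := by
    have : ∀ t : ℕ, q t = (fun s : ℕ => p (x + ((s : ℝ) * h) • e) / h) (t + 1) -
        (fun s : ℕ => p (x + ((s : ℝ) * h) • e) / h) t := by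
      intro t
      simp only [hq, diffQuot, ← he]
      rw [sub_div, add_assoc, ← add_smul]
      congr 5
      push_cast; ring
    rw [Finset.sum_congr rfl fun t _ => this t,
      Finset.sum_range_sub fun s : ℕ => p (x + ((s : ℝ) * h) • e) / h]
    simp only [diffQuot, ← he, Nat.cast_zero, zero_mul, zero_smul, add_zero]
    field_simp
  have hq0 : diffQuot i h p x = q 0 := by simp [hq]
  have hbd : ∀ t ∈ Finset.range M, |q 0 - q t| ≤ ∑ s ∈ Finset.range M, |q (s + 1) - q s| := by
    intro t ht
    rw [abs_sub_comm, ← Finset.sum_range_sub]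
    refine (Finset.abs_sum_le_sum_abs _ _).trans ?_
    refine Finset.sum_le_sum_of_subset_of_nonneg ?_ fun _ _ _ => abs_nonneg _
    exact Finset.range_subset_range.mpr (Finset.mem_range.mp ht).le
  simp_rw [← hq1]
  have : q 0 - (∑ t ∈ Finset.range M, q t) / M = (∑ t ∈ Finset.range M, (q 0 - q t)) / M := by
    rw [Finset.sum_sub_distrib]
    simp
    field_simp
  rw [hq0, havg, this, abs_div, Nat.abs_cast, div_le_iff₀ (by positivity)]
  refine (Finset.abs_sum_le_sum_abs _ _).trans ((Finset.sum_le_sum hbd).trans ?_)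
  simp [mul_comm]

theorem abs_integral_le_of_bounded {F : EuclideanSpace ℝ (Fin d) → ℝ} {B R : ℝ}
    (hB : ∀ x, |F x| ≤ B) (h0 : ∀ x, R < ‖x‖ → F x = 0) :
    |∫ x, F x| ≤ B * volume.real (Metric.closedBall (0 : EuclideanSpace ℝ (Fin d)) R) := by
  rw [← setIntegral_eq_integral_of_forall_compl_eq_zero (s := Metric.closedBall 0 R)
    fun x hx => h0 x (by simpa using hx)]
  exact norm_setIntegral_le_of_norm_le_const (f := F) measure_closedBall_lt_top fun x _ => hB x

theorem LipSupp.bdd_mul (hd : 0 < d) {L ρ : ℝ≥0} {R : ℝ} (hR : 0 ≤ R)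
    {r g : EuclideanSpace ℝ (Fin d) → ℝ} (hg : LipSupp L R g) (hr : LipschitzWith ρ r)
    (hr1 : ∀ x, |r x| ≤ 1) : ∃ C', LipSupp C' R fun x => r x * g x := by
  refine ⟨ρ * (L * (2 * R.toNNReal + 1)) + L, LipschitzWith.of_dist_le_mul fun x y => ?_,
    fun x hx => by rw [hg.zero x hx, mul_zero]⟩
  have h1 := hr.dist_le_mul x y
  have h2 := hg.lip.dist_le_mul x y
  have h3 := hg.bounded hd hR x
  have h4 := hr1 y
  rw [Real.dist_eq] at *
  have e : r x * g x - r y * g y = (r x - r y) * g x + r y * (g x - g y) := by ring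
  rw [e]
  refine (abs_add_le _ _).trans ?_
  rw [abs_mul, abs_mul]
  push_cast
  rw [Real.coe_toNNReal R hR]
  calc _ ≤ (ρ * dist x y) * (L * (2 * R + 1)) + 1 * (L * dist x y) := by gcongr
    _ = _ := by ring

/-- The large constant `ρ` of the wave multiplies `|g x|` pointwise rather than its supremum, so
that this term can later be absorbed by the weight `v`. -/
theorem ae_abs_fderiv_mul_le {L ρ : ℝ≥0} {r g : EuclideanSpace ℝ (Fin d) → ℝ}
    (hg : LipschitzWith L g) (hr : LipschitzWith ρ r) (hr1 : ∀ x, |r x| ≤ 1) :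
    ∀ᵐ x, ∀ k, |fderiv ℝ (fun y => r y * g y) x (EuclideanSpace.single k 1)| ≤
      ρ * |g x| + L := by
  filter_upwards [hg.ae_differentiableAt, hr.ae_differentiableAt] with x h1 h2 k
  rw [fderiv_fun_mul h2 h1]
  simp only [add_apply, smul_apply, smul_eq_mul]
  refine (abs_add_le _ _).trans ?_
  rw [abs_mul, abs_mul, add_comm]
  have h3 := abs_fderiv_single_le hg x k
  have h4 := abs_fderiv_single_le hr x k
  have h5 := hr1 x
  calc _ ≤ |g x| * ρ + 1 * L := by gcongr
    _ = _ := by ring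

variable {C L ρ : ℝ≥0} {R B h : ℝ} {M : ℕ} {p : Fin d → EuclideanSpace ℝ (Fin d) → ℝ}
  {r g v : EuclideanSpace ℝ (Fin d) → ℝ}

/-- A row with small gradient makes the whole determinant small. Keeping `g` under the integral
makes the bound depend on the mass of `v` and not on its maximum, which grows with the stages. -/
theorem abs_integral_mul_jacDet_update_le
    (hp : ∀ j, LipschitzWith C (p j)) (m : Fin d) {c : EuclideanSpace ℝ (Fin d) → ℝ} {a : ℝ≥0}
    (hc : LipschitzWith a c) (hg0 : ∀ x, R < ‖x‖ → g x = 0)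
    (hgv : ∀ x, |g x| ≤ v x) (hv : Continuous v) :
    |∫ x, g x * jacDet (Function.update p m c) x| ≤
      d.factorial * (a * C ^ (d - 1)) *
        ∫ x in Metric.closedBall (0 : EuclideanSpace ℝ (Fin d)) (R + 1), v x := by
  rw [← setIntegral_eq_integral_of_forall_compl_eq_zero
    (s := Metric.closedBall (0 : EuclideanSpace ℝ (Fin d)) (R + 1))
    fun x hx => by
      rw [hg0 x (by have : R + 1 < ‖x‖ := by simpa using hx
                    linarith), zero_mul], ← integral_const_mul]
  have hvi : IntegrableOn v (Metric.closedBall (0 : EuclideanSpace ℝ (Fin d)) (R + 1)) :=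
    hv.continuousOn.integrableOn_compact (isCompact_closedBall _ _)
  refine (abs_integral_le_integral_abs).trans (integral_mono_of_nonneg
    (Eventually.of_forall fun x => abs_nonneg _) (hvi.const_mul _)
    (Eventually.of_forall fun x => ?_))
  have h1 : |jacDet (Function.update p m c) x| ≤ d.factorial * (a * C ^ (d - 1)) := by
    have h2 := abs_jacDet_le (p := Function.update p m c)
      (b := Function.update (fun _ => C) m a) (fun k => by
        by_cases hk : k = m
        · subst hk; simpa using hc
        · simpa [hk] using hp k) x
    have h3 : ∏ k, ((Function.update (fun _ => C) m a k : ℝ≥0) : ℝ) = a * C ^ (d - 1) := by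
      rw [← prod_update_const m]
      refine Finset.prod_congr rfl fun k _ => ?_
      by_cases hk : k = m
      · subst hk; simp
      · simp [hk]
    rwa [h3] at h2
  simp only
  rw [abs_mul, mul_comm]
  have h4 := hgv x
  gcongr

end Step

/-! ### The estimate for a single oscillation -/

section Step

variable {d : ℕ} {C L ρ : ℝ≥0} {R B h : ℝ} {M : ℕ}
  {p : Fin d → EuclideanSpace ℝ (Fin d) → ℝ} {r g v : EuclideanSpace ℝ (Fin d) → ℝ}

/-- Translating the first integral by `h` flips the sign of `r`, so the sum only retains the
increment of `g` over `h`, at most `L * h`. -/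
theorem integral_mul_jacDet_add_shift (hd : 0 < d) (hR : 0 ≤ R) (i : Fin d)
    (hp : ∀ j, LipSupp C R (p j)) (hh : 0 < h) (hh1 : h ≤ 1)
    (hr : LipschitzWith ρ r) (hr1 : ∀ x, |r x| ≤ 1)
    (hanti : ∀ x, r (x + h • EuclideanSpace.single i 1) = -r x) (hg : LipSupp L R g) :
    |(∫ x, (r x * g x) * jacDet p x) + ∫ x, (r x * g x) *
        jacDet (fun j y => p j (y + h • EuclideanSpace.single i 1)) x| ≤
      L * h * (d.factorial * C ^ d) *
        volume.real (Metric.closedBall (0 : EuclideanSpace ℝ (Fin d)) (R + 1)) := by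
  set e : EuclideanSpace ℝ (Fin d) := EuclideanSpace.single i 1 with he
  set q : Fin d → EuclideanSpace ℝ (Fin d) → ℝ := fun j y => p j (y + h • e) with hq
  have hqL : ∀ j, LipSupp C (R + |h|) (q j) := fun j => (hp j).shift i
  obtain ⟨C₁, hw⟩ := hg.bdd_mul hd hR hr hr1
  have hgs : LipSupp L (R + |h|) fun x => g (x + h • e) := hg.shift i
  have hR' : 0 ≤ R + |h| := by positivity
  obtain ⟨C₂, hw'⟩ := hgs.bdd_mul hd hR' hr hr1
  have h1 : ∫ x, (r x * g x) * jacDet p x = -∫ x, (r x * g (x + h • e)) * jacDet q x := by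
    rw [← integral_add_right_eq_self _ (h • e), ← integral_neg]
    refine integral_congr_ae (Eventually.of_forall fun x => ?_)
    simp only
    rw [hanti, hq, jacDet_shift]
    ring
  have h2 : (∫ x, (r x * g x) * jacDet p x) + ∫ x, (r x * g x) * jacDet q x =
      ∫ x, (r x * (g x - g (x + h • e))) * jacDet q x := by
    rw [h1, neg_add_eq_sub, ← integral_sub
      (integrable_mul_jacDet hd hR (fun j => (hqL j).lip) hw)
      (integrable_mul_jacDet hd hR' (fun j => (hqL j).lip) hw')]
    refine integral_congr_ae (Eventually.of_forall fun x => ?_)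
    simp only
    ring
  rw [h2]
  refine abs_integral_le_of_bounded (fun x => ?_) fun x hx => ?_
  · have h3 := abs_jacDet_le (fun j => (hqL j).lip) x
    rw [Finset.prod_const, Finset.card_univ, Fintype.card_fin] at h3
    have h4 := abs_shift_sub_le hg.lip i h x
    rw [abs_sub_comm, abs_of_pos hh] at h4
    rw [abs_mul, abs_mul]
    have h5 := hr1 x
    calc _ ≤ 1 * (L * h) * (d.factorial * (C : ℝ) ^ d) := by gcongr
      _ = _ := by ring
  · rw [jacDet_eq_zero_of_norm_gt (hqL ⟨0, hd⟩) (by rw [abs_of_pos hh]; linarith), mul_zero]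

/-- The contribution of one row after integrating by parts. -/
theorem abs_integral_row_le (hd : 0 < d) (hR : 0 ≤ R) (i : Fin d) (hh : 0 < h)
    (hM : 0 < M) {P : Fin d → EuclideanSpace ℝ (Fin d) → ℝ} {R' : ℝ}
    (hP : ∀ j, LipSupp C R' (P j)) (hRR : R ≤ R')
    {f : EuclideanSpace ℝ (Fin d) → ℝ} (hf : LipSupp C R f) (hRM : R + M * h ≤ R')
    (hr : LipschitzWith ρ r) (hρ : (ρ : ℝ) ≤ 4 / h) (hr1 : ∀ x, |r x| ≤ 1)
    (hg : LipSupp L R g) (hv : Continuous v) (hB : ∀ x, |v x| ≤ B)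
    (hinv : ∀ x (t : ℝ), v (x + t • EuclideanSpace.single i 1) = v x)
    (hgv : ∀ x, |g x| ≤ v x) (m : Fin d) :
    |∫ x, (r x * g x) * jacDet (Function.update P m fun y =>
        f (y + h • EuclideanSpace.single i 1) - f y) x| ≤
      d.factorial * (2 * C / M * C ^ (d - 1)) *
        (∫ x in Metric.closedBall (0 : EuclideanSpace ℝ (Fin d)) (R + 1), v x) +
      d.factorial * C ^ (d - 1) * (4 * (M * ∫ x, |secondDiff i h f x| * v x) +
        2 * C * h * L * volume.real (Metric.closedBall (0 : EuclideanSpace ℝ (Fin d)) R)) := by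
  set e : EuclideanSpace ℝ (Fin d) := EuclideanSpace.single i 1 with he
  have hM0 : (0 : ℝ) < M := by exact_mod_cast hM
  have hR' : 0 ≤ R' := hR.trans hRR
  have hMh : |(M : ℝ) * h| = M * h := abs_of_pos (by positivity)
  have hM1 : (1 : ℝ) ≤ M := by exact_mod_cast hM
  have hhM : h ≤ M * h := by nlinarith
  set ψ : EuclideanSpace ℝ (Fin d) → ℝ := fun y => f (y + h • e) - f y with hψ
  -- The slowly varying part of the increment `ψ`: it is `h` times the quotient over the step `M *
  -- h`, but its Lipschitz constant is only `2 * C / M`. It is estimated directly, without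
  -- integrating by parts.
  set c : EuclideanSpace ℝ (Fin d) → ℝ := fun y => (f (y + (M * h) • e) - f y) / (M : ℝ≥0) with hc
  have hfR : LipSupp C R' f := hf.enlarge hRR
  have hψL : LipSupp (C + C) R' ψ :=
    ((hf.shift i).enlarge (by rw [abs_of_pos hh]; linarith)).sub hfR
  have hcL : LipSupp ((C + C) / M) R' c :=
    (((hf.shift i).enlarge (by rw [hMh]; exact hRM)).sub hfR).div M
  have hψc := hψL.sub hcL
  obtain ⟨C₁, hw⟩ := hg.bdd_mul hd hR hr hr1
  have hwv : ∀ x, |r x * g x| ≤ v x := fun x => by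
    rw [abs_mul]
    calc _ ≤ 1 * v x := mul_le_mul (hr1 x) (hgv x) (abs_nonneg _) zero_le_one
      _ = v x := one_mul _
  -- splitting off the slowly varying part
  have hsplit : ∫ x, (r x * g x) * jacDet (Function.update P m ψ) x =
      (∫ x, (r x * g x) * jacDet (Function.update P m c) x) +
      ∫ x, (r x * g x) * jacDet (Function.update P m fun y => ψ y - c y) x := by
    have hupd : ∀ {u : EuclideanSpace ℝ (Fin d) → ℝ} {a : ℝ≥0}, LipschitzWith a u →
        ∀ k, LipschitzWith (max C a) (Function.update P m u k) := fun hu k => by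
      by_cases hk : k = m
      · subst hk; simpa using hu.weaken (le_max_right _ _)
      · simpa [hk] using (hP k).lip.weaken (le_max_left _ _)
    rw [← integral_add (integrable_mul_jacDet hd hR (hupd hcL.lip) hw)
      (integrable_mul_jacDet hd hR (hupd hψc.lip) hw)]
    refine integral_congr_ae ?_
    filter_upwards [hψL.lip.ae_differentiableAt, hcL.lip.ae_differentiableAt] with x hx1 hx2
    have e1 : (fun i => fderiv ℝ ψ x (EuclideanSpace.single i 1)) =
        (fun i => fderiv ℝ c x (EuclideanSpace.single i 1)) +
        fun i => fderiv ℝ (fun y => ψ y - c y) x (EuclideanSpace.single i 1) := by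
      ext k
      rw [Pi.add_apply, fderiv_fun_sub hx1 hx2]
      simp
    simp only [jacDet]
    rw [gradMat_update, gradMat_update, gradMat_update, e1, Matrix.det_updateRow_add]
    ring
  have hslow := abs_integral_mul_jacDet_update_le (g := fun x => r x * g x) (R := R) (fun j => (hP j).lip) m
    hcL.lip hw.zero hwv hv
  have hslow' : (((C + C) / M : ℝ≥0) : ℝ) = 2 * C / M := by push_cast; ring
  rw [hslow'] at hslow
  -- the fast part
  have hPu : ∀ k, LipSupp (max C (C + C + (C + C) / M)) R' (Function.update P m (fun y => ψ y - c y) k) := fun k => by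
    by_cases hk : k = m
    · subst hk; simpa using hψc.mono (le_max_right _ _)
    · simpa [hk] using (hP k).mono (le_max_left _ _)
  -- For `ψ - c` the derivative is moved to `r * g`. This costs `4 / h * v`, which the factor `h` in
  -- `hsd` compensates; the derivative of `g` itself meets the bound `hsmall` and gives the term
  -- with `h * L`.
  have hibp := integral_mul_jacDet hd hR' hPu (hw.enlarge hRR) m
  rw [Function.update_self, Function.update_idem] at hibp
  have hsmall : ∀ x, |ψ x - c x| ≤ 2 * C * h := by
    intro x
    have h1 := abs_shift_sub_le hf.lip i h x
    have h2 := abs_shift_sub_le hf.lip i (M * h) x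
    rw [abs_of_pos hh] at h1
    rw [hMh] at h2
    have h3 : |c x| ≤ C * h := by
      simp only [hc, abs_div]
      rw [NNReal.coe_natCast, Nat.abs_cast, div_le_iff₀ hM0]
      exact h2.trans_eq (by ring)
    refine (abs_sub _ _).trans ?_
    linarith
  have hsd : ∀ x, |ψ x - c x| ≤
      h * ∑ t ∈ Finset.range M, |secondDiff i h f (x + (((t : ℝ) + 1) * h) • e)| := by
    intro x
    have h1 := abs_diffQuot_sub_le i hh.ne' hM f x
    have h2 : ψ x - c x = h * (diffQuot i h f x - diffQuot i (M * h) f x) := by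
      simp only [hψ, hc, diffQuot, ← he, NNReal.coe_natCast]
      field_simp
    rw [h2, abs_mul, abs_of_pos hh]
    gcongr
  have hSint : ∀ t : ℕ, Integrable fun x =>
      |secondDiff i h f (x + (((t : ℝ) + 1) * h) • e)| * v x := by
    intro t
    refine ((integrable_abs_secondDiff_mul hf hv hB i h).comp_add_right
      ((((t : ℝ) + 1) * h) • e)).congr (Eventually.of_forall fun x => ?_)
    simp only
    rw [hinv]
  -- All translated second differences have the same weighted integral since `v` is invariant in
  -- direction `i`, whence the factor `M`.
  have hSeq : ∀ t : ℕ, ∫ x, |secondDiff i h f (x + (((t : ℝ) + 1) * h) • e)| * v x =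
      ∫ x, |secondDiff i h f x| * v x := by
    intro t
    rw [← integral_add_right_eq_self (fun x => |secondDiff i h f x| * v x)
      ((((t : ℝ) + 1) * h) • e)]
    refine integral_congr_ae (Eventually.of_forall fun x => ?_)
    simp only
    rw [hinv]
  set b : EuclideanSpace ℝ (Fin d) → ℝ := (Metric.closedBall 0 R).indicator fun _ => 2 * C * h * L
    with hb
  have hbint : Integrable b := (integrable_indicator_iff measurableSet_closedBall).mpr
    (integrableOn_const measure_closedBall_lt_top.ne)
  have hfast : |∫ x, (ψ x - c x) * jacDet (Function.update P m fun x => r x * g x) x| ≤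
      ∫ x, d.factorial * C ^ (d - 1) * (4 * (∑ t ∈ Finset.range M,
        |secondDiff i h f (x + (((t : ℝ) + 1) * h) • e)| * v x) + b x) := by
    refine abs_integral_le_integral_abs.trans (integral_mono_of_nonneg
      (Eventually.of_forall fun x => abs_nonneg _)
      ((((integrable_finsetSum _ fun t _ => hSint t).const_mul 4).add hbint).const_mul _) ?_)
    filter_upwards [ae_abs_fderiv_mul_le hg.lip hr hr1] with x hx
    simp only [hb]
    have hv0 : 0 ≤ v x := (abs_nonneg _).trans (hgv x)
    by_cases hxR : R < ‖x‖
    · rw [jacDet_eq_zero_of_fderiv (j := m) (by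
        rw [Function.update_self]; exact fderiv_eq_zero_of_norm_gt hw.zero hxR), mul_zero, abs_zero]
      have : 0 ≤ ∑ t ∈ Finset.range M, |secondDiff i h f (x + (((t : ℝ) + 1) * h) • e)| * v x :=
        Finset.sum_nonneg fun t _ => mul_nonneg (abs_nonneg _) hv0
      have h2 : 0 ≤ (Metric.closedBall (0 : EuclideanSpace ℝ (Fin d)) R).indicator
          (fun _ => 2 * (C : ℝ) * h * L) x := Set.indicator_nonneg (fun _ _ => by positivity) _
      positivity
    · have hxm : x ∈ Metric.closedBall (0 : EuclideanSpace ℝ (Fin d)) R := by simpa using hxR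
      rw [Set.indicator_of_mem hxm]
      have hJ : |jacDet (Function.update P m fun x => r x * g x) x| ≤
          d.factorial * ((ρ * |g x| + L) * C ^ (d - 1)) := by
        rw [← prod_update_const m]
        refine abs_det_le _ _ fun j k => ?_
        by_cases hj : j = m
        · subst hj
          simpa [gradMat] using hx k
        · simpa [gradMat, hj] using abs_fderiv_single_le (hP j).lip x k
      rw [abs_mul]
      have hgρ : ρ * |g x| ≤ 4 / h * v x := mul_le_mul hρ (hgv x) (abs_nonneg _) (by positivity)
      calc |ψ x - c x| * |jacDet (Function.update P m fun x => r x * g x) x|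
          ≤ |ψ x - c x| * (d.factorial * ((4 / h * v x + L) * C ^ (d - 1))) := by
            refine mul_le_mul_of_nonneg_left (hJ.trans ?_) (abs_nonneg _)
            gcongr
        _ = d.factorial * C ^ (d - 1) *
            (4 / h * v x * |ψ x - c x| + |ψ x - c x| * L) := by ring
        _ ≤ d.factorial * C ^ (d - 1) * (4 / h * v x *
            (h * ∑ t ∈ Finset.range M, |secondDiff i h f (x + (((t : ℝ) + 1) * h) • e)|) +
              2 * C * h * L) := by
            have := hsd x
            have := hsmall x
            gcongr
        _ = _ := by
            rw [← Finset.sum_mul]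
            field_simp
  have hfast2 : ∫ x, d.factorial * C ^ (d - 1) * (4 * (∑ t ∈ Finset.range M,
        |secondDiff i h f (x + (((t : ℝ) + 1) * h) • e)| * v x) + b x) =
      d.factorial * C ^ (d - 1) * (4 * (M * ∫ x, |secondDiff i h f x| * v x) +
        2 * C * h * L * volume.real (Metric.closedBall (0 : EuclideanSpace ℝ (Fin d)) R)) := by
    rw [integral_const_mul, integral_add ((integrable_finsetSum _ fun t _ => hSint t).const_mul 4)
      hbint, integral_const_mul, integral_finsetSum _ fun t _ => hSint t]
    simp_rw [hSeq]
    simp only [Finset.sum_const, Finset.card_range, nsmul_eq_mul, hb]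
    rw [integral_indicator measurableSet_closedBall, setIntegral_const, smul_eq_mul]
    ring
  rw [hsplit, hibp]
  refine (abs_add_le _ _).trans (add_le_add hslow ?_)
  rw [abs_neg]
  exact hfast.trans_eq hfast2

theorem LipSupp.hybrid {q : Fin d → EuclideanSpace ℝ (Fin d) → ℝ} (hp : ∀ j, LipSupp C R (p j))
    (hq : ∀ j, LipSupp C R (q j)) (m : ℕ) (j : Fin d) : LipSupp C R (hybrid p q m j) := by
  unfold PrescribedJacobian.hybrid
  split_ifs
  exacts [hq j, hp j]

/-- With `a` the pairing with `jacDet p` and `b` the pairing with its translate, `2 a = (a + b) - (b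
- a)`. The sum is small by antiperiodicity, and the difference is expanded into rows. The constant
`D` depends only on `d`, `C` and `R`; in particular neither `M` nor the scale nor the weight enters
it. -/
theorem exists_step_bound (hd : 0 < d) (C : ℝ≥0) {R : ℝ} (hR : 0 ≤ R) : ∃ D : ℝ, 0 ≤ D ∧
    ∀ (i : Fin d) (p : Fin d → EuclideanSpace ℝ (Fin d) → ℝ)
      (r g v : EuclideanSpace ℝ (Fin d) → ℝ) (L ρ : ℝ≥0) (B h : ℝ) (M : ℕ),
      (∀ j, LipSupp C R (p j)) → 0 < h → h ≤ 1 → 0 < M →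
      LipschitzWith ρ r → (ρ : ℝ) ≤ 4 / h → (∀ x, |r x| ≤ 1) →
      (∀ x, r (x + h • EuclideanSpace.single i 1) = -r x) →
      LipSupp L R g → Continuous v → (∀ x, |v x| ≤ B) →
      (∀ x (t : ℝ), v (x + t • EuclideanSpace.single i 1) = v x) → (∀ x, |g x| ≤ v x) →
      |∫ x, (r x * g x) * jacDet p x| ≤
        D * ((∫ x in Metric.closedBall (0 : EuclideanSpace ℝ (Fin d)) (R + 1), v x) / M +
          M * (∑ j, ∫ x, |secondDiff i h (p j) x| * v x) + h * L) := by
  set V₁ := volume.real (Metric.closedBall (0 : EuclideanSpace ℝ (Fin d)) (R + 1)) with hV₁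
  set V₀ := volume.real (Metric.closedBall (0 : EuclideanSpace ℝ (Fin d)) R) with hV₀
  set D₀ : ℝ := d.factorial * C ^ d with hD₀
  set D₁ : ℝ := d.factorial * (C : ℝ) ^ (d - 1) with hD₁
  have hV₁0 : 0 ≤ V₁ := measureReal_nonneg
  have hV₀0 : 0 ≤ V₀ := measureReal_nonneg
  have hD₀0 : 0 ≤ D₀ := by positivity
  have hD₁0 : 0 ≤ D₁ := by positivity
  refine ⟨D₀ * V₁ + d * (D₁ * (2 * C) + 4 * D₁ + D₁ * (2 * C) * V₀), by positivity, ?_⟩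
  intro i p r g v L ρ B h M hp hh hh1 hM hr hρ hr1 hanti hg hv hB hinv hgv
  set e : EuclideanSpace ℝ (Fin d) := EuclideanSpace.single i 1 with he
  set q : Fin d → EuclideanSpace ℝ (Fin d) → ℝ := fun j y => p j (y + h • e) with hq
  set V := ∫ x in Metric.closedBall (0 : EuclideanSpace ℝ (Fin d)) (R + 1), v x with hV
  have hv0 : ∀ x, 0 ≤ v x := fun x => (abs_nonneg _).trans (hgv x)
  have hV0 : 0 ≤ V := integral_nonneg fun x => hv0 x
  have hM0 : (0 : ℝ) < M := by exact_mod_cast hM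
  have hM1 : (1 : ℝ) ≤ M := by exact_mod_cast hM
  set s : Fin d → ℝ := fun j => ∫ x, |secondDiff i h (p j) x| * v x with hs
  have hs0 : ∀ j, 0 ≤ s j := fun j =>
    integral_nonneg fun x => mul_nonneg (abs_nonneg _) (hv0 x)
  have hfirst := integral_mul_jacDet_add_shift hd hR i hp hh hh1 hr hr1 hanti hg
  obtain ⟨C₁, hw⟩ := hg.bdd_mul hd hR hr hr1
  have hqL : ∀ j, LipSupp C (R + |h|) (q j) := fun j => (hp j).shift i
  have hR1 : R ≤ R + M * h := by nlinarith [mul_pos hM0 hh]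
  have hR2 : R + |h| ≤ R + M * h := by rw [abs_of_pos hh]; nlinarith
  have hrow := fun m : Fin d => abs_integral_row_le hd hR i hh hM
    (P := hybrid p q m) (R' := R + M * h)
    (LipSupp.hybrid (fun j => (hp j).enlarge hR1) (fun j => (hqL j).enlarge hR2) m) hR1
    (hp m) le_rfl hr hρ hr1 hg hv hB hinv hgv m
  have hdiff : (∫ x, (r x * g x) * jacDet q x) - ∫ x, (r x * g x) * jacDet p x =
      ∑ m : Fin d, ∫ x, (r x * g x) *
        jacDet (Function.update (hybrid p q m) m fun y => q m y - p m y) x := by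
    rw [← integral_sub (integrable_mul_jacDet hd hR (fun j => (hqL j).lip) hw)
      (integrable_mul_jacDet hd hR (fun j => (hp j).lip) hw), ← integral_finsetSum]
    · refine integral_congr_ae ?_
      filter_upwards [ae_jacDet_sub_eq_sum (fun j => (hp j).lip) (fun j => (hqL j).lip)] with x hx
      rw [← mul_sub, hx, Finset.mul_sum]
    · intro m _
      refine integrable_mul_jacDet (C := max C (C + C)) hd hR (fun k => ?_) hw
      by_cases hk : k = m
      · subst hk
        rw [Function.update_self]
        exact ((hqL k).lip.sub (hp k).lip).weaken (le_max_right _ _)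
      · rw [Function.update_of_ne hk]
        exact (LipSupp.hybrid (fun j => (hp j).enlarge hR1) (fun j => (hqL j).enlarge hR2) m
          k).lip.weaken (le_max_left _ _)
  have hsum : |(∫ x, (r x * g x) * jacDet q x) - ∫ x, (r x * g x) * jacDet p x| ≤
      ∑ m : Fin d, (D₁ * (2 * C) * (V / M) + D₁ * (4 * (M * s m) + 2 * C * h * L * V₀)) := by
    rw [hdiff]
    refine (Finset.abs_sum_le_sum_abs _ _).trans (Finset.sum_le_sum fun m _ => ?_)
    refine (hrow m).trans_eq ?_
    simp only [hD₁, hs, hV₀, hV]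
    ring
  rw [Finset.sum_add_distrib, Finset.sum_const, Finset.card_univ, Fintype.card_fin, nsmul_eq_mul,
    ← Finset.mul_sum, Finset.sum_add_distrib, ← Finset.mul_sum, ← Finset.mul_sum,
    Finset.sum_const, Finset.card_univ, Fintype.card_fin, nsmul_eq_mul] at hsum
  set S := ∑ j, s j with hS
  have hS0 : 0 ≤ S := Finset.sum_nonneg fun j _ => hs0 j
  set a := ∫ x, (r x * g x) * jacDet p x
  set b := ∫ x, (r x * g x) * jacDet q x
  have hab : |a| ≤ |a + b| + |b - a| := by
    have : 2 * a = (a + b) - (b - a) := by ring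
    have h2 : |2 * a| ≤ |a + b| + |b - a| := by rw [this]; exact abs_sub _ _
    rw [abs_mul, abs_two] at h2
    linarith [abs_nonneg a]
  have hd1 : (1 : ℝ) ≤ d := by exact_mod_cast hd
  have hVM : 0 ≤ V / M := by positivity
  have hhL : 0 ≤ h * L := by positivity
  have hMS : 0 ≤ M * S := by positivity
  calc |a| ≤ |a + b| + |b - a| := hab
    _ ≤ L * h * D₀ * V₁ + (d * (D₁ * (2 * C) * (V / M)) +
        D₁ * (4 * (M * S) + d * (2 * C * h * L * V₀))) := add_le_add hfirst hsum
    _ ≤ _ := by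
      have e1 : 0 ≤ D₁ * (M * S) := by positivity
      have e2 : 1 * (D₁ * (M * S)) ≤ d * (D₁ * (M * S)) := mul_le_mul_of_nonneg_right hd1 e1
      have e3 : 0 ≤ D₀ * V₁ * (V / M + M * S) := by positivity
      have e4 : 0 ≤ d * (D₁ * (2 * C)) * (M * S + h * L) := by positivity
      have e5 : 0 ≤ d * (4 * D₁) * (V / M + h * L) := by positivity
      have e6 : 0 ≤ d * (D₁ * (2 * C) * V₀) * (V / M + M * S) := by positivity
      linarith

end Step

/-! ### Periodic profiles -/

section Profiles

/-- A continuous periodic function minus its mean has a bounded antiderivative. -/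
theorem exists_bounded_antiderivative {φ : ℝ → ℝ} (hφ : Continuous φ) {c : ℝ} (hc : 0 < c)
    (hper : Function.Periodic φ c) :
    ∃ (Γ : ℝ → ℝ) (K : ℝ), (∀ t, HasDerivAt Γ (φ t - (∫ s in (0 : ℝ)..c, φ s) / c) t) ∧
      ∀ t, |Γ t| ≤ K := by
  set m := (∫ s in (0 : ℝ)..c, φ s) / c with hm
  have hψ : Continuous fun t => φ t - m := hφ.sub continuous_const
  have hψp : Function.Periodic (fun t => φ t - m) c := fun t => by simp only [hper t]
  set Γ : ℝ → ℝ := fun t => ∫ s in (0 : ℝ)..t, (φ s - m) with hΓ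
  have hder : ∀ t, HasDerivAt Γ (φ t - m) t := fun t =>
    intervalIntegral.integral_hasDerivAt_right (hψ.intervalIntegrable _ _)
      (hψ.stronglyMeasurableAtFilter _ _) hψ.continuousAt
  have hzero : ∫ s in (0 : ℝ)..c, (φ s - m) = 0 := by
    rw [intervalIntegral.integral_sub (hφ.intervalIntegrable _ _) (by simp),
      intervalIntegral.integral_const, hm]
    simp only [sub_zero, smul_eq_mul]
    field_simp
    ring
  have hΓp : Function.Periodic Γ c := by
    intro t
    have h1 := intervalIntegral.integral_add_adjacent_intervals
      (hψ.intervalIntegrable (μ := volume) 0 t) (hψ.intervalIntegrable t (t + c))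
    have h2 := hψp.intervalIntegral_add_eq t 0
    rw [zero_add, hzero] at h2
    simp only [hΓ]
    rw [← h1, h2, add_zero]
  have hΓc : Continuous Γ := continuous_iff_continuousAt.mpr fun t => (hder t).continuousAt
  obtain ⟨K, hK⟩ := (hΓp.isBounded_of_continuous hc.ne' hΓc).exists_norm_le
  exact ⟨Γ, K, hder, fun t => hK _ ⟨t, rfl⟩⟩

theorem mean_pos {φ : ℝ → ℝ} (hφ : Continuous φ) (h0 : ∀ t, 0 ≤ φ t) {c : ℝ} {a : ℝ}
    (ha : a ∈ Set.Ioo 0 c) (hpos : 0 < φ a) : 0 < (∫ s in (0 : ℝ)..c, φ s) / c := by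
  have hc : 0 < c := ha.1.trans ha.2
  refine div_pos ?_ hc
  refine (intervalIntegral.integral_pos_iff_support_of_nonneg_ae
    (Eventually.of_forall fun t => h0 t) (hφ.intervalIntegrable _ _)).mpr ⟨hc, ?_⟩
  have hopen : IsOpen (Function.support φ ∩ Set.Ioo 0 c) :=
    (hφ.isOpen_support).inter isOpen_Ioo
  refine (hopen.measure_pos volume ⟨a, hpos.ne', ha⟩).trans_le (measure_mono ?_)
  exact Set.inter_subset_inter_right _ Set.Ioo_subset_Ioc_self

/-- The profiles from which the oscillating densities are built: `β` has mean one, `ζ` is a cutoff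
equal to one where `β` does not vanish, and `α` has mean `m` and is carried by the zeros of `β`. -/
structure Profiles (β ζ α Γβ Γα : ℝ → ℝ) (K : ℝ≥0) (m : ℝ) : Prop where
  mean_pos : 0 < m
  lip_β : LipschitzWith K β
  lip_ζ : LipschitzWith K ζ
  lip_α : LipschitzWith K α
  β_nonneg : ∀ t, 0 ≤ β t
  ζ_nonneg : ∀ t, 0 ≤ ζ t
  α_nonneg : ∀ t, 0 ≤ α t
  β_le : ∀ t, β t ≤ K
  α_le : ∀ t, α t ≤ K
  add_le : ∀ t, α t + ζ t ≤ 1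
  α_mul_β : ∀ t, α t * β t = 0
  ζ_mul_β : ∀ t, ζ t * β t = β t
  deriv_β : ∀ t, HasDerivAt Γβ (β t - 1) t
  deriv_α : ∀ t, HasDerivAt Γα (α t - m) t
  Γβ_le : ∀ t, |Γβ t| ≤ K
  Γα_le : ∀ t, |Γα t| ≤ K

theorem lipschitzWith_sin : LipschitzWith 1 Real.sin :=
  lipschitzWith_of_nnnorm_deriv_le Real.differentiable_sin fun t => by
    rw [Real.deriv_sin, ← NNReal.coe_le_coe, coe_nnnorm, NNReal.coe_one]
    exact Real.abs_cos_le_one t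

/-- All profiles come from the sine: `β` is the positive part of `2 sin - 1` divided by its mean,
`ζ` the positive part of `2 sin` cut off at one, and `α` the negative part of the sine. Thus `ζ = 1`
wherever `β > 0`, and `α` lives where both vanish. -/
theorem exists_profiles : ∃ (β ζ α Γβ Γα : ℝ → ℝ) (K : ℝ≥0) (m : ℝ),
    Profiles β ζ α Γβ Γα K m := by
  have hs : Continuous Real.sin := Real.continuous_sin
  have hpi : Real.pi / 2 ∈ Set.Ioo 0 (2 * Real.pi) :=
    ⟨by positivity, by linarith [Real.pi_pos]⟩
  have hpi' : 3 * Real.pi / 2 ∈ Set.Ioo 0 (2 * Real.pi) :=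
    ⟨by positivity, by linarith [Real.pi_pos]⟩
  have hsin' : Real.sin (3 * Real.pi / 2) = -1 := by
    rw [show 3 * Real.pi / 2 = Real.pi / 2 + Real.pi by ring, Real.sin_add_pi, Real.sin_pi_div_two]
  set φ : ℝ → ℝ := fun t => max (2 * Real.sin t - 1) 0 with hφ
  set α : ℝ → ℝ := fun t => max (-Real.sin t) 0 with hα
  set ζ : ℝ → ℝ := fun t => min 1 (max (2 * Real.sin t) 0) with hζ
  have hφc : Continuous φ := by fun_prop
  have hαc : Continuous α := by fun_prop
  have hφp : Function.Periodic φ (2 * Real.pi) := fun t => by simp [hφ, Real.sin_add_two_pi]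
  have hαp : Function.Periodic α (2 * Real.pi) := fun t => by simp [hα, Real.sin_add_two_pi]
  obtain ⟨Γφ, K₁, hd₁, hK₁⟩ := exists_bounded_antiderivative hφc Real.two_pi_pos hφp
  obtain ⟨Γα, K₂, hd₂, hK₂⟩ := exists_bounded_antiderivative hαc Real.two_pi_pos hαp
  have hm₁ : 0 < (∫ s in (0 : ℝ)..(2 * Real.pi), φ s) / (2 * Real.pi) :=
    mean_pos hφc (fun t => le_max_right _ _) hpi (by simp [hφ])
  have hm₂ : 0 < (∫ s in (0 : ℝ)..(2 * Real.pi), α s) / (2 * Real.pi) :=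
    mean_pos hαc (fun t => le_max_right _ _) hpi' (by simp [hα, hsin'])
  set m₁ := (∫ s in (0 : ℝ)..(2 * Real.pi), φ s) / (2 * Real.pi)
  set m₂ := (∫ s in (0 : ℝ)..(2 * Real.pi), α s) / (2 * Real.pi)
  have h2s : LipschitzWith 2 fun t => 2 * Real.sin t := by
    refine LipschitzWith.of_dist_le_mul fun x y => ?_
    have := lipschitzWith_sin.dist_le_mul x y
    rw [Real.dist_eq] at *
    rw [← mul_sub, abs_mul, abs_two]
    simpa using this
  have hφl : LipschitzWith 2 φ := by
    have : LipschitzWith 2 fun t => 2 * Real.sin t - 1 := by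
      simpa using h2s.sub (LipschitzWith.const (1 : ℝ))
    exact this.max_const 0
  have hαl : LipschitzWith 1 α := lipschitzWith_sin.neg.max_const 0
  have hζl : LipschitzWith 2 ζ := (h2s.max_const 0).const_min 1
  have hφ1 : ∀ t, φ t ≤ 1 := fun t => max_le (by linarith [Real.sin_le_one t]) zero_le_one
  have hφ0 : ∀ t, 0 ≤ φ t := fun t => le_max_right _ _
  set K : ℝ≥0 := max (max 2 (2 / m₁).toNNReal) (max (K₁ / m₁).toNNReal K₂.toNNReal) with hK
  have hK2 : (2 : ℝ≥0) ≤ K := (le_max_left _ _).trans (le_max_left _ _)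
  have hKm : 2 / m₁ ≤ K := (Real.le_coe_toNNReal _).trans
    (by exact_mod_cast (le_max_right _ _).trans (le_max_left _ _))
  have hKK₁ : K₁ / m₁ ≤ K := (Real.le_coe_toNNReal _).trans
    (by exact_mod_cast (le_max_left _ _).trans (le_max_right _ _))
  have hKK₂ : K₂ ≤ K := (Real.le_coe_toNNReal _).trans
    (by exact_mod_cast (le_max_right _ _).trans (le_max_right _ _))
  refine ⟨fun t => φ t / m₁, ζ, α, fun t => Γφ t / m₁, Γα, K, m₂, hm₂, ?_, hζl.weaken hK2,
    hαl.weaken (le_trans (by norm_num) hK2), fun t => div_nonneg (hφ0 t) hm₁.le,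
    fun t => le_min zero_le_one (le_max_right _ _), fun t => le_max_right _ _, fun t => ?_,
    fun t => (max_le (by linarith [Real.neg_one_le_sin t]) zero_le_one).trans
      (le_trans (by norm_num) (NNReal.coe_le_coe.mpr hK2) : (1 : ℝ) ≤ K),
    fun t => ?_, fun t => ?_, fun t => ?_, fun t => ?_, hd₂, fun t => ?_,
    fun t => (hK₂ t).trans hKK₂⟩
  · refine LipschitzWith.of_dist_le_mul fun x y => ?_
    have h := hφl.dist_le_mul x y
    rw [Real.dist_eq] at *
    rw [← sub_div, abs_div, abs_of_pos hm₁]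
    calc _ ≤ ((2 : ℝ≥0) : ℝ) * dist x y / m₁ := by gcongr
      _ = 2 / m₁ * dist x y := by push_cast; ring
      _ ≤ K * dist x y := by gcongr
  · refine le_trans ?_ hKm
    have := hφ1 t
    gcongr
    linarith
  · simp only [hα, hζ]
    rcases le_total 0 (Real.sin t) with h | h
    · rw [max_eq_right (by linarith : -Real.sin t ≤ 0), zero_add]
      exact min_le_left _ _
    · rw [max_eq_right (by linarith : 2 * Real.sin t ≤ 0), min_eq_right zero_le_one, add_zero]
      exact max_le (by linarith [Real.neg_one_le_sin t]) zero_le_one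
  · simp only [hα, hφ]
    rcases le_total 0 (Real.sin t) with h | h
    · rw [max_eq_right (by linarith : -Real.sin t ≤ 0), zero_mul]
    · rw [max_eq_right (by linarith : 2 * Real.sin t - 1 ≤ 0), zero_div, mul_zero]
  · simp only [hζ, hφ]
    rcases le_total (2 * Real.sin t) 1 with h | h
    · rw [max_eq_right (by linarith : 2 * Real.sin t - 1 ≤ 0), zero_div, mul_zero]
    · rw [min_eq_left (h.trans (le_max_left _ _)), one_mul]
  · have := (hd₁ t).div_const m₁
    rwa [sub_div, div_self hm₁.ne'] at this
  · rw [abs_div, abs_of_pos hm₁]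
    refine le_trans ?_ hKK₁
    have := hK₁ t
    gcongr

end Profiles

/-! ### Bounded Lipschitz functions and averaging -/

section BoundedLipschitz

variable {d : ℕ}

/-- Functions that are Lipschitz and bounded with the same constant. -/
structure BddLip (K : ℝ≥0) (f : EuclideanSpace ℝ (Fin d) → ℝ) : Prop where
  lip : LipschitzWith K f
  le : ∀ x, |f x| ≤ K

theorem BddLip.mono {K K' : ℝ≥0} {f : EuclideanSpace ℝ (Fin d) → ℝ} (hf : BddLip K f)
    (h : K ≤ K') : BddLip K' f :=
  ⟨hf.lip.weaken h, fun x => (hf.le x).trans (by exact_mod_cast h)⟩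

theorem BddLip.mul {K K' : ℝ≥0} {f g : EuclideanSpace ℝ (Fin d) → ℝ} (hf : BddLip K f)
    (hg : BddLip K' g) : BddLip (2 * (K * K')) fun x => f x * g x := by
  refine ⟨LipschitzWith.of_dist_le_mul fun x y => ?_, fun x => ?_⟩
  · have h1 := hf.lip.dist_le_mul x y
    have h2 := hg.lip.dist_le_mul x y
    have h3 := hg.le x
    have h4 := hf.le y
    rw [Real.dist_eq] at *
    have e : f x * g x - f y * g y = (f x - f y) * g x + f y * (g x - g y) := by ring
    rw [e]
    refine (abs_add_le _ _).trans ?_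
    rw [abs_mul, abs_mul]
    push_cast
    calc _ ≤ (K * dist x y) * K' + K * (K' * dist x y) := by gcongr
      _ = _ := by ring
  · rw [abs_mul]
    have h3 := hg.le x
    have h4 := hf.le x
    push_cast
    calc _ ≤ (K : ℝ) * K' := by gcongr
      _ ≤ 2 * (K * K') := by
        have : (0 : ℝ) ≤ K * K' := by positivity
        linarith

theorem BddLip.add {K K' : ℝ≥0} {f g : EuclideanSpace ℝ (Fin d) → ℝ} (hf : BddLip K f)
    (hg : BddLip K' g) : BddLip (K + K') fun x => f x + g x :=
  ⟨hf.lip.add hg.lip, fun x => (abs_add_le _ _).trans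
    (by push_cast; exact add_le_add (hf.le x) (hg.le x))⟩

theorem BddLip.lipSupp {K : ℝ≥0} {R : ℝ} {f : EuclideanSpace ℝ (Fin d) → ℝ} (hf : BddLip K f)
    (h0 : ∀ x, R < ‖x‖ → f x = 0) : LipSupp K R f :=
  ⟨hf.lip, h0⟩

theorem BddLip.comp_coord {φ : ℝ → ℝ} {K : ℝ≥0} (hφ : LipschitzWith K φ) (hφ1 : ∀ t, |φ t| ≤ K)
    (N : ℝ≥0) (j : Fin d) : BddLip (K * max 1 N) fun x => φ (N * x j) := by
  refine ⟨LipschitzWith.of_dist_le_mul fun x y => ?_, fun x => (hφ1 _).trans ?_⟩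
  · refine (hφ.dist_le_mul _ _).trans ?_
    push_cast
    rw [mul_assoc]
    refine mul_le_mul_of_nonneg_left ?_ K.2
    rw [Real.dist_eq, ← mul_sub, abs_mul, NNReal.abs_eq, dist_eq_norm]
    have := abs_coord_le (x - y) j
    refine mul_le_mul (le_max_right _ _) (by simpa using this) (abs_nonneg _) (by positivity)
  · push_cast
    exact le_mul_of_one_le_right K.2 (le_max_left _ _)

/-- The constant deteriorates as `h` decreases but is the same for all `p` with constant `C`. This
permits the choice of a frequency for the next weight that works for every `p` at once. -/
theorem BddLip.diffQuot {C : ℝ≥0} {p : EuclideanSpace ℝ (Fin d) → ℝ} (hp : LipschitzWith C p)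
    (i : Fin d) {h : ℝ≥0} (hh : 0 < h) : BddLip (2 * C / h + C) (diffQuot i h p) := by
  refine ⟨LipschitzWith.of_dist_le_mul fun x y => ?_, fun x => (abs_diffQuot_le hp i h x).trans ?_⟩
  · have h1 := hp.dist_le_mul (x + (h : ℝ) • EuclideanSpace.single i 1)
      (y + (h : ℝ) • EuclideanSpace.single i 1)
    have h2 := hp.dist_le_mul x y
    rw [dist_add_right] at h1
    rw [Real.dist_eq] at *
    have hh' : (0 : ℝ) < h := hh
    simp only [PrescribedJacobian.diffQuot]
    rw [← sub_div, abs_div, NNReal.abs_eq, div_le_iff₀ hh']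
    have e : ∀ a b c d : ℝ, a - b - (c - d) = (a - c) - (b - d) := fun a b c d => by ring
    rw [e]
    refine (abs_sub _ _).trans ((add_le_add h1 h2).trans ?_)
    push_cast
    have : (2 * (C : ℝ) / h + C) * dist x y * h = 2 * C * dist x y + C * dist x y * h := by
      field_simp
    rw [this]
    have : 0 ≤ (C : ℝ) * dist x y * h := by positivity
    linarith
  · push_cast
    have : (0 : ℝ) ≤ 2 * C / h := by positivity
    linarith

/-- Averaging of a rapidly oscillating periodic factor. -/
theorem abs_integral_profile_sub_le {Γ φ : ℝ → ℝ} {m : ℝ} {K L : ℝ≥0}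
    (hΓ : ∀ t, HasDerivAt Γ (φ t - m) t) (hA : ∀ t, |Γ t| ≤ K) (hφ : ∀ t, |φ t| ≤ K)
    (hφc : Continuous φ) {N : ℝ} (hN : 0 < N) (j : Fin d)
    {G : EuclideanSpace ℝ (Fin d) → ℝ} {R : ℝ} (hG : BddLip L G)
    (hG0 : ∀ x, R < ‖x‖ → G x = 0) :
    |(∫ x, φ (N * x j) * G x) - m * ∫ x, G x| ≤
      K / N * L * volume.real (Metric.closedBall (0 : EuclideanSpace ℝ (Fin d)) R) := by
  have hcoord : Continuous fun x : EuclideanSpace ℝ (Fin d) => φ (N * x j) := by fun_prop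
  have h1 : Integrable fun x : EuclideanSpace ℝ (Fin d) => φ (N * x j) * G x := by
    refine integrable_of_bounded_support (B := K * L) (R := R)
      (hcoord.mul hG.lip.continuous).measurable (fun x => ?_) fun x hx => by
        rw [hG0 x hx, mul_zero]
    rw [abs_mul]
    exact mul_le_mul (hφ _) (hG.le x) (abs_nonneg _) K.2
  have h2 : Integrable G :=
    integrable_of_bounded_support hG.lip.continuous.measurable hG.le hG0
  rw [← integral_const_mul, ← integral_sub h1 (h2.const_mul m)]
  have h3 := abs_integral_oscillating_le (B := K + |m|) hΓ hA
    (fun t => (abs_sub _ _).trans (by have := hφ t; gcongr)) hN j (hG.lipSupp hG0)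
    L.2 fun x t => abs_shift_sub_le hG.lip j t x
  refine le_of_eq_of_le ?_ h3
  congr 2
  ext x
  ring

end BoundedLipschitz

/-! ### From second differences to energy increments; waves and stages -/

section Induction

variable {d : ℕ}

theorem BddLip.integrable {K : ℝ≥0} {R : ℝ} {f : EuclideanSpace ℝ (Fin d) → ℝ} (hf : BddLip K f)
    (h0 : ∀ x, R < ‖x‖ → f x = 0) : Integrable f :=
  integrable_of_bounded_support hf.lip.continuous.measurable hf.le h0

theorem integral_abs_secondDiff_mul_le {C : ℝ≥0} {R B h V : ℝ} {M : ℕ} (hM : 0 < M)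
    {p v : EuclideanSpace ℝ (Fin d) → ℝ} (hp : LipSupp C R p) (hv : Continuous v)
    (hB : ∀ x, |v x| ≤ B) (hv0 : ∀ x, 0 ≤ v x) (i : Fin d) (hh : |h| ≤ 1)
    (hV : ∫ x in Metric.closedBall (0 : EuclideanSpace ℝ (Fin d)) (R + 1), v x ≤ V) :
    ∫ x, |secondDiff i h p x| * v x ≤
      (M : ℝ) ^ 2 / 2 * (∫ x, secondDiff i h p x ^ 2 * v x) + V / (2 * (M : ℝ) ^ 2) := by
  have hM0 : (0 : ℝ) < M := by exact_mod_cast hM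
  have hvi : IntegrableOn v (Metric.closedBall (0 : EuclideanSpace ℝ (Fin d)) (R + 1)) :=
    hv.continuousOn.integrableOn_compact (isCompact_closedBall _ _)
  have hI := integrable_secondDiff_sq_mul hp hv hB i h
  have hI' := integrable_abs_secondDiff_mul hp hv hB i h
  have hz : ∀ x, x ∉ Metric.closedBall (0 : EuclideanSpace ℝ (Fin d)) (R + 1) →
      secondDiff i h p x = 0 := fun x hx => by
    refine secondDiff_eq_zero hp i ?_
    have : R + 1 < ‖x‖ := by simpa using hx
    linarith
  rw [← setIntegral_eq_integral_of_forall_compl_eq_zero fun x hx => by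
      rw [hz x hx, abs_zero, zero_mul],
    ← setIntegral_eq_integral_of_forall_compl_eq_zero
      (s := Metric.closedBall (0 : EuclideanSpace ℝ (Fin d)) (R + 1))
      (f := fun x => secondDiff i h p x ^ 2 * v x) fun x hx => by rw [hz x hx]; simp]
  have hdiv : V / (2 * (M : ℝ) ^ 2) ≥
      ∫ x in Metric.closedBall (0 : EuclideanSpace ℝ (Fin d)) (R + 1), v x / (2 * (M : ℝ) ^ 2) := by
    rw [integral_div]
    gcongr
  refine le_trans ?_ (add_le_add_right hdiv _)
  rw [← integral_const_mul, ← integral_add (hI.integrableOn.const_mul _) (hvi.div_const _)]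
  refine integral_mono hI'.integrableOn ((hI.integrableOn.const_mul _).add (hvi.div_const _)) ?_
  intro x
  have hpt : |secondDiff i h p x| ≤ (M : ℝ) ^ 2 / 2 * secondDiff i h p x ^ 2 +
      1 / (2 * (M : ℝ) ^ 2) := by
    -- Young's inequality weighted by `M`: after multiplication by the factor `M` of
    -- `exists_step_bound`, the constant part is still of order `1 / M`, and the quadratic part
    -- carries `M ^ 3`.
    have h1 := sq_nonneg ((M : ℝ) * |secondDiff i h p x| - 1 / M)
    have h2 : ((M : ℝ) * |secondDiff i h p x| - 1 / M) ^ 2 =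
        2 * ((M : ℝ) ^ 2 / 2 * secondDiff i h p x ^ 2 + 1 / (2 * (M : ℝ) ^ 2) -
          |secondDiff i h p x|) := by
      rw [← sq_abs (secondDiff i h p x)]
      field_simp
      ring
    linarith
  calc |secondDiff i h p x| * v x ≤ ((M : ℝ) ^ 2 / 2 * secondDiff i h p x ^ 2 +
      1 / (2 * (M : ℝ) ^ 2)) * v x := mul_le_mul_of_nonneg_right hpt (hv0 x)
    _ = _ := by ring

/-- One oscillation contributes little beyond the increase of the directional energy. -/
theorem exists_energy_step_bound (hd : 0 < d) (C : ℝ≥0) {R : ℝ} (hR : 0 ≤ R) (V : ℝ) :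
    ∃ D : ℝ, 0 ≤ D ∧
    ∀ (i : Fin d) (p : Fin d → EuclideanSpace ℝ (Fin d) → ℝ)
      (r g v : EuclideanSpace ℝ (Fin d) → ℝ) (L ρ : ℝ≥0) (B h : ℝ) (M : ℕ),
      (∀ j, LipSupp C R (p j)) → 0 < h → h ≤ 1 → 0 < M →
      LipschitzWith ρ r → (ρ : ℝ) ≤ 4 / h → (∀ x, |r x| ≤ 1) →
      (∀ x, r (x + h • EuclideanSpace.single i 1) = -r x) →
      LipSupp L R g → Continuous v → (∀ x, |v x| ≤ B) →
      (∀ x (t : ℝ), v (x + t • EuclideanSpace.single i 1) = v x) → (∀ x, |g x| ≤ v x) →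
      ∫ x in Metric.closedBall (0 : EuclideanSpace ℝ (Fin d)) (R + 1), v x ≤ V → h * L ≤ 1 / M →
      |∫ x, (r x * g x) * jacDet p x| ≤
        D / M + D * M ^ 3 * ∑ j, ((∫ x, diffQuot i h (p j) x ^ 2 * v x) -
          ∫ x, diffQuot i (2 * h) (p j) x ^ 2 * v x) := by
  obtain ⟨D, hD0, hD⟩ := exists_step_bound hd C hR
  refine ⟨D * (|V| + d * |V| + 1) + 2 * D, by positivity, ?_⟩
  intro i p r g v L ρ B h M hp hh hh1 hM hr hρ hr1 hanti hg hv hB hinv hgv hV hhL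
  have hv0 : ∀ x, 0 ≤ v x := fun x => (abs_nonneg _).trans (hgv x)
  have hM0 : (0 : ℝ) < M := by exact_mod_cast hM
  have h1 := hD i p r g v L ρ B h M hp hh hh1 hM hr hρ hr1 hanti hg hv hB hinv hgv
  have hV0 : 0 ≤ V := le_trans (integral_nonneg fun x => hv0 x) hV
  rw [abs_of_nonneg hV0]
  set E : Fin d → ℝ := fun j => (∫ x, diffQuot i h (p j) x ^ 2 * v x) -
    ∫ x, diffQuot i (2 * h) (p j) x ^ 2 * v x with hE
  have h2 : ∀ j, ∫ x, secondDiff i h (p j) x ^ 2 * v x = 4 * E j := fun j => by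
    rw [integral_secondDiff_sq (hp j) hv hB i hinv hh.ne']
    simp only [hE]
    ring
  have hE0 : ∀ j, 0 ≤ E j := fun j => by
    have h3 : 0 ≤ ∫ x, secondDiff i h (p j) x ^ 2 * v x :=
      integral_nonneg fun x => mul_nonneg (sq_nonneg _) (hv0 x)
    rw [h2] at h3
    linarith
  have h3 : ∀ j, ∫ x, |secondDiff i h (p j) x| * v x ≤
      2 * M ^ 2 * E j + V / (2 * (M : ℝ) ^ 2) := fun j => by
    have := integral_abs_secondDiff_mul_le hM (hp j) hv hB hv0 i
      (by rwa [abs_of_pos hh] : |h| ≤ 1) hV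
    rw [h2] at this
    linarith
  have h4 : ∑ j, ∫ x, |secondDiff i h (p j) x| * v x ≤
      2 * M ^ 2 * ∑ j, E j + d * (V / (2 * (M : ℝ) ^ 2)) := by
    refine (Finset.sum_le_sum fun j _ => h3 j).trans_eq ?_
    rw [Finset.sum_add_distrib, ← Finset.mul_sum]
    simp
  set S := ∑ j, E j
  have hS0 : 0 ≤ S := Finset.sum_nonneg fun j _ => hE0 j
  calc _ ≤ D * (V / M + M * (2 * M ^ 2 * S + d * (V / (2 * (M : ℝ) ^ 2))) + 1 / M) := by
        refine h1.trans ?_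
        gcongr
    _ = (D * (V + d * V / 2 + 1)) / M + 2 * D * M ^ 3 * S := by field_simp; ring
    _ ≤ _ := by
        have e1 : 0 ≤ D * (V + d * V + 1) * M ^ 3 * S := by positivity
        have e2 : (D * (V + d * V / 2 + 1)) / M ≤ (D * (V + d * V + 1) + 2 * D) / M := by
          gcongr
          have : 0 ≤ (d : ℝ) * V := by positivity
          nlinarith
        linarith

/-- A cosine wave of half period `2⁻ⁿ` in the `i`-th coordinate. -/
noncomputable def wave (i : Fin d) (n : ℕ) (x : EuclideanSpace ℝ (Fin d)) : ℝ :=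
  Real.cos (Real.pi * ((2 : ℝ≥0) ^ n * x i))

theorem lipschitzWith_cos_pi : LipschitzWith NNReal.pi fun t => Real.cos (Real.pi * t) := by
  refine lipschitzWith_of_nnnorm_deriv_le (by fun_prop) fun t => ?_
  have : HasDerivAt (fun t => Real.cos (Real.pi * t)) (-Real.sin (Real.pi * t) * (Real.pi * 1)) t :=
    ((hasDerivAt_id t).const_mul Real.pi).cos
  rw [this.deriv, ← NNReal.coe_le_coe, coe_nnnorm, norm_mul, norm_neg, mul_one,
    Real.norm_of_nonneg Real.pi_pos.le]
  calc _ ≤ 1 * Real.pi := mul_le_mul_of_nonneg_right (Real.abs_sin_le_one _) Real.pi_pos.le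
    _ = _ := by simp

theorem bddLip_wave (i : Fin d) (n : ℕ) : BddLip (NNReal.pi * max 1 (2 ^ n)) (wave i n) := by
  have h := BddLip.comp_coord lipschitzWith_cos_pi
    (fun t => (Real.abs_cos_le_one _).trans (by
      rw [NNReal.coe_real_pi]; linarith [Real.pi_gt_three])) (2 ^ n) i
  refine ⟨h.lip, fun x => ?_⟩
  simpa [wave] using h.le x

theorem abs_wave_le (i : Fin d) (n : ℕ) (x : EuclideanSpace ℝ (Fin d)) : |wave i n x| ≤ 1 :=
  Real.abs_cos_le_one _

theorem wave_shift (i : Fin d) (n : ℕ) (x : EuclideanSpace ℝ (Fin d)) :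
    wave i n (x + ((1 / 2 : ℝ) ^ n) • EuclideanSpace.single i 1) = -wave i n x := by
  have h : ((2 : ℝ≥0) ^ n : ℝ≥0) * ((1 / 2 : ℝ) ^ n) = 1 := by
    push_cast
    rw [← mul_pow]; norm_num
  simp only [wave, PiLp.add_apply, PiLp.smul_apply, PiLp.single_apply, if_true, smul_eq_mul,
    mul_one, mul_add]
  push_cast at h ⊢
  rw [h, mul_one, Real.cos_add_pi]

theorem abs_integral_wave_le (i : Fin d) (n : ℕ) {G : EuclideanSpace ℝ (Fin d) → ℝ} {K : ℝ≥0}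
    {R L : ℝ} (hG : LipSupp K R G) (hL0 : 0 ≤ L)
    (hL : ∀ x (t : ℝ), |G (x + t • EuclideanSpace.single i 1) - G x| ≤ L * |t|) :
    |∫ x, wave i n x * G x| ≤
      (1 / 2) ^ n * (L * volume.real (Metric.closedBall (0 : EuclideanSpace ℝ (Fin d)) R)) := by
  have hpi := Real.pi_pos
  have h := abs_integral_oscillating_le (γ := fun t => Real.cos (Real.pi * t))
    (Γ := fun t => Real.sin (Real.pi * t) / Real.pi) (A := 1) (B := 1) (fun t => by
      have : HasDerivAt (fun t => Real.sin (Real.pi * t))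
        (Real.cos (Real.pi * t) * (Real.pi * 1)) t := ((hasDerivAt_id t).const_mul Real.pi).sin
      have h2 := this.div_const Real.pi
      rwa [mul_one, mul_div_assoc, div_self hpi.ne', mul_one] at h2) (fun t => by
      rw [abs_div, abs_of_pos hpi, div_le_one hpi]
      exact (Real.abs_sin_le_one _).trans (by linarith [Real.pi_gt_three]))
    (fun t => Real.abs_cos_le_one _) (N := 2 ^ n) (by positivity) i hG hL0 hL
  refine h.trans_eq ?_
  rw [one_div_pow, mul_assoc]

/-- The square has mean `1 / 2`, and its fluctuation is again a wave, so it is covered by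
`abs_integral_wave_le`. -/
theorem wave_sq (i : Fin d) (n : ℕ) (x : EuclideanSpace ℝ (Fin d)) :
    wave i n x ^ 2 = 1 / 2 + wave i (n + 1) x / 2 := by
  simp only [wave]
  rw [Real.cos_sq]
  congr 3
  push_cast
  ring

/-- The data after finitely many oscillations: the density `u`, the concentrating weight `v`, the
indicator-like cutoff `z` of its support, the dual function `X`, and the last scale `2⁻ⁿ`. -/
structure Stage (i : Fin d) (χ κ : EuclideanSpace ℝ (Fin d) → ℝ) (C : ℝ≥0) (R V c a A B T : ℝ)
    (u v z X : EuclideanSpace ℝ (Fin d) → ℝ) (n : ℕ) (K : ℝ≥0) : Prop where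
  bddLip_u : BddLip K u
  bddLip_v : BddLip K v
  bddLip_z : BddLip K z
  bddLip_X : BddLip K X
  v_nonneg : ∀ x, 0 ≤ v x
  z_nonneg : ∀ x, 0 ≤ z x
  v_shift : ∀ x (t : ℝ), v (x + t • EuclideanSpace.single i 1) = v x
  z_shift : ∀ x (t : ℝ), z (x + t • EuclideanSpace.single i 1) = z x
  abs_X_add_le : ∀ x, |X x| + z x ≤ 1
  v_mul_z : ∀ x, v x * z x = v x
  v_mul_X : ∀ x, v x * X x = 0
  integral_κ_lt : ∫ x, κ x * v x < V
  lt_integral_χ : c < ∫ x, χ x * v x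
  le_integral : a * T ≤ ∫ x, χ x * u x * X x
  pairing_le : ∀ (f : EuclideanSpace ℝ (Fin d) → ℝ) (p : Fin d → EuclideanSpace ℝ (Fin d) → ℝ),
    BddLip 1 f → (∀ j, LipSupp C R (p j)) →
      |∫ x, χ x * u x * f x * jacDet p x| ≤
        A * T + B * ∑ j, ∫ x, diffQuot i ((1 / 2) ^ n) (p j) x ^ 2 * v x

end Induction

/-! ### Passing from one stage to the next -/

section InductionStep

variable {d : ℕ}

theorem exists_stage_zero (i : Fin d) {χ κ : EuclideanSpace ℝ (Fin d) → ℝ} (C : ℝ≥0)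
    (R : ℝ) {V c : ℝ} (a A : ℝ) {B : ℝ} (hB : 0 ≤ B) (hV : ∫ x, κ x < V) (hc : c < ∫ x, χ x) :
    ∃ u v z X n K, Stage i χ κ C R V c a A B 0 u v z X n K := by
  have h0 : BddLip (1 : ℝ≥0) fun _ : EuclideanSpace ℝ (Fin d) => (0 : ℝ) :=
    ⟨(LipschitzWith.const 0).weaken (by simp), fun _ => by simp⟩
  have h1 : BddLip (1 : ℝ≥0) fun _ : EuclideanSpace ℝ (Fin d) => (1 : ℝ) :=
    ⟨(LipschitzWith.const 1).weaken (by simp), fun _ => by simp⟩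
  refine ⟨fun _ => 0, fun _ => 1, fun _ => 1, fun _ => 0, 0, 1, h0, h1, h1, h0, fun _ => zero_le_one,
    fun _ => zero_le_one, fun _ _ => rfl, fun _ _ => rfl, fun _ => by simp, fun _ => by simp,
    fun _ => by simp, by simpa using hV, by simpa using hc, by simp, fun f p _ _ => ?_⟩
  have : 0 ≤ ∑ j, ∫ x, diffQuot i ((1 / 2) ^ 0) (p j) x ^ 2 * 1 :=
    Finset.sum_nonneg fun j _ => integral_nonneg fun x => by positivity
  simpa using mul_nonneg hB this

/-- A factor invariant in direction `i` and bounded by one does not worsen the Lipschitz bound in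
that direction, however fast it oscillates elsewhere. This allows the wave to be fixed before the
frequency of `b`. -/
theorem abs_mul_shift_sub_le {K : ℝ≥0} {w G : EuclideanSpace ℝ (Fin d) → ℝ} {i : Fin d}
    (hG : ∀ x (t : ℝ), |G (x + t • EuclideanSpace.single i 1) - G x| ≤ K * |t|)
    (hw1 : ∀ x, |w x| ≤ 1) (hw : ∀ x (t : ℝ), w (x + t • EuclideanSpace.single i 1) = w x)
    (x : EuclideanSpace ℝ (Fin d)) (t : ℝ) :
    |G (x + t • EuclideanSpace.single i 1) * w (x + t • EuclideanSpace.single i 1) - G x * w x| ≤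
      K * |t| := by
  rw [hw, ← sub_mul, abs_mul]
  calc _ ≤ K * |t| * 1 := mul_le_mul (hG x t) (hw1 x) (abs_nonneg _) (by positivity)
    _ = _ := mul_one _

theorem coord_shift {i j : Fin d} (hij : i ≠ j) (x : EuclideanSpace ℝ (Fin d)) (t : ℝ) :
    (x + t • EuclideanSpace.single i 1 : EuclideanSpace ℝ (Fin d)) j = x j := by
  simp [hij.symm]

/-- In the product of the new density with the new dual function, `v * X = 0` removes the new wave
against the old `X`, and the old density against the new term is a rapidly oscillating integral. The
square of the wave contributes half of `∫ χ v b`, roughly `m * c / 2`. The errors add up to at most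
`2 * ε`. -/
theorem Stage.le_integral_succ {i : Fin d} {χ κ : EuclideanSpace ℝ (Fin d) → ℝ}
    {C Kχ : ℝ≥0} {R V c a A B T m ε : ℝ} {u v z X b : EuclideanSpace ℝ (Fin d) → ℝ} {n : ℕ}
    {K Kb : ℝ≥0} (S : Stage i χ κ C R V c a A B T u v z X n K) (hχ : BddLip Kχ χ)
    (hχ0 : ∀ x, R < ‖x‖ → χ x = 0) (hb : BddLip Kb b) (hb0 : ∀ x, 0 ≤ b x) (hb1 : ∀ x, b x ≤ 1)
    (hbs : ∀ x (t : ℝ), b (x + t • EuclideanSpace.single i 1) = b x) (hm : 0 < m) (n' : ℕ)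
    (hn' : (1 / 2 : ℝ) ^ n' * ((2 * (Kχ * K) : ℝ≥0) *
      volume.real (Metric.closedBall (0 : EuclideanSpace ℝ (Fin d)) R)) ≤ ε)
    (hbm : |(∫ x, b x * (χ x * v x)) - m * ∫ x, χ x * v x| ≤ ε) (ha : a ≤ m * c / 2 - 2 * ε) :
    a * (T + 1) ≤
      ∫ x, χ x * (u x + wave i n' x * v x) * (X x + wave i n' x * (z x * b x)) := by
  have hχu := hχ.mul S.bddLip_u
  have hχv := hχ.mul S.bddLip_v
  have hzb := S.bddLip_z.mul hb
  have hz1 : ∀ x, z x ≤ 1 := fun x => by linarith [S.abs_X_add_le x, abs_nonneg (X x)]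
  have hχu0 : ∀ x, R < ‖x‖ → χ x * u x = 0 := fun x hx => by rw [hχ0 x hx, zero_mul]
  have hχv0 : ∀ x, R < ‖x‖ → χ x * v x = 0 := fun x hx => by rw [hχ0 x hx, zero_mul]
  have hzb1 : ∀ x, |z x * b x| ≤ 1 := fun x => by
    rw [abs_of_nonneg (mul_nonneg (S.z_nonneg x) (hb0 x))]
    exact mul_le_one₀ (hz1 x) (hb0 x) (hb1 x)
  have hzbs : ∀ x (t : ℝ), z (x + t • EuclideanSpace.single i 1) *
      b (x + t • EuclideanSpace.single i 1) = z x * b x := fun x t => by rw [S.z_shift, hbs]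
  have hG₁ := hχu.mul hzb
  have hG₂ := hχv.mul hb
  have hG₁0 : ∀ x, R < ‖x‖ → χ x * u x * (z x * b x) = 0 := fun x hx => by
    rw [hχu0 x hx, zero_mul]
  have hG₂0 : ∀ x, R < ‖x‖ → χ x * v x * b x = 0 := fun x hx => by rw [hχv0 x hx, zero_mul]
  have hw₁ := abs_integral_wave_le i n' (hG₁.lipSupp hG₁0) (2 * (Kχ * K) : ℝ≥0).2
    (abs_mul_shift_sub_le (K := 2 * (Kχ * K)) (G := fun x => χ x * u x) (w := fun x => z x * b x)
      (fun x t => abs_shift_sub_le hχu.lip i t x) hzb1 hzbs)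
  have hw₂ := abs_integral_wave_le i (n' + 1) (hG₂.lipSupp hG₂0) (2 * (Kχ * K) : ℝ≥0).2
    (abs_mul_shift_sub_le (K := 2 * (Kχ * K)) (G := fun x => χ x * v x) (w := b) (fun x t => abs_shift_sub_le hχv.lip i t x)
      (fun x => by rw [abs_of_nonneg (hb0 x)]; exact hb1 x) hbs)
  have hw₁' := hw₁.trans hn'
  have hw₂' := hw₂.trans (le_trans (mul_le_mul_of_nonneg_right
    (pow_le_pow_of_le_one (by norm_num) (by norm_num) (Nat.le_succ n'))
    (mul_nonneg (NNReal.coe_nonneg _) measureReal_nonneg)) hn')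
  have i₀ : Integrable fun x => χ x * u x * X x :=
    (hχu.mul S.bddLip_X).integrable (R := R) fun x hx => by rw [hχu0 x hx, zero_mul]
  have i₁ : Integrable fun x => wave i n' x * (χ x * u x * (z x * b x)) :=
    ((bddLip_wave i n').mul hG₁).integrable (R := R) fun x hx => by rw [hG₁0 x hx, mul_zero]
  have i₂ : Integrable fun x => wave i (n' + 1) x * (χ x * v x * b x) :=
    ((bddLip_wave i (n' + 1)).mul hG₂).integrable (R := R) fun x hx => by
      rw [hG₂0 x hx, mul_zero]
  have i₃ : Integrable fun x => b x * (χ x * v x) :=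
    (hb.mul hχv).integrable (R := R) fun x hx => by rw [hχv0 x hx, mul_zero]
  have hpt : ∀ x, χ x * (u x + wave i n' x * v x) * (X x + wave i n' x * (z x * b x)) =
      (χ x * u x * X x + wave i n' x * (χ x * u x * (z x * b x))) +
      (1 / 2 * (b x * (χ x * v x)) + 1 / 2 * (wave i (n' + 1) x * (χ x * v x * b x))) := by
    intro x
    calc _ = χ x * u x * X x + wave i n' x * (χ x * u x * (z x * b x)) +
          (χ x * wave i n' x * (v x * X x) + wave i n' x ^ 2 * χ x * (v x * z x) * b x) := by ring
      _ = _ := by rw [S.v_mul_X, S.v_mul_z, wave_sq]; ring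
  simp_rw [hpt]
  rw [integral_add (by exact i₀.add i₁) (by exact (i₃.const_mul _).add (i₂.const_mul _)),
    integral_add i₀ i₁, integral_add (i₃.const_mul _) (i₂.const_mul _), integral_const_mul,
    integral_const_mul]
  have h1 := S.le_integral
  have h2 := (abs_le.mp hw₁').1
  have h3 := (abs_le.mp hw₂').1
  have h4 := (abs_le.mp hbm).1
  have h5 := mul_lt_mul_of_pos_left S.lt_integral_χ hm
  linarith

/-- The estimate for a single oscillation, as provided by `exists_energy_step_bound`. -/
def EnergyStepBound (d : ℕ) (C : ℝ≥0) (R V D : ℝ) : Prop :=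
  ∀ (i : Fin d) (p : Fin d → EuclideanSpace ℝ (Fin d) → ℝ)
    (r g v : EuclideanSpace ℝ (Fin d) → ℝ) (L ρ : ℝ≥0) (B h : ℝ) (M : ℕ),
    (∀ j, LipSupp C R (p j)) → 0 < h → h ≤ 1 → 0 < M →
    LipschitzWith ρ r → (ρ : ℝ) ≤ 4 / h → (∀ x, |r x| ≤ 1) →
    (∀ x, r (x + h • EuclideanSpace.single i 1) = -r x) →
    LipSupp L R g → Continuous v → (∀ x, |v x| ≤ B) →
    (∀ x (t : ℝ), v (x + t • EuclideanSpace.single i 1) = v x) → (∀ x, |g x| ≤ v x) →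
    ∫ x in Metric.closedBall (0 : EuclideanSpace ℝ (Fin d)) (R + 1), v x ≤ V → h * L ≤ 1 / M →
    |∫ x, (r x * g x) * jacDet p x| ≤
      D / M + D * M ^ 3 * ∑ j, ((∫ x, diffQuot i h (p j) x ^ 2 * v x) -
        ∫ x, diffQuot i (2 * h) (p j) x ^ 2 * v x)

/-- The old stage contributes the energy at scale `n`, and the new wave the increment from scale `n'
- 1` to `n'`. By monotonicity of the energy the two sum to at most the energy at scale `n'` with
weight `v`. Passing to the new weight `w` costs at most `1 / M`, which together with `D / M` from
the new wave accounts for the constant `(D + 1) / M` per step. -/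
theorem Stage.pairing_le_succ (hd : 0 < d) {i : Fin d} {χ κ : EuclideanSpace ℝ (Fin d) → ℝ}
    {C Kχ Kκ : ℝ≥0} {R R₁ V c a D T : ℝ} {M : ℕ} {u v z X w : EuclideanSpace ℝ (Fin d) → ℝ} {n : ℕ}
    {K : ℝ≥0} (S : Stage i χ κ C R V c a ((D + 1) / M) (D * M ^ 3) T u v z X n K) (hR : 0 ≤ R)
    (hχ : BddLip Kχ χ) (hχ0 : ∀ x, R < ‖x‖ → χ x = 0) (hχnn : ∀ x, 0 ≤ χ x)
    (hχ1 : ∀ x, χ x ≤ 1) (hκ : BddLip Kκ κ) (hκ0 : ∀ x, R₁ < ‖x‖ → κ x = 0)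
    (hκnn : ∀ x, 0 ≤ κ x) (hκ1 : ∀ x, ‖x‖ ≤ R + 1 → 1 ≤ κ x) (hM : 0 < M) (hD0 : 0 ≤ D)
    (hD : EnergyStepBound d C R V D) {n' : ℕ} (hnn' : n + 1 ≤ n')
    (hn' : (1 / 2 : ℝ) ^ n' * (2 * (2 * (Kχ * K) * 1) : ℝ≥0) ≤ 1 / M)
    (f : EuclideanSpace ℝ (Fin d) → ℝ) (p : Fin d → EuclideanSpace ℝ (Fin d) → ℝ)
    (hf : BddLip 1 f) (hp : ∀ j, LipSupp C R (p j))
    (hw : ∀ k, (∫ x, diffQuot i ((1 / 2) ^ n') (p k) x ^ 2 * v x) ≤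
      (∫ x, diffQuot i ((1 / 2) ^ n') (p k) x ^ 2 * w x) + 1 / (M * (D * M ^ 3 * d + 1))) :
    |∫ x, χ x * (u x + wave i n' x * v x) * f x * jacDet p x| ≤
      (D + 1) / M * (T + 1) +
        D * M ^ 3 * ∑ k, ∫ x, diffQuot i ((1 / 2) ^ n') (p k) x ^ 2 * w x := by
  have hM0 : (0 : ℝ) < M := by exact_mod_cast hM
  have hχuf := (hχ.mul S.bddLip_u).mul hf
  have hχvf := (hχ.mul S.bddLip_v).mul hf
  have hχuf0 : ∀ x, R < ‖x‖ → χ x * u x * f x = 0 := fun x hx => by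
    rw [hχ0 x hx, zero_mul, zero_mul]
  have hχvf0 : ∀ x, R < ‖x‖ → χ x * v x * f x = 0 := fun x hx => by
    rw [hχ0 x hx, zero_mul, zero_mul]
  -- The Lipschitz constant of the wave is at most `π / h`; the `4` in the step bound only has to
  -- exceed `π`.
  have hpi : ((NNReal.pi * max 1 (2 ^ n') : ℝ≥0) : ℝ) ≤ 4 / (1 / 2) ^ n' := by
    have h1 : (1 : ℝ≥0) ≤ 2 ^ n' := one_le_pow₀ (by norm_num)
    rw [max_eq_right h1, one_div_pow, div_div_eq_mul_div, div_one]
    push_cast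
    rw [NNReal.coe_real_pi]
    exact mul_le_mul_of_nonneg_right Real.pi_lt_four.le (by positivity)
  have hκv : Integrable fun x => κ x * v x :=
    (hκ.mul S.bddLip_v).integrable (R := R₁) fun x hx => by rw [hκ0 x hx, zero_mul]
  have hV : ∫ x in Metric.closedBall (0 : EuclideanSpace ℝ (Fin d)) (R + 1), v x ≤ V := by
    refine le_trans ?_ S.integral_κ_lt.le
    refine le_trans (setIntegral_mono_on
      (S.bddLip_v.lip.continuous.continuousOn.integrableOn_compact (isCompact_closedBall _ _))
      hκv.integrableOn measurableSet_closedBall fun x hx => ?_)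
      (setIntegral_le_integral hκv
        (Eventually.of_forall fun x => mul_nonneg (hκnn x) (S.v_nonneg x)))
    exact le_mul_of_one_le_left (S.v_nonneg x) (hκ1 x (by simpa using hx))
  have hstep := hD i p (wave i n') (fun x => χ x * v x * f x) v _ _ K ((1 / 2) ^ n') M hp
    (by positivity) (pow_le_one₀ (by norm_num) (by norm_num)) hM (bddLip_wave i n').lip hpi
    (abs_wave_le i n') (wave_shift i n') (hχvf.lipSupp hχvf0) S.bddLip_v.lip.continuous
    S.bddLip_v.le S.v_shift (fun x => by
      rw [abs_mul, abs_of_nonneg (mul_nonneg (hχnn x) (S.v_nonneg x))]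
      have h1 : χ x * v x ≤ v x := mul_le_of_le_one_left (S.v_nonneg x) (hχ1 x)
      have h2 : |f x| ≤ 1 := by simpa using hf.le x
      calc _ ≤ v x * 1 := mul_le_mul h1 h2 (abs_nonneg _) (S.v_nonneg x)
        _ = v x := mul_one _) hV hn'
  have hsplit : ∫ x, χ x * (u x + wave i n' x * v x) * f x * jacDet p x =
      (∫ x, χ x * u x * f x * jacDet p x) +
        ∫ x, (wave i n' x * (χ x * v x * f x)) * jacDet p x := by
    rw [← integral_add (integrable_mul_jacDet hd hR (fun j => (hp j).lip) (hχuf.lipSupp hχuf0))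
      (integrable_mul_jacDet hd hR (fun j => (hp j).lip)
        (((bddLip_wave i n').mul hχvf).lipSupp fun x hx => by rw [hχvf0 x hx, mul_zero]))]
    refine integral_congr_ae (Eventually.of_forall fun x => ?_)
    simp only
    ring
  have hold := S.pairing_le f p hf hp
  obtain ⟨l, rfl⟩ : ∃ l, n' = l + 1 := ⟨n' - 1, by omega⟩
  have h2h : (2 : ℝ) * (1 / 2) ^ (l + 1) = (1 / 2) ^ l := by rw [pow_succ]; ring
  rw [h2h] at hstep
  have hmono : ∀ k, ∫ x, diffQuot i ((1 / 2) ^ n) (p k) x ^ 2 * v x ≤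
      ∫ x, diffQuot i ((1 / 2) ^ l) (p k) x ^ 2 * v x := fun k =>
    integral_diffQuot_sq_le_half (hp k) S.bddLip_v.lip.continuous S.bddLip_v.le S.v_nonneg i
      S.v_shift (by omega)
  -- The tolerance for changing the weight in one component: multiplied by `D * M ^ 3` and summed
  -- over `d` components it stays below `1 / M`.
  set Q : ℝ := 1 / (M * (D * M ^ 3 * d + 1)) with hQ
  have hsum : ∑ k, ((∫ x, diffQuot i ((1 / 2) ^ (l + 1)) (p k) x ^ 2 * v x) -
        ∫ x, diffQuot i ((1 / 2) ^ l) (p k) x ^ 2 * v x) +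
      ∑ k, ∫ x, diffQuot i ((1 / 2) ^ n) (p k) x ^ 2 * v x ≤
      (∑ k, ∫ x, diffQuot i ((1 / 2) ^ (l + 1)) (p k) x ^ 2 * w x) + d * Q := by
    rw [← Finset.sum_add_distrib]
    have : (d : ℝ) * Q = ∑ _k : Fin d, Q := by simp
    rw [this, ← Finset.sum_add_distrib]
    refine Finset.sum_le_sum fun k _ => ?_
    linarith [hmono k, hw k]
  have hDM : 0 ≤ D * M ^ 3 := by positivity
  have hsum' := mul_le_mul_of_nonneg_left hsum hDM
  have hQ' : D * M ^ 3 * (d * Q) ≤ 1 / M := by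
    have h1 : D * M ^ 3 * (d * Q) = (D * M ^ 3 * d / (D * M ^ 3 * d + 1)) * (1 / M) := by
      rw [hQ]; field_simp
    rw [h1]
    refine mul_le_of_le_one_left (by positivity) ?_
    rw [div_le_one (by positivity)]
    linarith
  have hDM1 : (D + 1) / M = D / M + 1 / M := add_div _ _ _
  rw [hsplit]
  refine (abs_add_le _ _).trans ((add_le_add hold hstep).trans ?_)
  rw [mul_add, mul_add] at hsum'
  rw [mul_add, mul_one]
  linarith

-- The order of choices is essential. First the scale of the wave, fine relative to the current
-- stage; then the frequency `N` of the new weight factor in `x_j`, high relative to that scale, so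
-- that replacing `v` by `v * β (N x_j)` hardly changes its masses or the energies at that scale,
-- uniformly in `p`. The waves do not notice `N`, because they oscillate in another coordinate.
set_option maxHeartbeats 1000000 in
theorem Stage.exists_succ (hd : 0 < d) {i j : Fin d} (hij : i ≠ j)
    {β ζ α Γβ Γα : ℝ → ℝ} {Kp : ℝ≥0} {m : ℝ} (P : Profiles β ζ α Γβ Γα Kp m)
    {χ κ : EuclideanSpace ℝ (Fin d) → ℝ} {C Kχ Kκ : ℝ≥0} {R R₁ V c D : ℝ} {M : ℕ}
    (hχ : BddLip Kχ χ) (hχ0 : ∀ x, R < ‖x‖ → χ x = 0) (hχnn : ∀ x, 0 ≤ χ x) (hχ1 : ∀ x, χ x ≤ 1)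
    (hκ : BddLip Kκ κ) (hκ0 : ∀ x, R₁ < ‖x‖ → κ x = 0) (hκnn : ∀ x, 0 ≤ κ x)
    (hκ1 : ∀ x, ‖x‖ ≤ R + 1 → 1 ≤ κ x) (hc : 0 < c) (hM : 0 < M) (hD0 : 0 ≤ D)
    (hD : EnergyStepBound d C R V D) (hR : 0 ≤ R)
    {T : ℝ} {u v z X : EuclideanSpace ℝ (Fin d) → ℝ} {n : ℕ} {K : ℝ≥0}
    (S : Stage i χ κ C R V c (m * c / 4) ((D + 1) / M) (D * M ^ 3) T u v z X n K) :
    ∃ u' v' z' X' n' K',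
      Stage i χ κ C R V c (m * c / 4) ((D + 1) / M) (D * M ^ 3) (T + 1) u' v' z' X' n' K' := by
  have hM0 : (0 : ℝ) < M := by exact_mod_cast hM
  set vol₀ := volume.real (Metric.closedBall (0 : EuclideanSpace ℝ (Fin d)) R) with hvol₀
  set vol₁ := volume.real (Metric.closedBall (0 : EuclideanSpace ℝ (Fin d)) R₁) with hvol₁
  set vol₂ := volume.real (Metric.closedBall (0 : EuclideanSpace ℝ (Fin d)) (R + 1)) with hvol₂
  have hvol₀0 : 0 ≤ vol₀ := measureReal_nonneg
  have hvol₁0 : 0 ≤ vol₁ := measureReal_nonneg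
  have hvol₂0 : 0 ≤ vol₂ := measureReal_nonneg
  -- choice of the scale of the wave
  have hχu := hχ.mul S.bddLip_u
  have hχv := hχ.mul S.bddLip_v
  have hκv := hκ.mul S.bddLip_v
  set L₁ : ℝ≥0 := 2 * (Kχ * K) with hL₁
  set L₂ : ℝ≥0 := 2 * (Kκ * K) with hL₂
  set Lg : ℝ≥0 := 2 * (L₁ * 1) with hLg
  -- Any value up to `m * c / 8` would do: the gain `m * c / 2 - 2 * ε` has to be at least `m * c /
  -- 4`.
  set ε := m * c / 10 with hε
  have hε0 : 0 < ε := div_pos (mul_pos P.mean_pos hc) (by norm_num)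
  obtain ⟨l, hl⟩ : ∃ l : ℕ, (1 / 2 : ℝ) ^ l < min ε (1 / M) / (L₁ * vol₀ + Lg + 1) :=
    exists_pow_lt_of_lt_one (div_pos (lt_min hε0 (by positivity)) (by positivity)) (by norm_num)
  -- The summand `1` ensures that the doubled step, of scale `n' - 1`, is not coarser than the last
  -- scale `n`.
  set n' := n + 1 + l with hn'
  set h : ℝ := (1 / 2) ^ n' with hh
  have hh0 : 0 < h := by positivity
  have hh1 : h ≤ 1 := pow_le_one₀ (by norm_num) (by norm_num)
  have hhl : h ≤ (1 / 2) ^ l :=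
    pow_le_pow_of_le_one (by norm_num) (by norm_num) (by omega)
  have hhb : h * (L₁ * vol₀ + Lg + 1) ≤ min ε (1 / M) := by
    rw [← le_div_iff₀ (by positivity)]
    exact hhl.trans hl.le
  have hhε : h * (L₁ * vol₀) ≤ ε := by
    refine le_trans ?_ (hhb.trans (min_le_left _ _))
    refine mul_le_mul_of_nonneg_left ?_ hh0.le
    linarith [Lg.2]
  have hhM : h * Lg ≤ 1 / M := by
    refine le_trans ?_ (hhb.trans (min_le_right _ _))
    refine mul_le_mul_of_nonneg_left ?_ hh0.le
    have : 0 ≤ L₁ * vol₀ := by positivity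
    linarith
  -- choice of the frequency of the new weight
  set hN : ℝ≥0 := (1 / 2) ^ n' with hhN
  have hhNc : (hN : ℝ) = h := by rw [hhN, hh]; push_cast; rfl
  have hhN0 : 0 < hN := by positivity
  set Kq : ℝ≥0 := 2 * C / hN + C with hKq
  set L₃ : ℝ≥0 := 2 * (2 * (Kq * Kq) * K) with hL₃
  -- One tolerance for all averaging errors: the gain of the dual function, the two strict mass
  -- inequalities, and the change of weight in the energy.
  set gap : ℝ := min (min ε ((∫ x, χ x * v x) - c)) (min (V - ∫ x, κ x * v x)
    (1 / (M * (D * M ^ 3 * d + 1)))) with hgap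
  have hgap0 : 0 < gap :=
    lt_min (lt_min hε0 (sub_pos.mpr S.lt_integral_χ)) (lt_min (sub_pos.mpr S.integral_κ_lt)
      (by positivity))
  set W : ℝ≥0 := Kp * (L₁ * vol₀.toNNReal + L₂ * vol₁.toNNReal + L₃ * vol₂.toNNReal) with hW
  have hWc : (W : ℝ) = Kp * (L₁ * vol₀ + L₂ * vol₁ + L₃ * vol₂) := by
    rw [hW]; push_cast
    rw [Real.coe_toNNReal _ hvol₀0, Real.coe_toNNReal _ hvol₁0, Real.coe_toNNReal _ hvol₂0]
  set N : ℝ≥0 := W / gap.toNNReal + 1 with hN'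
  have hN0 : (0 : ℝ) < N := by rw [hN']; push_cast; positivity
  have hWN : (W : ℝ) / N < gap := by
    rw [div_lt_iff₀ hN0, hN']
    push_cast
    rw [Real.coe_toNNReal _ hgap0.le, mul_add, mul_div_cancel₀ _ hgap0.ne']
    linarith
  have e₁ : (Kp : ℝ) / N * L₁ * vol₀ < gap := by
    refine lt_of_le_of_lt ?_ hWN
    rw [hWc, div_mul_eq_mul_div, div_mul_eq_mul_div]
    refine div_le_div_of_nonneg_right ?_ hN0.le
    have : (0 : ℝ) ≤ Kp * (L₂ * vol₁ + L₃ * vol₂) := by positivity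
    linarith
  have e₂ : (Kp : ℝ) / N * L₂ * vol₁ < gap := by
    refine lt_of_le_of_lt ?_ hWN
    rw [hWc, div_mul_eq_mul_div, div_mul_eq_mul_div]
    refine div_le_div_of_nonneg_right ?_ hN0.le
    have : (0 : ℝ) ≤ Kp * (L₁ * vol₀ + L₃ * vol₂) := by positivity
    linarith
  have e₃ : (Kp : ℝ) / N * L₃ * vol₂ < gap := by
    refine lt_of_le_of_lt ?_ hWN
    rw [hWc, div_mul_eq_mul_div, div_mul_eq_mul_div]
    refine div_le_div_of_nonneg_right ?_ hN0.le
    have : (0 : ℝ) ≤ Kp * (L₁ * vol₀ + L₂ * vol₁) := by positivity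
    linarith
  have hζ1 : ∀ t, ζ t ≤ 1 := fun t => by linarith [P.add_le t, P.α_nonneg t]
  have hα1 : ∀ t, α t ≤ 1 := fun t => by linarith [P.add_le t, P.ζ_nonneg t]
  have hz1 : ∀ x, z x ≤ 1 := fun x => by linarith [S.abs_X_add_le x, abs_nonneg (X x)]
  have habsβ : ∀ t, |β t| ≤ Kp := fun t => by rw [abs_of_nonneg (P.β_nonneg t)]; exact P.β_le t
  have habsα : ∀ t, |α t| ≤ max 1 Kp := fun t => by
    rw [abs_of_nonneg (P.α_nonneg t)]; exact_mod_cast (hα1 t).trans (le_max_left _ _)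
  have habsζ : ∀ t, |ζ t| ≤ max 1 Kp := fun t => by
    rw [abs_of_nonneg (P.ζ_nonneg t)]; exact_mod_cast (hζ1 t).trans (le_max_left _ _)
  have habsα' : ∀ t, |α t| ≤ Kp := fun t => by
    rw [abs_of_nonneg (P.α_nonneg t)]; exact P.α_le t
  have hbβ := BddLip.comp_coord P.lip_β habsβ N j
  have hbα := BddLip.comp_coord (P.lip_α.weaken (le_max_right 1 Kp)) (by exact_mod_cast habsα) N j
  have hbζ := BddLip.comp_coord (P.lip_ζ.weaken (le_max_right 1 Kp)) (by exact_mod_cast habsζ) N j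
  have hbr := bddLip_wave i n'
  have hzα := S.bddLip_z.mul hbα
  have hu' := S.bddLip_u.add (hbr.mul S.bddLip_v)
  have hv' := S.bddLip_v.mul hbβ
  have hz' := S.bddLip_z.mul hbζ
  have hX' := S.bddLip_X.add (hbr.mul hzα)
  obtain ⟨K', hKu, hKv, hKz, hKX⟩ : ∃ K' : ℝ≥0, K + 2 * (NNReal.pi * max 1 (2 ^ n') * K) ≤ K' ∧
      2 * (K * (Kp * max 1 N)) ≤ K' ∧ 2 * (K * (max 1 Kp * max 1 N)) ≤ K' ∧
      K + 2 * (NNReal.pi * max 1 (2 ^ n') * (2 * (K * (max 1 Kp * max 1 N)))) ≤ K' :=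
    ⟨_, le_max_of_le_left (le_max_left _ _), le_max_of_le_left (le_max_right _ _),
      le_max_of_le_right (le_max_left _ _), le_max_of_le_right (le_max_right _ _)⟩
  have hgapε : gap ≤ ε := (min_le_left _ _).trans (min_le_left _ _)
  have hgapχ : gap ≤ (∫ x, χ x * v x) - c := (min_le_left _ _).trans (min_le_right _ _)
  have hgapκ : gap ≤ V - ∫ x, κ x * v x := (min_le_right _ _).trans (min_le_left _ _)
  have hgapM : gap ≤ 1 / (M * (D * M ^ 3 * d + 1)) := (min_le_right _ _).trans (min_le_right _ _)
  have hχv0 : ∀ x, R < ‖x‖ → χ x * v x = 0 := fun x hx => by rw [hχ0 x hx, zero_mul]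
  have hχu0 : ∀ x, R < ‖x‖ → χ x * u x = 0 := fun x hx => by rw [hχ0 x hx, zero_mul]
  have hκv0 : ∀ x, R₁ < ‖x‖ → κ x * v x = 0 := fun x hx => by rw [hκ0 x hx, zero_mul]
  have hvX : ∀ x, v x * X x = 0 := S.v_mul_X
  refine ⟨fun x => u x + wave i n' x * v x, fun x => v x * β (N * x j), fun x => z x * ζ (N * x j),
    fun x => X x + wave i n' x * (z x * α (N * x j)), n', K', hu'.mono hKu, hv'.mono hKv,
    hz'.mono hKz, hX'.mono hKX, fun x => mul_nonneg (S.v_nonneg x) (P.β_nonneg _),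
    fun x => mul_nonneg (S.z_nonneg x) (P.ζ_nonneg _), fun x t => ?_, fun x t => ?_, fun x => ?_,
    fun x => ?_, fun x => ?_, ?_, ?_, ?_, ?_⟩
  · simp only
    rw [S.v_shift, coord_shift hij]
  · simp only
    rw [S.z_shift, coord_shift hij]
  · have h1 : |X x + wave i n' x * (z x * α (N * x j))| ≤ |X x| + z x * α (N * x j) := by
      refine (abs_add_le _ _).trans ?_
      have h2 : 0 ≤ z x * α (N * x j) := mul_nonneg (S.z_nonneg x) (P.α_nonneg _)
      rw [abs_mul, abs_of_nonneg h2]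
      have := mul_le_mul_of_nonneg_right (abs_wave_le i n' x) h2
      linarith
    have h2 := mul_le_mul_of_nonneg_left (P.add_le (N * x j)) (S.z_nonneg x)
    have h3 := S.abs_X_add_le x
    rw [mul_one, mul_add] at h2
    simp only
    linarith
  · simp only
    calc v x * β (N * x j) * (z x * ζ (N * x j))
        = (v x * z x) * (ζ (N * x j) * β (N * x j)) := by ring
      _ = _ := by rw [S.v_mul_z, P.ζ_mul_β]
  · simp only
    calc v x * β (N * x j) * (X x + wave i n' x * (z x * α (N * x j)))
        = (v x * X x) * β (N * x j) +
          v x * wave i n' x * z x * (α (N * x j) * β (N * x j)) := by ring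
      _ = 0 := by rw [hvX, P.α_mul_β]; ring
  · have h1 := abs_integral_profile_sub_le P.deriv_β P.Γβ_le habsβ P.lip_β.continuous hN0 j hκv hκv0
    have h2 := (abs_lt.mp (h1.trans_lt e₂)).2
    have h3 : ∫ x, κ x * (v x * β (N * x j)) = ∫ x, β (N * x j) * (κ x * v x) :=
      integral_congr_ae (Eventually.of_forall fun x => by simp only; ring)
    simp only
    rw [h3]
    linarith
  · have h1 := abs_integral_profile_sub_le P.deriv_β P.Γβ_le habsβ P.lip_β.continuous hN0 j hχv hχv0
    have h2 := (abs_lt.mp (h1.trans_lt e₁)).1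
    have h3 : ∫ x, χ x * (v x * β (N * x j)) = ∫ x, β (N * x j) * (χ x * v x) :=
      integral_congr_ae (Eventually.of_forall fun x => by simp only; ring)
    simp only
    rw [h3]
    linarith
  · have h1 := abs_integral_profile_sub_le P.deriv_α P.Γα_le habsα' P.lip_α.continuous hN0 j hχv hχv0
    refine S.le_integral_succ hχ hχ0 hbα (fun x => P.α_nonneg _) (fun x => hα1 _)
      (fun x t => by rw [coord_shift hij]) P.mean_pos n' hhε (h1.trans (e₁.le.trans hgapε)) ?_
    rw [hε]
    linarith [mul_pos P.mean_pos hc]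
  · intro f p hf hp
    refine S.pairing_le_succ hd hR hχ hχ0 hχnn hχ1 hκ hκ0 hκnn hκ1 hM hD0 hD (by omega) hhM f p hf
      hp fun k => ?_
    have hq := BddLip.diffQuot (hp k).lip i hhN0
    have hqv := (hq.mul hq).mul S.bddLip_v
    have h1 := abs_integral_profile_sub_le P.deriv_β P.Γβ_le habsβ P.lip_β.continuous hN0 j hqv
      (R := R + 1) fun x hx => by
        rw [diffQuot_eq_zero (hp k) i (by rw [hhNc, abs_of_pos hh0]; linarith)]; simp
    rw [hhNc] at h1
    have h2 := (abs_le.mp (h1.trans (e₃.le.trans hgapM))).1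
    have h3 : ∫ x, diffQuot i h (p k) x ^ 2 * (v x * β (N * x j)) =
        ∫ x, β (N * x j) * (diffQuot i h (p k) x * diffQuot i h (p k) x * v x) :=
      integral_congr_ae (Eventually.of_forall fun x => by simp only; ring)
    have h4 : ∫ x, diffQuot i h (p k) x ^ 2 * v x =
        ∫ x, diffQuot i h (p k) x * diffQuot i h (p k) x * v x :=
      integral_congr_ae (Eventually.of_forall fun x => by simp only; ring)
    rw [← hh, h3, h4]
    linarith

end InductionStep

/-! ### Densities on the whole space -/

section Density

variable {d : ℕ}

theorem exists_cutoff {R : ℝ} (hR : 0 ≤ R) :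
    ∃ (κ : EuclideanSpace ℝ (Fin d) → ℝ) (K : ℝ≥0), BddLip K κ ∧
      (∀ x, R + 1 < ‖x‖ → κ x = 0) ∧ (∀ x, 0 ≤ κ x) ∧ ∀ x, ‖x‖ ≤ R → 1 ≤ κ x := by
  refine ⟨fun x => max 0 (R + 1 - ‖x‖), (R + 1).toNNReal, ⟨?_, fun x => ?_⟩, fun x hx => ?_,
    fun x => le_max_left _ _, fun x hx => ?_⟩
  · have h1 : LipschitzWith (0 + 1) fun x : EuclideanSpace ℝ (Fin d) => R + 1 - ‖x‖ :=
      (LipschitzWith.const (R + 1)).sub lipschitzWith_one_norm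
    refine (h1.const_max 0).weaken ?_
    rw [zero_add, ← Real.toNNReal_one]
    exact Real.toNNReal_le_toNNReal (by linarith)
  · rw [abs_of_nonneg (le_max_left _ _), Real.coe_toNNReal _ (by linarith)]
    exact max_le (by linarith) (by linarith [norm_nonneg x])
  · exact max_eq_left (by linarith)
  · exact le_max_of_le_right (by linarith)

/-- Difference quotients are bounded by `C` and vanish where `κ` may be less than one. As the
`κ`-mass of `v` stays below `V` at every stage, the energy is bounded independently of the number of
steps. -/
theorem sum_integral_diffQuot_sq_mul_le {C K Kκ : ℝ≥0} {R R₁ h : ℝ} (hh : |h| ≤ 1)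
    {p : Fin d → EuclideanSpace ℝ (Fin d) → ℝ} (hp : ∀ k, LipSupp C R (p k)) (i : Fin d)
    {v κ : EuclideanSpace ℝ (Fin d) → ℝ} (hv : BddLip K v) (hv0 : ∀ x, 0 ≤ v x)
    (hκ : BddLip Kκ κ) (hκ0 : ∀ x, R₁ < ‖x‖ → κ x = 0) (hκnn : ∀ x, 0 ≤ κ x)
    (hκ1 : ∀ x, ‖x‖ ≤ R + 1 → 1 ≤ κ x) :
    ∑ k, ∫ x, diffQuot i h (p k) x ^ 2 * v x ≤ d * (C ^ 2 * ∫ x, κ x * v x) := by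
  have hκv : Integrable fun x => κ x * v x :=
    (hκ.mul hv).integrable (R := R₁) fun x hx => by rw [hκ0 x hx, zero_mul]
  have h1 : ∀ k, ∫ x, diffQuot i h (p k) x ^ 2 * v x ≤ C ^ 2 * ∫ x, κ x * v x := fun k => by
    rw [← integral_const_mul]
    refine integral_mono (integrable_diffQuot_sq_mul (hp k) hv.lip.continuous hv.le i h)
      (hκv.const_mul _) fun x => ?_
    have hq : diffQuot i h (p k) x ^ 2 ≤ C ^ 2 * κ x := by
      rcases le_or_gt ‖x‖ (R + 1) with hx | hx
      · calc diffQuot i h (p k) x ^ 2 ≤ (C : ℝ) ^ 2 :=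
            sq_le_sq' (neg_le_of_abs_le (abs_diffQuot_le (hp k).lip i h x))
              (le_of_abs_le (abs_diffQuot_le (hp k).lip i h x))
          _ ≤ _ := le_mul_of_one_le_right (by positivity) (hκ1 x hx)
      · rw [diffQuot_eq_zero (hp k) i (by linarith), zero_pow two_ne_zero]
        have := hκnn x
        positivity
    calc _ ≤ C ^ 2 * κ x * v x := mul_le_mul_of_nonneg_right hq (hv0 x)
      _ = _ := mul_assoc _ _ _
  refine (Finset.sum_le_sum fun k _ => h1 k).trans_eq ?_
  simp

/-- Densities of unit mass with arbitrarily small pairing against Jacobians. -/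
theorem exists_density (hd : 2 ≤ d) (C : ℝ≥0) {R : ℝ} (hR : 0 ≤ R)
    {χ : EuclideanSpace ℝ (Fin d) → ℝ} {Kχ : ℝ≥0} (hχ : BddLip Kχ χ)
    (hχ0 : ∀ x, R < ‖x‖ → χ x = 0) (hχnn : ∀ x, 0 ≤ χ x) (hχ1 : ∀ x, χ x ≤ 1)
    (hpos : 0 < ∫ x, χ x) {ε : ℝ} (hε : 0 < ε) :
    ∃ (u : EuclideanSpace ℝ (Fin d) → ℝ), (∃ K, BddLip K u) ∧ 1 ≤ ∫ x, |χ x * u x| ∧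
      ∀ (f : EuclideanSpace ℝ (Fin d) → ℝ) (p : Fin d → EuclideanSpace ℝ (Fin d) → ℝ),
        BddLip 1 f → (∀ j, LipSupp C R (p j)) →
          |∫ x, χ x * u x * f x * jacDet p x| ≤ ε := by
  have hd0 : 0 < d := by omega
  have hij : (⟨0, hd0⟩ : Fin d) ≠ ⟨1, hd⟩ := by simp
  set i : Fin d := ⟨0, hd0⟩
  obtain ⟨β, ζ, α, Γβ, Γα, Kp, m, P⟩ := exists_profiles
  obtain ⟨κ, Kκ, hκ, hκ0, hκnn, hκ1⟩ := exists_cutoff (d := d) (R := R + 1) (by linarith)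
  set V : ℝ := (∫ x, κ x) + 1
  set c : ℝ := (∫ x, χ x) / 2
  have hc : 0 < c := half_pos hpos
  obtain ⟨D, hD0, hD⟩ := exists_energy_step_bound hd0 C hR V
  have ha : 0 < m * c / 4 := by have := P.mean_pos; positivity
  set a : ℝ := m * c / 4
  -- First `M` makes the loss per step at most half of `ε` times the gain per step. Then `T`, chosen
  -- after `M`, makes the total gain outweigh the energy term despite its factor `M ^ 3`.
  obtain ⟨M, hM⟩ := exists_nat_gt ((D + 1) / (ε / 2 * a))
  have hM0 : (0 : ℝ) < M := lt_of_le_of_lt (by positivity) hM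
  have hMn : 0 < M := by exact_mod_cast hM0
  have hV0 : 0 ≤ V := by
    have : 0 ≤ ∫ x, κ x := integral_nonneg hκnn
    positivity
  have hA : (D + 1) / M ≤ ε / 2 * a := by
    rw [div_lt_iff₀ (by positivity)] at hM
    rw [div_le_iff₀ hM0]
    linarith
  obtain ⟨T, hT⟩ := exists_nat_gt (D * M ^ 3 * (d * (C ^ 2 * V)) / (ε / 2 * a))
  have hT0 : (0 : ℝ) < T := lt_of_le_of_lt (by positivity) hT
  have hB : D * M ^ 3 * (d * (C ^ 2 * V)) ≤ ε / 2 * a * T := by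
    rw [div_lt_iff₀ (by positivity)] at hT
    linarith
  have hstage : ∀ T : ℕ, ∃ u v z X n K,
      Stage i χ κ C R V c a ((D + 1) / M) (D * M ^ 3) T u v z X n K := by
    intro T
    induction T with
    | zero =>
      rw [Nat.cast_zero]
      exact exists_stage_zero i C R a _ (by positivity) (lt_add_one _) (half_lt_self hpos)
    | succ T ih =>
      obtain ⟨u, v, z, X, n, K, S⟩ := ih
      rw [Nat.cast_succ]
      exact S.exists_succ hd0 hij P hχ hχ0 hχnn hχ1 hκ hκ0 hκnn hκ1 hc hMn hD0 hD hR
  obtain ⟨u, v, z, X, n, K, S⟩ := hstage T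
  have haT : 0 < a * T := by positivity
  have hu : BddLip (K * (a * T).toNNReal⁻¹) fun x => u x * (a * T)⁻¹ := by
    refine ⟨LipschitzWith.of_dist_le_mul fun x y => ?_, fun x => ?_⟩
    · rw [Real.dist_eq, ← sub_mul, abs_mul, abs_of_pos (inv_pos.mpr haT), NNReal.coe_mul,
        NNReal.coe_inv, Real.coe_toNNReal _ haT.le, mul_right_comm]
      exact mul_le_mul_of_nonneg_right (S.bddLip_u.lip.dist_le_mul x y) (by positivity)
    · rw [abs_mul, abs_of_pos (inv_pos.mpr haT), NNReal.coe_mul, NNReal.coe_inv,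
        Real.coe_toNNReal _ haT.le]
      exact mul_le_mul_of_nonneg_right (S.bddLip_u.le x) (by positivity)
  refine ⟨fun x => u x * (a * T)⁻¹, ⟨_, hu⟩, ?_, fun f p hf hp => ?_⟩
  · have hχu : Integrable fun x => χ x * u x :=
      (hχ.mul S.bddLip_u).integrable (R := R) fun x hx => by rw [hχ0 x hx, zero_mul]
    -- Duality with `X`, which is bounded by one because `z` is nonnegative.
    have h1 : a * T ≤ ∫ x, |χ x * u x| := by
      refine S.le_integral.trans (integral_mono
        (((hχ.mul S.bddLip_u).mul S.bddLip_X).integrable (R := R) fun x hx => by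
          rw [hχ0 x hx, zero_mul, zero_mul]) hχu.abs fun x => ?_)
      refine (le_abs_self _).trans ?_
      rw [abs_mul]
      exact mul_le_of_le_one_right (abs_nonneg _)
        (by linarith [S.abs_X_add_le x, S.z_nonneg x])
    have h2 : ∀ x, |χ x * (u x * (a * T)⁻¹)| = |χ x * u x| * (a * T)⁻¹ := fun x => by
      rw [← mul_assoc, abs_mul (χ x * u x), abs_of_pos (inv_pos.mpr haT)]
    simp_rw [h2]
    rw [integral_mul_const, ← div_eq_mul_inv, le_div_iff₀ haT, one_mul]
    exact h1
  · have h1 := S.pairing_le f p hf hp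
    have hh : |((1 / 2 : ℝ)) ^ n| ≤ 1 := by
      rw [abs_of_nonneg (by positivity)]
      exact pow_le_one₀ (by norm_num) (by norm_num)
    have h2 := sum_integral_diffQuot_sq_mul_le hh hp i S.bddLip_v S.v_nonneg hκ hκ0 hκnn hκ1
    have h3 : (d : ℝ) * (C ^ 2 * ∫ x, κ x * v x) ≤ d * (C ^ 2 * V) := by
      have := S.integral_κ_lt.le
      gcongr
    have h4 := mul_le_mul_of_nonneg_left (h2.trans h3) (by positivity : 0 ≤ D * (M : ℝ) ^ 3)
    have h5 : (D + 1) / M * T ≤ ε / 2 * a * T := mul_le_mul_of_nonneg_right hA hT0.le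
    have h6 : ∀ x, χ x * (u x * (a * T)⁻¹) * f x * jacDet p x =
        χ x * u x * f x * jacDet p x * (a * T)⁻¹ := fun x => by ring
    simp_rw [h6]
    rw [integral_mul_const, abs_mul, abs_of_pos (inv_pos.mpr haT), ← div_eq_mul_inv,
      div_le_iff₀ haT]
    linarith

end Density

/-! ### Transfer to the cube -/

section Cube

variable {d : ℕ}

theorem norm_le_of_mem_cube {x : EuclideanSpace ℝ (Fin d)} (hx : x ∈ cube d) : ‖x‖ ≤ d := by
  have h1 : ‖x‖ ^ 2 ≤ d := by
    rw [EuclideanSpace.norm_sq_eq]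
    refine (Finset.sum_le_sum fun i _ => ?_).trans_eq (by simp : ∑ _i : Fin d, (1 : ℝ) = d)
    rw [Real.norm_eq_abs, sq_abs]
    exact pow_le_one₀ (hx i).1 (hx i).2
  have h2 : (d : ℝ) ≤ (d : ℝ) ^ 2 := by
    exact_mod_cast Nat.le_self_pow two_ne_zero d
  exact le_of_sq_le_sq (h1.trans h2) (Nat.cast_nonneg d)

theorem zero_mem_cube : (0 : EuclideanSpace ℝ (Fin d)) ∈ cube d := fun i => by simp

theorem IsLip.coord {π : EuclideanSpace ℝ (Fin d) → EuclideanSpace ℝ (Fin d)}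
    (h : IsLip π) (j : Fin d) : IsLip fun x => π x j := by
  obtain ⟨K, hK⟩ := h
  refine ⟨K, LipschitzOnWith.of_dist_le_mul fun x hx y hy => ?_⟩
  refine le_trans ?_ (hK.dist_le_mul x hx y hy)
  rw [Real.dist_eq, dist_eq_norm]
  exact abs_coord_le (π x - π y) j

theorem lipschitzOnWith_of_lipConst_lt {g : EuclideanSpace ℝ (Fin d) → ℝ} (h : IsLip g) {L : ℝ≥0}
    (hL : lipConst g < L) : LipschitzOnWith L g (cube d) := by
  obtain ⟨K, hK, hlt⟩ := exists_lt_of_csInf_lt (s := {K : ℝ≥0 | LipschitzOnWith K g (cube d)}) h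
    (by exact_mod_cast hL)
  exact LipschitzOnWith.weaken hK hlt.le

theorem abs_le_supNorm {g : EuclideanSpace ℝ (Fin d) → ℝ} (h : IsLip g)
    {x : EuclideanSpace ℝ (Fin d)} (hx : x ∈ cube d) : |g x| ≤ supNorm g := by
  obtain ⟨K, hK⟩ := h
  refine le_ciSup (f := fun y : cube d => |g y|) ⟨|g 0| + K * d, ?_⟩ ⟨x, hx⟩
  rintro _ ⟨y, rfl⟩
  have h1 := hK.dist_le_mul y y.2 0 zero_mem_cube
  rw [Real.dist_eq, dist_zero_right] at h1
  have h2 := mul_le_mul_of_nonneg_left (norm_le_of_mem_cube y.2) K.2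
  have h3 := abs_sub_abs_le_abs_sub (g y) (g 0)
  simp only
  have h4 : (K : ℝ) * ‖(y : EuclideanSpace ℝ (Fin d))‖ ≤ K * d := h2
  linarith

theorem lipConst_nonneg (g : EuclideanSpace ℝ (Fin d) → ℝ) : 0 ≤ lipConst g := NNReal.coe_nonneg _

theorem supNorm_nonneg (g : EuclideanSpace ℝ (Fin d) → ℝ) : 0 ≤ supNorm g :=
  Real.iSup_nonneg fun _ => abs_nonneg _

theorem exists_extension_coeff {f : EuclideanSpace ℝ (Fin d) → ℝ} {F : ℝ≥0} (hF : 0 < F)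
    (hf : LipschitzOnWith F f (cube d)) (hf' : ∀ x ∈ cube d, |f x| ≤ F) :
    ∃ g : EuclideanSpace ℝ (Fin d) → ℝ, BddLip 1 g ∧ ∀ x ∈ cube d, f x = F * g x := by
  have hF' : (0 : ℝ) < F := hF
  obtain ⟨g, hg, hfg⟩ := LipschitzOnWith.extend_real (K := 1) (f := fun x => f x / F) (s := cube d)
    (LipschitzOnWith.of_dist_le_mul fun x hx y hy => by
      rw [Real.dist_eq, ← sub_div, abs_div, abs_of_pos hF', div_le_iff₀ hF', NNReal.coe_one,
        one_mul, mul_comm]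
      exact hf.dist_le_mul x hx y hy)
  refine ⟨fun x => max (-1) (min 1 (g x)), ⟨(hg.const_min 1).const_max (-1), fun x => ?_⟩,
    fun x hx => ?_⟩
  · rw [NNReal.coe_one]
    exact abs_le.mpr ⟨le_max_left _ _, max_le (by norm_num) (min_le_left _ _)⟩
  · have h1 : |g x| ≤ 1 := by
      rw [← hfg hx, abs_div, abs_of_pos hF', div_le_one hF']
      exact hf' x hx
    beta_reduce
    rw [min_eq_right (abs_le.mp h1).2, max_eq_right (abs_le.mp h1).1, ← hfg hx]
    field_simp

/-- Only gradients matter, so the component may be normalised to vanish at the origin. Its extension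
is then at most `‖x‖` in size, and truncating it between plus and minus the positive part of `2 * d
- ‖x‖` keeps the constant one, forces bounded support, and changes nothing on the cube, where `‖x‖ ≤
d`. -/
theorem exists_extension_field {q : EuclideanSpace ℝ (Fin d) → ℝ} {b : ℝ≥0} (hb : 0 < b)
    (hq : LipschitzOnWith b q (cube d)) :
    ∃ p : EuclideanSpace ℝ (Fin d) → ℝ, LipSupp 1 (2 * d) p ∧
      ∀ x ∈ cube d, q x = q 0 + b * p x := by
  have hb' : (0 : ℝ) < b := hb
  obtain ⟨g, hg, hqg⟩ := LipschitzOnWith.extend_real (K := 1) (f := fun x => (q x - q 0) / b)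
    (s := cube d)
    (LipschitzOnWith.of_dist_le_mul fun x hx y hy => by
      rw [Real.dist_eq, ← sub_div, sub_sub_sub_cancel_right, abs_div, abs_of_pos hb',
        div_le_iff₀ hb', NNReal.coe_one, one_mul, mul_comm]
      exact hq.dist_le_mul x hx y hy)
  have hψ : LipschitzWith 1 fun x : EuclideanSpace ℝ (Fin d) => max 0 (2 * (d : ℝ) - ‖x‖) := by
    have h1 : LipschitzWith (0 + 1) fun x : EuclideanSpace ℝ (Fin d) => 2 * (d : ℝ) - ‖x‖ :=
      (LipschitzWith.const (2 * (d : ℝ))).sub lipschitzWith_one_norm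
    rw [zero_add] at h1
    exact h1.const_max 0
  have hg0 : g 0 = 0 := by rw [← hqg zero_mem_cube]; simp
  refine ⟨fun x => max (-max 0 (2 * (d : ℝ) - ‖x‖)) (min (g x) (max 0 (2 * (d : ℝ) - ‖x‖))),
    ⟨?_, fun x hx => ?_⟩, fun x hx => ?_⟩
  · have := hψ.neg.max (hg.min hψ)
    simpa using this
  · have h1 : max 0 (2 * (d : ℝ) - ‖x‖) = 0 := max_eq_left (by linarith)
    rw [h1, neg_zero]
    exact max_eq_left (min_le_right _ _)
  · have hx' := norm_le_of_mem_cube hx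
    have h1 : |g x| ≤ 2 * (d : ℝ) - ‖x‖ := by
      have := hg.dist_le_mul x 0
      rw [Real.dist_eq, hg0, sub_zero, dist_zero_right, NNReal.coe_one, one_mul] at this
      linarith
    have h2 := h1.trans (le_max_right 0 _)
    beta_reduce
    rw [min_eq_left (abs_le.mp h2).2, max_eq_right (abs_le.mp h2).1, ← hqg hx]
    field_simp
    ring

theorem jac_eq_prod_mul_jacDet {π : EuclideanSpace ℝ (Fin d) → EuclideanSpace ℝ (Fin d)}
    {p : Fin d → EuclideanSpace ℝ (Fin d) → ℝ} {a b : Fin d → ℝ} {x : EuclideanSpace ℝ (Fin d)}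
    (hx : cube d ∈ 𝓝 x) (hp : ∀ j, DifferentiableAt ℝ (p j) x)
    (h : ∀ y ∈ cube d, ∀ j, π y j = a j + b j * p j y) :
    jac π x = (∏ j, b j) * jacDet p x := by
  have hq : ∀ j, HasFDerivAt (fun y => a j + b j * p j y) (b j • fderiv ℝ (p j) x) x :=
    fun j => ((hp j).hasFDerivAt.const_mul (b j)).const_add (a j)
  have hπ : π =ᶠ[𝓝 x] fun y => WithLp.toLp 2 fun j => a j + b j * p j y := by
    filter_upwards [hx] with y hy
    ext j
    exact h y hy j
  rw [jac, fderivWithin_of_mem_nhds hx, hπ.fderiv_eq,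
    (hasFDerivAt_toLp fun j => (hq j).differentiableAt).fderiv, det_eq_det_matrix, jacDet,
    ← Matrix.det_mul_column]
  congr 1
  ext j i
  simp only [gradMat, Matrix.of_apply]
  rw [← smul_eq_mul, ← smul_apply, ← (hq j).fderiv]
  rfl

/-- The centre of the cube. -/
noncomputable def cubeCenter (d : ℕ) : EuclideanSpace ℝ (Fin d) := WithLp.toLp 2 fun _ => 1 / 2

/-- A Lipschitz bump supported in the interior of the cube. -/
noncomputable def cubeBump (d : ℕ) (x : EuclideanSpace ℝ (Fin d)) : ℝ :=
  max 0 (1 / 4 - ‖x - cubeCenter d‖)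

theorem mem_nhds_of_cubeBump_ne_zero {x : EuclideanSpace ℝ (Fin d)} (hx : cubeBump d x ≠ 0) :
    cube d ∈ 𝓝 x := by
  have h1 : x ∈ Metric.ball (cubeCenter d) (1 / 4) := by
    rw [mem_ball_iff_norm]
    by_contra h
    exact hx (max_eq_left (by linarith))
  refine mem_of_superset (Metric.isOpen_ball.mem_nhds h1) fun y hy i => ?_
  rw [mem_ball_iff_norm] at hy
  have h2 := (abs_coord_le (y - cubeCenter d) i).trans hy.le
  rw [PiLp.sub_apply, show cubeCenter d i = 1 / 2 from rfl, abs_le] at h2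
  constructor <;> linarith [h2.1, h2.2]

theorem cubeBump_eq_zero {x : EuclideanSpace ℝ (Fin d)} (hx : x ∉ cube d) : cubeBump d x = 0 := by
  by_contra h
  exact hx (mem_of_mem_nhds (mem_nhds_of_cubeBump_ne_zero h))

theorem bddLip_cubeBump : BddLip 1 (cubeBump d) := by
  have h1 : LipschitzWith (0 + 1) fun x : EuclideanSpace ℝ (Fin d) =>
      1 / 4 - ‖x - cubeCenter d‖ := by
    refine (LipschitzWith.const (1 / 4 : ℝ)).sub (LipschitzWith.of_dist_le_mul fun x y => ?_)
    rw [NNReal.coe_one, one_mul, dist_eq_norm x y, Real.dist_eq]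
    exact (abs_norm_sub_norm_le _ _).trans_eq (by rw [sub_sub_sub_cancel_right])
  rw [zero_add] at h1
  refine ⟨h1.const_max 0, fun x => ?_⟩
  rw [cubeBump, abs_of_nonneg (le_max_left _ _), NNReal.coe_one]
  exact max_le zero_le_one (by linarith [norm_nonneg (x - cubeCenter d)])

theorem integral_cubeBump_pos : 0 < ∫ x, cubeBump d x := by
  have hint : Integrable (cubeBump d) := bddLip_cubeBump.integrable (R := d) fun x hx =>
    cubeBump_eq_zero fun h => hx.not_ge (norm_le_of_mem_cube h)
  refine (integral_pos_iff_support_of_nonneg (fun x => le_max_left _ _) hint).mpr ?_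
  refine (bddLip_cubeBump.lip.continuous.isOpen_support).measure_pos volume ⟨cubeCenter d, ?_⟩
  simp [cubeBump]

theorem measurableSet_cube : MeasurableSet (cube d) := by
  have : cube d = ⋂ i, (fun x : EuclideanSpace ℝ (Fin d) => x i) ⁻¹' Set.Icc 0 1 := by
    ext x; simp [cube]
  rw [this]
  exact MeasurableSet.iInter fun i =>
    (by fun_prop : Measurable fun x : EuclideanSpace ℝ (Fin d) => x i) measurableSet_Icc

/-- Integrable densities on the cube with unit mass and small pairing against all Lipschitz data. -/
theorem exists_cube_density (hd : 2 ≤ d) {ε : ℝ} (hε : 0 < ε) :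
    ∃ U : EuclideanSpace ℝ (Fin d) → ℝ, Integrable U (cubeVol d) ∧
      1 ≤ ∫ x, |U x| ∂(cubeVol d) ∧
      ∀ (f : EuclideanSpace ℝ (Fin d) → ℝ)
        (π : EuclideanSpace ℝ (Fin d) → EuclideanSpace ℝ (Fin d)), IsLip f → IsLip π →
        Integrable (fun x => U x * f x * jac π x) (cubeVol d) ∧
          |∫ x, U x * f x * jac π x ∂(cubeVol d)| ≤ ε * pairSize f π := by
  have hd0 : 0 < d := by omega
  have hR : (0 : ℝ) ≤ 2 * d := by positivity
  have hχ0 : ∀ x : EuclideanSpace ℝ (Fin d), 2 * (d : ℝ) < ‖x‖ → cubeBump d x = 0 := fun x hx =>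
    cubeBump_eq_zero fun h => by linarith [norm_le_of_mem_cube h, norm_nonneg x]
  obtain ⟨u, ⟨K, hu⟩, hu1, hup⟩ := exists_density hd 1 hR bddLip_cubeBump hχ0
    (fun x => le_max_left _ _) (fun x => by
      simpa using (le_abs_self _).trans (bddLip_cubeBump.le x)) integral_cubeBump_pos hε
  have hχu := bddLip_cubeBump.mul hu
  have hχu0 : ∀ x, 2 * (d : ℝ) < ‖x‖ → cubeBump d x * u x = 0 := fun x hx => by
    rw [hχ0 x hx, zero_mul]
  refine ⟨fun x => cubeBump d x * u x, (hχu.integrable hχu0).restrict, ?_, fun f π hf hπ => ?_⟩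
  · refine hu1.trans_eq (setIntegral_eq_integral_of_forall_compl_eq_zero fun x hx => ?_).symm
    rw [cubeBump_eq_zero hx, zero_mul, abs_zero]
  -- Raising each constant by `δ` makes it positive, so that one may divide by it even when `f` or a
  -- component of `π` is degenerate; afterwards `δ` tends to zero.
  have key : ∀ δ : ℝ≥0, 0 < δ →
      Integrable (fun x => cubeBump d x * u x * f x * jac π x) (cubeVol d) ∧
      |∫ x, cubeBump d x * u x * f x * jac π x ∂(cubeVol d)| ≤
        ε * ((max (lipConst f) (supNorm f) + δ) * ∏ j, (lipConst (fun x => π x j) + δ)) := by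
    intro δ hδ
    have hδ' : (0 : ℝ) < δ := hδ
    obtain ⟨F, hF⟩ : ∃ F : ℝ≥0, (F : ℝ) = max (lipConst f) (supNorm f) + δ :=
      ⟨⟨_, add_nonneg (le_max_of_le_left (lipConst_nonneg f)) δ.2⟩, rfl⟩
    obtain ⟨b, hb⟩ : ∃ b : Fin d → ℝ≥0, ∀ j, (b j : ℝ) = lipConst (fun x => π x j) + δ :=
      ⟨fun j => ⟨_, add_nonneg (lipConst_nonneg _) δ.2⟩, fun j => rfl⟩
    have hF0 : 0 < F := by
      rw [← NNReal.coe_pos, hF]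
      linarith [(lipConst_nonneg f).trans (le_max_left _ (supNorm f))]
    have hb0 : ∀ j, 0 < b j := fun j => by
      rw [← NNReal.coe_pos, hb]
      linarith [lipConst_nonneg fun x => π x j]
    obtain ⟨g, hg, hfg⟩ := exists_extension_coeff hF0
      (lipschitzOnWith_of_lipConst_lt hf (by rw [hF]; linarith [le_max_left (lipConst f) (supNorm f)]))
      (fun x hx => (abs_le_supNorm hf hx).trans
        (by rw [hF]; linarith [le_max_right (lipConst f) (supNorm f)]))
    choose p hp hpπ using fun j => exists_extension_field (hb0 j)
      (lipschitzOnWith_of_lipConst_lt (hπ.coord j)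
        (by rw [hb]; linarith : lipConst (fun x => π x j) < b j))
    set P : ℝ := F * ∏ j, (b j : ℝ) with hP
    have hP0 : 0 ≤ P := mul_nonneg F.2 (Finset.prod_nonneg fun j _ => (b j).2)
    have hint : Integrable fun x => cubeBump d x * u x * g x * jacDet p x :=
      integrable_mul_jacDet hd0 hR (fun j => (hp j).lip)
        ((hχu.mul hg).lipSupp fun x hx => by rw [hχu0 x hx, zero_mul])
    have hae : ∀ᵐ x ∂(cubeVol d), P * (cubeBump d x * u x * g x * jacDet p x) =
        cubeBump d x * u x * f x * jac π x := by
      rw [cubeVol, ae_restrict_iff' measurableSet_cube]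
      filter_upwards [ae_differentiableAt_all fun j => (hp j).lip] with x hx hxc
      -- Where the bump is nonzero the cube is a neighbourhood of the point, so the derivative
      -- within the cube is the full derivative of the extension.
      by_cases h0 : cubeBump d x = 0
      · simp [h0]
      · rw [jac_eq_prod_mul_jacDet (mem_nhds_of_cubeBump_ne_zero h0) hx fun y hy j => hpπ j y hy,
          hfg x hxc, hP]
        ring
    refine ⟨(hint.restrict.const_mul P).congr hae, ?_⟩
    rw [← integral_congr_ae hae, integral_const_mul, abs_mul, abs_of_nonneg hP0]
    have h1 : ∫ x, cubeBump d x * u x * g x * jacDet p x ∂(cubeVol d) =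
        ∫ x, cubeBump d x * u x * g x * jacDet p x :=
      setIntegral_eq_integral_of_forall_compl_eq_zero fun x hx => by
        rw [cubeBump_eq_zero hx]; simp
    rw [h1, mul_comm ε]
    refine (mul_le_mul_of_nonneg_left (hup g p hg hp) hP0).trans_eq ?_
    rw [hP, hF]
    simp_rw [hb]
  refine ⟨(key 1 one_pos).1, ?_⟩
  have hcont : Continuous fun δ : ℝ => ε * ((max (lipConst f) (supNorm f) + δ) *
      ∏ j, (lipConst (fun x => π x j) + δ)) := by fun_prop
  have hlim := (hcont.tendsto 0).mono_left (nhdsWithin_le_nhds (s := Set.Ioi 0))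
  simp only [add_zero] at hlim
  refine ge_of_tendsto hlim ?_
  filter_upwards [self_mem_nhdsWithin] with δ hδ
  exact (key ⟨δ, le_of_lt hδ⟩ hδ).2

theorem strongNonRegularity (hd : 2 ≤ d) : StrongNonRegularity d := by
  have h : ∀ n : ℕ, ∃ U : EuclideanSpace ℝ (Fin d) → ℝ, 1 ≤ n → Integrable U (cubeVol d) ∧
      1 ≤ ∫ x, |U x| ∂(cubeVol d) ∧
      ∀ (f : EuclideanSpace ℝ (Fin d) → ℝ)
        (π : EuclideanSpace ℝ (Fin d) → EuclideanSpace ℝ (Fin d)), IsLip f → IsLip π →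
          pairSize f π ≤ 1 → |∫ x, U x * f x * jac π x ∂(cubeVol d)| ≤ 1 / (n : ℝ) := by
    intro n
    rcases Nat.eq_zero_or_pos n with rfl | hn
    · exact ⟨0, fun h => absurd h (by norm_num)⟩
    · have hn' : (0 : ℝ) < 1 / n := by positivity
      obtain ⟨U, h1, h2, h3⟩ := exists_cube_density hd hn'
      exact ⟨U, fun _ => ⟨h1, h2, fun f π hf hπ hs =>
        (h3 f π hf hπ).2.trans (mul_le_of_le_one_right hn'.le hs)⟩⟩
  choose u hu using h
  exact ⟨u, hu⟩

end Cube

/-! ### Nonexistence of solutions by duality -/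

section Duality

variable {d : ℕ}

theorem pairSize_nonneg (f : EuclideanSpace ℝ (Fin d) → ℝ)
    (π : EuclideanSpace ℝ (Fin d) → EuclideanSpace ℝ (Fin d)) : 0 ≤ pairSize f π :=
  mul_nonneg ((supNorm_nonneg f).trans (le_max_right _ _))
    (Finset.prod_nonneg fun _ _ => lipConst_nonneg _)

theorem tendsto_integral_mul_of_eLpNorm_top {α : Type*} [MeasurableSpace α] {μ : Measure α}
    {U ρ : α → ℝ} {S : ℕ → α → ℝ} (hU : Integrable U μ) (hρ : Integrable (fun x => U x * ρ x) μ)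
    (hS : ∀ N, Integrable (fun x => U x * S N x) μ)
    (h : Tendsto (fun N => eLpNorm (fun x => S N x - ρ x) ∞ μ) atTop (𝓝 0)) :
    Tendsto (fun N => ∫ x, U x * S N x ∂μ) atTop (𝓝 (∫ x, U x * ρ x ∂μ)) := by
  rw [tendsto_iff_dist_tendsto_zero]
  have h1 : Tendsto (fun N => (eLpNorm (fun x => S N x - ρ x) ∞ μ).toReal * ∫ x, |U x| ∂μ) atTop
      (𝓝 0) := by
    have := ((ENNReal.tendsto_toReal ENNReal.zero_ne_top).comp h).mul_const (∫ x, |U x| ∂μ)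
    simpa using this
  refine squeeze_zero' (Eventually.of_forall fun _ => dist_nonneg) ?_ h1
  filter_upwards [h.eventually_lt_const ENNReal.zero_lt_top] with N hN
  rw [dist_eq_norm, ← integral_sub (hS N) hρ, ← integral_const_mul]
  refine norm_integral_le_of_norm_le (hU.abs.const_mul _) ?_
  rw [eLpNorm_exponent_top] at hN ⊢
  filter_upwards [ae_le_eLpNormEssSup (f := fun x => S N x - ρ x) (μ := μ)] with x hx
  rw [← mul_sub, norm_mul, mul_comm, Real.norm_eq_abs (U x)]
  refine mul_le_mul_of_nonneg_right ?_ (abs_nonneg _)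
  rw [← toReal_enorm]
  exact ENNReal.toReal_mono hN.ne hx

theorem abs_integral_mul_le_tsum {U ρ : EuclideanSpace ℝ (Fin d) → ℝ} {ε : ℝ} (hε : 0 ≤ ε)
    (hU : Integrable U (cubeVol d))
    (h : ∀ (f : EuclideanSpace ℝ (Fin d) → ℝ)
      (π : EuclideanSpace ℝ (Fin d) → EuclideanSpace ℝ (Fin d)), IsLip f → IsLip π →
      Integrable (fun x => U x * f x * jac π x) (cubeVol d) ∧
        |∫ x, U x * f x * jac π x ∂(cubeVol d)| ≤ ε * pairSize f π)
    (hρ : MemLp ρ ∞ (cubeVol d)) {f : ℕ → EuclideanSpace ℝ (Fin d) → ℝ}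
    {π : ℕ → EuclideanSpace ℝ (Fin d) → EuclideanSpace ℝ (Fin d)}
    (S : IsLipschitzSolution ρ f π) :
    |∫ x, U x * ρ x ∂(cubeVol d)| ≤ ε * ∑' i, pairSize (f i) (π i) := by
  have hI := fun i => h (f i) (π i) (S.lip_coeff i) (S.lip_field i)
  have hpt : ∀ N : ℕ, (fun x => U x * ∑ i ∈ Finset.range N, f i x * jac (π i) x) =
      fun x => ∑ i ∈ Finset.range N, U x * f i x * jac (π i) x := fun N => by
    funext x
    rw [Finset.mul_sum]
    exact Finset.sum_congr rfl fun i _ => (mul_assoc _ _ _).symm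
  have hlim := tendsto_integral_mul_of_eLpNorm_top hU (hU.mul_of_top_left hρ)
    (fun N => by
      rw [hpt]
      exact integrable_finsetSum _ fun i _ => (hI i).1) S.conv
  refine le_of_tendsto hlim.abs (Eventually.of_forall fun N => ?_)
  rw [hpt, integral_finsetSum _ fun i _ => (hI i).1]
  calc _ ≤ ∑ i ∈ Finset.range N, ε * pairSize (f i) (π i) :=
        (Finset.abs_sum_le_sum_abs _ _).trans (Finset.sum_le_sum fun i _ => (hI i).2)
    _ = ε * ∑ i ∈ Finset.range N, pairSize (f i) (π i) := (Finset.mul_sum _ _ _).symm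
    _ ≤ _ := mul_le_mul_of_nonneg_left
        (S.finite_size.sum_le_tsum _ fun i _ => pairSize_nonneg _ _) hε

theorem exists_unit_memLp_top_mul_eq_abs {α : Type*} [MeasurableSpace α] {μ : Measure α} {U : α → ℝ}
    (hU : AEStronglyMeasurable U μ) : ∃ s : α → ℝ, MemLp s ∞ μ ∧ eLpNorm s ∞ μ ≤ 1 ∧
      ∀ x, U x * s x = |U x| := by
  have hm : AEStronglyMeasurable (fun x => U x / |U x|) μ :=
    (hU.aemeasurable.div hU.aemeasurable.abs).aestronglyMeasurable
  have hb : eLpNorm (fun x => U x / |U x|) ∞ μ ≤ 1 := by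
    rw [eLpNorm_exponent_top, ← ENNReal.ofReal_one]
    refine eLpNormEssSup_le_of_ae_bound (Eventually.of_forall fun x => ?_)
    rw [Real.norm_eq_abs, abs_div, abs_abs]
    exact div_self_le_one _
  refine ⟨_, ⟨hm, hb.trans_lt ENNReal.one_lt_top⟩, hb, fun x => ?_⟩
  rcases eq_or_ne (U x) 0 with h | h
  · simp [h]
  · rw [mul_div_assoc', ← abs_mul_abs_self, mul_div_assoc, div_self (abs_ne_zero.mpr h), mul_one]

/-- If every bounded `ρ` had a solution, its total size would bound all the functionals `g n` at
`ρ`. Uniform boundedness would then bound their norms, but testing `g n` on the sign of `U n` gives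
at least `n + 1`. -/
theorem exists_memLp_not_isLipschitzSolution (hd : 2 ≤ d) :
    ∃ ρ : EuclideanSpace ℝ (Fin d) → ℝ, MemLp ρ ∞ (cubeVol d) ∧
      ¬ ∃ (f : ℕ → EuclideanSpace ℝ (Fin d) → ℝ)
        (π : ℕ → EuclideanSpace ℝ (Fin d) → EuclideanSpace ℝ (Fin d)),
        IsLipschitzSolution ρ f π := by
  by_contra! hcon
  choose U hU hU1 hUp using fun n : ℕ =>
    exists_cube_density hd (by positivity : (0 : ℝ) < 1 / ((n : ℝ) + 1))
  have hmem : ∀ n, MemLp (U n) 1 (cubeVol d) := fun n => memLp_one_iff_integrable.mpr (hU n)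
  -- The factor `n + 1` cancels the smallness `1 / (n + 1)` of the pairing of `U n`, leaving a
  -- pointwise bound independent of `n`.
  set g : ℕ → Lp ℝ ∞ (cubeVol d) →L[ℝ] ℝ := fun n => ((n : ℝ) + 1) •
    (ContinuousLinearMap.mul ℝ ℝ).lpPairing (cubeVol d) 1 ∞ ((hmem n).toLp (U n)) with hg
  have hgval : ∀ n (s : EuclideanSpace ℝ (Fin d) → ℝ) (hs : MemLp s ∞ (cubeVol d)),
      g n (hs.toLp s) = ((n : ℝ) + 1) * ∫ x, U n x * s x ∂(cubeVol d) := by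
    intro n s hs
    simp only [hg, smul_apply, smul_eq_mul]
    rw [ContinuousLinearMap.lpPairing_eq_integral]
    congr 1
    refine integral_congr_ae ?_
    filter_upwards [(hmem n).coeFn_toLp, hs.coeFn_toLp] with x h1 h2
    rw [h1, h2, ContinuousLinearMap.mul_apply']
  obtain ⟨C, hC⟩ := banach_steinhaus (g := g) fun ρ => by
    obtain ⟨f, π, S⟩ := hcon ρ (Lp.memLp ρ)
    refine ⟨∑' i, pairSize (f i) (π i), fun n => ?_⟩
    have h1 := abs_integral_mul_le_tsum (by positivity) (hU n) (hUp n) (Lp.memLp ρ) S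
    have h2 := hgval n ρ (Lp.memLp ρ)
    rw [Lp.toLp_coeFn] at h2
    have hn : (0 : ℝ) < n + 1 := by positivity
    rw [h2, norm_mul, Real.norm_of_nonneg hn.le, Real.norm_eq_abs]
    calc _ ≤ ((n : ℝ) + 1) * (1 / (n + 1) * ∑' i, pairSize (f i) (π i)) :=
          mul_le_mul_of_nonneg_left h1 hn.le
      _ = _ := by field_simp
  obtain ⟨n, hn⟩ := exists_nat_gt C
  obtain ⟨s, hs, hs1, hUs⟩ := exists_unit_memLp_top_mul_eq_abs (hU n).1
  have hnorm : ‖hs.toLp s‖ ≤ 1 := by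
    rw [Lp.norm_toLp]
    exact ENNReal.toReal_le_of_le_ofReal zero_le_one (by rwa [ENNReal.ofReal_one])
  have h1 := (g n).le_of_opNorm_le_of_le (hC n) hnorm
  rw [hgval, mul_one] at h1
  simp_rw [hUs] at h1
  have h2 := (le_abs_self _).trans h1
  have h3 := mul_le_mul_of_nonneg_left (hU1 n) (by positivity : (0 : ℝ) ≤ n + 1)
  linarith

theorem lipConst_zero : lipConst (fun _ : EuclideanSpace ℝ (Fin d) => (0 : ℝ)) = 0 := by
  rw [lipConst, NNReal.coe_eq_zero]
  exact le_antisymm (csInf_le (OrderBot.bddBelow _)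
    ((LipschitzWith.const (0 : ℝ)).lipschitzOnWith)) zero_le

theorem pairSize_zero (π : EuclideanSpace ℝ (Fin d) → EuclideanSpace ℝ (Fin d)) :
    pairSize (fun _ => 0) π = 0 := by
  simp [pairSize, lipConst_zero, supNorm]

/-- A single Jacobian is a series whose coefficient is `1` at index `0` and `0` afterwards; the zero
coefficients have size zero, so the same `π` may be repeated. -/
theorem IsJacobianSolution.isLipschitzSolution {ρ : EuclideanSpace ℝ (Fin d) → ℝ}
    {π : EuclideanSpace ℝ (Fin d) → EuclideanSpace ℝ (Fin d)} (h : IsJacobianSolution ρ π)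
    (hρ : MemLp ρ ∞ (cubeVol d)) :
    IsLipschitzSolution ρ (fun i _ => if i = 0 then 1 else 0) fun _ => π where
  lip_coeff i := ⟨0, (LipschitzWith.const _).lipschitzOnWith⟩
  lip_field _ := h.1
  finite_size := summable_of_ne_finset_zero (s := {0}) fun i hi => by
    have : i ≠ 0 := by simpa using hi
    simp [this, pairSize_zero]
  abs_conv := by
    rw [tsum_eq_single 0 fun i hi => by
      simp only [hi, if_false, zero_mul]
      exact eLpNorm_zero]
    simp only [if_true, one_mul]
    rw [eLpNorm_congr_ae h.2]
    exact hρ.2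
  conv := by
    refine tendsto_const_nhds.congr' ?_
    filter_upwards [eventually_ge_atTop 1] with N hN
    rw [eq_comm, ← eLpNorm_zero (α := EuclideanSpace ℝ (Fin d)) (ε := ℝ) (p := ∞)
      (μ := cubeVol d)]
    refine eLpNorm_congr_ae ?_
    filter_upwards [h.2] with x hx
    have h0 : 0 ∈ Finset.range N := Finset.mem_range.mpr hN
    simp [ite_mul, Finset.sum_ite_eq', h0, hx]

end Duality

end PrescribedJacobian

theorem theorem1p1 (d : ℕ) (hd : 2 ≤ d) :
    PrescribedJacobian.StrongNonRegularity d ∧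
    ∃ ρ : EuclideanSpace ℝ (Fin d) → ℝ,
      MemLp ρ ∞ (PrescribedJacobian.cubeVol d) ∧
      (¬ ∃ (f : ℕ → EuclideanSpace ℝ (Fin d) → ℝ)
          (π : ℕ → EuclideanSpace ℝ (Fin d) → EuclideanSpace ℝ (Fin d)),
          PrescribedJacobian.IsLipschitzSolution ρ f π) ∧
      (¬ ∃ π : EuclideanSpace ℝ (Fin d) → EuclideanSpace ℝ (Fin d),
          PrescribedJacobian.IsJacobianSolution ρ π) := by
  obtain ⟨ρ, hρ, hno⟩ := PrescribedJacobian.exists_memLp_not_isLipschitzSolution hd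
  exact ⟨PrescribedJacobian.strongNonRegularity hd, ρ, hρ, hno,
    fun ⟨_, h⟩ => hno ⟨_, _, h.isLipschitzSolution hρ⟩⟩
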